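/- **Setting.** Let $X_1,\dots,X_{n_x}\sim\mu$ i.i.d. and $Y_1,\dots,Y_{n_y}\sim\nu$ i.i.d. be two independent samples in $\mathbb R^d$, $n=n_x+n_y$. Split $\{1,\dots,n_x\}=I_X^{fit}\sqcup I_X^{test}$ and $\{1,\dots,n_y\}=I_Y^{fit}\sqcup I_Y^{test}$, let $\mathcal D_{fit}$ be the observations with fitting indices, and let $a=|I_X^{test}|$, $b=|I_Y^{test}|$. Let $\mathcal N(D,\mathbf p,s,B)$ be the class of real-valued ReLU networks with $D$ hidden layers, widths $\mathbf p=(k,p_1,\dots,p_D,1)$, weights and biases in $[-1,1]$, at most $s$ of them nonzero, and sup norm at most $B$. For $j=1,\dots,m$ ($m\ge 1$ fixed) let $\hat g_j(x)=\hat f_j(\hat U_j^\top x)$, where $\hat U_j\in\mathbb R^{d\times k_j}$ with $\hat U_j^\top\hat U_j=I_{k_j}$ and $\hat f_j\in\mathcal N(D_j,\mathbf p_j,s_j,B_j)$ are computed from $\mathcal D_{fit}$ by an arbitrary measurable rule. Put $$\hat S_{n,j}=\frac1a\sum_{i\in I_X^{test}}\hat g_j(X_i)-\frac1b\sum_{i\in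 I_Y^{test}}\hat g_j(Y_i),\qquad \Sigma=\mathrm{Var}\Big\{\Big(\tfrac{ab}{a+b}\Big)^{1/2}\hat S_n\,\Big|\,\mathcal D_{fit}\Big\},\qquad \hat\Sigma=\tfrac{b}{a+b}\hat C_X+\tfrac{a}{a+b}\hat C_Y,$$ where $\hat C_X$ (with divisor $a$) and $\hat C_Y$ (with divisor $b$) are the empirical covariance matrices of $(\hat g_1,\dots,\hat g_m)$ over the two test samples, and $$T_n=\max_{1\le j\le m}\Big(\frac{ab}{a+b}\Big)^{1/2}\big|e_j^\top\hat\Sigma^{-1/2}\hat S_n\big|$$ (with the pseudo-inverse of $\hat\Sigma^{1/2}$ where $\hat\Sigma$ is singular). Let $Z\sim N(0,I_m)$. **Assumptions.** Fix constants $0<c_1\le c_2<1$ and $0<c_1',c_2'<\infty$. (0) $H_0$: $\mu=\nu$. (1) $n_x/n$, $|I_X^{fit}|/n_x$ and $|I_Y^{fit}|/n_y$ lie in $[c_1,c_2]$. (2) Almost surely $c_1'\le\lambda_{\min}(\Sigma)\le\lambda_{\max}(\Sigma)\le c_2'$. **Theorem.** (i) Consider a sequence of such experiments with $n\to\infty$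 that all satisfy (0)–(2) with the same $m$ and constants; $d$, $\mu$, the split, $k_j$, $D_j$, $\mathbf p_j$, $s_j$, $B_j$ and the learning rule may change along the sequence. If the network bounds satisfy $B_j=o(\sqrt n)$ for every $j$ (for example, if they are bounded), then $T_n\to\max_{j}|Z_j|$ in distribution. (ii) There is a constant $c>0$, depending only on $m,c_1,c_2,c_1',c_2'$, such that for every such experiment that satisfies (0)–(2) and every $M_n>0$ with $$\mathbb E\big[e^{\hat g_j(X)^2/M_n^2}\mid\mathcal D_{fit}\big]\le2,\qquad \mathbb E\big[e^{\hat g_j(Y)^2/M_n^2}\mid\mathcal D_{fit}\big]\le2\quad\text{a.s.},\ j=1,\dots,m,$$ one has $$\sup_{t\in\mathbb R}\Big|\mathbb P(T_n\le t)-\mathbb P\big(\max_j|Z_j|\le t\big)\Big|\le c\,\frac{G_n}{\sqrt n}+c\,\frac{M_n^2\log n}{\sqrt n},\qquad G_n=\max_{j}\mathbb E\big(|\hat g_j(X)|^3+|\hat g_j(Y)|^3\big).$$ Here $X\sim\mu$ and $Y\sim\nu$ are draws independent of $\mathcal D_{fit}$. -/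

import Mathlib

open MeasureTheory ProbabilityTheory Filter Topology
open scoped Matrix

universe u

namespace NeuralTwoSample

noncomputable section

/-- Weight matrices and bias vectors of a fully connected network with layer widths
`p 0, p 1, p 2, …`. Only the layers `0, …, D` matter for a network with `D` hidden layers. -/
structure NetParams (p : ℕ → ℕ) where
  /-- weight matrices -/
  A : ∀ l : ℕ, Matrix (Fin (p (l + 1))) (Fin (p l)) ℝ
  /-- bias vectors -/
  b : ∀ l : ℕ, Fin (p (l + 1)) → ℝ

/-- `θ.layer l = L_l ∘ σ ∘ L_{l-1} ∘ ⋯ ∘ σ ∘ L_0` with `L_i x = A_i x + b_i` and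
`σ` the coordinatewise rectifier `max (·) 0`. -/
def NetParams.layer {p : ℕ → ℕ} (θ : NetParams p) :
    (l : ℕ) → (Fin (p 0) → ℝ) → (Fin (p (l + 1)) → ℝ)
  | 0, x => θ.A 0 *ᵥ x + θ.b 0
  | l + 1, x => θ.A (l + 1) *ᵥ (fun i => max (θ.layer l x i) 0) + θ.b (l + 1)

/-- The class `𝒩(D, p, s, B)` of real-valued ReLU networks with `D` hidden layers, widths
`p 0, …, p (D + 1) = 1`, all weights and biases in `[-1, 1]`, at most `s` nonzero weights and
biases, and sup norm at most `B`. -/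
def ReLUClass (D : ℕ) (p : ℕ → ℕ) (s : ℕ) (B : ℝ) : Set ((Fin (p 0) → ℝ) → ℝ) :=
  {f | p (D + 1) = 1 ∧ ∃ θ : NetParams p,
    (∀ x, ∀ i : Fin (p (D + 1)), f x = θ.layer D x i) ∧
    (∀ l ≤ D, (∀ i j, |θ.A l i j| ≤ 1) ∧ ∀ i, |θ.b l i| ≤ 1) ∧
    (∑ l ∈ Finset.range (D + 1),
      ({ij : Fin (p (l + 1)) × Fin (p l) | θ.A l ij.1 ij.2 ≠ 0}.ncard +
        {i : Fin (p (l + 1)) | θ.b l i ≠ 0}.ncard)) ≤ s ∧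
    ∀ x, |f x| ≤ B}

/-- The Stiefel manifold of `d × k` matrices with orthonormal columns. -/
def Stiefel (d k : ℕ) : Set (Matrix (Fin d) (Fin k) ℝ) := {U | Uᵀ * U = 1}

/-- Two independent i.i.d. samples `X_1, …, X_{nx} ∼ μ` and `Y_1, …, Y_{ny} ∼ ν` in `ℝ^d`, with
the indices of each sample split into a fitting part and its complement, the test part. -/
structure TwoSample where
  /-- dimension of the observations -/
  d : ℕ
  /-- size of the first sample -/
  nx : ℕ
  /-- size of the second sample -/
  ny : ℕ
  /-- fitting indices of the first sample -/
  fitX : Finset (Fin nx)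
  /-- fitting indices of the second sample -/
  fitY : Finset (Fin ny)
  /-- sample space -/
  Ω : Type u
  [mΩ : MeasurableSpace Ω]
  /-- probability on the sample space -/
  P : Measure Ω
  [hP : IsProbabilityMeasure P]
  /-- law of the first population -/
  μ : Measure (Fin d → ℝ)
  /-- law of the second population -/
  ν : Measure (Fin d → ℝ)
  [hμ : IsProbabilityMeasure μ]
  [hν : IsProbabilityMeasure ν]
  /-- first sample -/
  X : Fin nx → Ω → (Fin d → ℝ)
  /-- second sample -/
  Y : Fin ny → Ω → (Fin d → ℝ)
  measurable_X : ∀ i, Measurable (X i)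
  measurable_Y : ∀ i, Measurable (Y i)
  law_X : ∀ i, P.map (X i) = μ
  law_Y : ∀ i, P.map (Y i) = ν
  indep : iIndepFun (fun i : Fin nx ⊕ Fin ny => Sum.elim X Y i) P

attribute [instance] TwoSample.mΩ TwoSample.hP TwoSample.hμ TwoSample.hν

namespace TwoSample

/-- Total sample size. -/
def n (S : TwoSample.{u}) : ℕ := S.nx + S.ny

/-- Number of observations of the first sample in the test part. -/
def nxTest (S : TwoSample.{u}) : ℕ := (S.fitXᶜ).card

/-- Number of observations of the second sample in the test part. -/
def nyTest (S : TwoSample.{u}) : ℕ := (S.fitYᶜ).card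

/-- Possible values of the fitting data. -/
abbrev FitSpace (S : TwoSample.{u}) : Type :=
  (S.fitX → (Fin S.d → ℝ)) × (S.fitY → (Fin S.d → ℝ))

/-- The fitting data. -/
def fitData (S : TwoSample.{u}) (ω : S.Ω) : S.FitSpace :=
  (fun i => S.X i ω, fun j => S.Y j ω)

/-- The σ-algebra generated by the fitting data. -/
abbrev fitAlgebra (S : TwoSample.{u}) : MeasurableSpace S.Ω :=
  MeasurableSpace.comap S.fitData inferInstance

/-- The null hypothesis. -/
def Null (S : TwoSample.{u}) : Prop := S.μ = S.ν

/-- The sample-size ratios are bounded away from `0` and `1`. -/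
def SizesBalanced (S : TwoSample.{u}) (c₁ c₂ : ℝ) : Prop :=
  (S.nx : ℝ) / S.n ∈ Set.Icc c₁ c₂ ∧
  (S.fitX.card : ℝ) / S.nx ∈ Set.Icc c₁ c₂ ∧
  (S.fitY.card : ℝ) / S.ny ∈ Set.Icc c₁ c₂

end TwoSample

/-- A rule that learns from the fitting data, for each of `m` hyperparameters, a projection
`Û_j` in the Stiefel manifold (with `k_j = p_j 0` columns) and a ReLU network `f̂_j`.
The rule is arbitrary up to measurability: `Û_j` and `f̂_j` may be any (constrained) maximizers of
empirical criteria on the fitting data, or the output of any other algorithm. -/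
structure Learner (S : TwoSample.{u}) (m : ℕ) where
  /-- number of hidden layers -/
  D : Fin m → ℕ
  /-- layer widths -/
  p : Fin m → ℕ → ℕ
  /-- bound on the number of nonzero network parameters -/
  s : Fin m → ℕ
  /-- bound on the sup norm of the networks -/
  B : Fin m → ℝ
  /-- learned projections -/
  U : ∀ j, S.FitSpace → Matrix (Fin S.d) (Fin (p j 0)) ℝ
  /-- learned networks -/
  f : ∀ j, S.FitSpace → (Fin (p j 0) → ℝ) → ℝ
  U_mem : ∀ j z, U j z ∈ Stiefel S.d (p j 0)
  f_mem : ∀ j z, f j z ∈ ReLUClass (D j) (p j) (s j) (B j)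
  measurable_witness : ∀ j, Measurable fun zx : S.FitSpace × (Fin S.d → ℝ) =>
    f j zx.1 ((U j zx.1)ᵀ *ᵥ zx.2)

namespace Learner

variable {S : TwoSample.{u}} {m : ℕ}

/-- The witness `ĝ_j(x) = f̂_j(Û_jᵀ x)` learned from the fitting data at `ω`. -/
def g (L : Learner S m) (j : Fin m) (ω : S.Ω) (x : Fin S.d → ℝ) : ℝ :=
  L.f j (S.fitData ω) ((L.U j (S.fitData ω))ᵀ *ᵥ x)

/-- Mean of `ĝ_j` over the test part of the first sample. -/
def meanX (L : Learner S m) (j : Fin m) (ω : S.Ω) : ℝ :=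
  (1 / (S.nxTest : ℝ)) * ∑ i ∈ S.fitXᶜ, L.g j ω (S.X i ω)

/-- Mean of `ĝ_j` over the test part of the second sample. -/
def meanY (L : Learner S m) (j : Fin m) (ω : S.Ω) : ℝ :=
  (1 / (S.nyTest : ℝ)) * ∑ i ∈ S.fitYᶜ, L.g j ω (S.Y i ω)

/-- The statistic `S_n(ĝ_j)`. -/
def stat (L : Learner S m) (ω : S.Ω) (j : Fin m) : ℝ := L.meanX j ω - L.meanY j ω

/-- The factor `(nxTest * nyTest / (nxTest + nyTest))^{1/2}`. -/
def scale (S : TwoSample.{u}) : ℝ :=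
  √((S.nxTest : ℝ) * S.nyTest / (S.nxTest + S.nyTest))

/-- The conditional covariance matrix of the scaled vector of statistics given the fitting
data. -/
def condCov (L : Learner S m) (ω : S.Ω) : Matrix (Fin m) (Fin m) ℝ :=
  Matrix.of fun j k =>
    (S.P[fun ω' =>
      (scale S * L.stat ω' j - (S.P[fun η => scale S * L.stat η j | S.fitAlgebra]) ω') *
      (scale S * L.stat ω' k - (S.P[fun η => scale S * L.stat η k | S.fitAlgebra]) ω')
      | S.fitAlgebra]) ω

/-- The conditional covariance matrix (which is symmetric) has, almost surely, all its
eigenvalues in `[c₁', c₂']`. -/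
def WellConditioned (L : Learner S m) (c₁' c₂' : ℝ) : Prop :=
  ∀ᵐ ω ∂S.P, spectrum ℝ (L.condCov ω) ⊆ Set.Icc c₁' c₂'

/-- The sample estimate `Σ̂` of the conditional covariance matrix. -/
def sampleCov (L : Learner S m) (ω : S.Ω) : Matrix (Fin m) (Fin m) ℝ :=
  Matrix.of fun j k =>
    (S.nyTest : ℝ) / (S.nxTest + S.nyTest) * ((1 / (S.nxTest : ℝ)) * ∑ i ∈ S.fitXᶜ,
      (L.g j ω (S.X i ω) - L.meanX j ω) * (L.g k ω (S.X i ω) - L.meanX k ω)) +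
    (S.nxTest : ℝ) / (S.nxTest + S.nyTest) * ((1 / (S.nyTest : ℝ)) * ∑ i ∈ S.fitYᶜ,
      (L.g j ω (S.Y i ω) - L.meanY j ω) * (L.g k ω (S.Y i ω) - L.meanY k ω))

/-- `A^{-1/2}` for a positive semidefinite matrix `A`, by functional calculus (for singular `A`,
where `A^{-1/2}` does not exist, the pseudo-inverse of the square root). -/
def invSqrt (A : Matrix (Fin m) (Fin m) ℝ) : Matrix (Fin m) (Fin m) ℝ :=
  cfc (fun t : ℝ => (√t)⁻¹) A

/-- The aggregated max statistic `T_n`. -/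
def maxStat (L : Learner S m) (ω : S.Ω) : ℝ :=
  ⨆ j : Fin m, scale S * |(invSqrt (L.sampleCov ω) *ᵥ L.stat ω) j|

/-- The conditional expectation, given the fitting data, of `h (ĝ_j(X))` for a draw `X ∼ ρ`
independent of the fitting data. -/
def condExpWitness (L : Learner S m) (ρ : Measure (Fin S.d → ℝ)) (h : ℝ → ℝ) (j : Fin m)
    (ω : S.Ω) : ℝ :=
  ∫ x, h (L.g j ω x) ∂ρ

/-- Conditional sub-Gaussianity of all the witnesses with parameter `M`. -/
def SubGaussian (L : Learner S m) (M : ℝ) : Prop :=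
  ∀ j, ∀ᵐ ω ∂S.P,
    L.condExpWitness S.μ (fun y => Real.exp (y ^ 2 / M ^ 2)) j ω ≤ 2 ∧
    L.condExpWitness S.ν (fun y => Real.exp (y ^ 2 / M ^ 2)) j ω ≤ 2

/-- `G_n = max_j E(|ĝ_j(X)|³ + |ĝ_j(Y)|³)` for draws `X ∼ μ`, `Y ∼ ν` independent of the fitting
data. -/
def thirdMoment (L : Learner S m) : ℝ :=
  ⨆ j : Fin m, ∫ ω, (L.condExpWitness S.μ (fun y => |y| ^ 3) j ω +
    L.condExpWitness S.ν (fun y => |y| ^ 3) j ω) ∂S.P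

end Learner

/-- The law `N(0, I_m)`. -/
def stdNormal (m : ℕ) : Measure (Fin m → ℝ) := Measure.pi fun _ => gaussianReal 0 1

instance (m : ℕ) : IsProbabilityMeasure (stdNormal m) := by
  unfold stdNormal; infer_instance

/-- `max_j |z_j|`. -/
def maxAbs {m : ℕ} (z : Fin m → ℝ) : ℝ := ⨆ j, |z j|

end

end NeuralTwoSample

namespace NeuralTwoSample

noncomputable section

/-! Given the fitting data the witnesses are fixed functions `g j`, while the test observations stay
independent with their original laws. By Fubini (`integral_fitData_toTest`) it suffices to bound the
distance of distribution functions for fixed bounded `g` and to average the bound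
(`Learner.abs_real_maxStat_sub_le`). Under the null the scaled mean difference is `∑ wᵢ (g(obsᵢ) - E
g)` with `∑ wᵢ² = 1` and `|wᵢ| = O(n^{-1/2})`. Hence its conditional covariance is the covariance
matrix `Σ` of the witnesses under `μ` (`Learner.condCov_ae_eq`), and the eigenvalue assumption
speaks about this matrix.

Let `W` be `Σ^{-1/2}` applied to the scaled mean difference: a weighted sum of i.i.d. standardized
vectors. The event `max |W_j| ≤ t` is a box event, so a multivariate Berry–Esseen bound on boxes is
what is needed (`exists_berryEsseen_box`). It comes from Lindeberg replacement, with three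
ingredients. A Gaussian smoothing of a bounded function has a second order expansion with an
`L¹`-bounded third order remainder, so matching two moments leaves an error proportional to the sup
norm of the function (`abs_integral_smoothing_sub_le`). A smoothing inequality removes the auxiliary
Gaussian noise at the price of Gaussian anti-concentration (`exists_smoothing_bound`). In each
replacement the law of the partial sum is split as its Gaussian counterpart plus a difference that
is small by induction (`abs_conv_sub_conv_le`); this gives the rate `β W / √V` without logarithms.

The statistic uses the sample matrix in place of `Σ`. If the two differ by at most `δ` entrywise and
`|W_j| ≤ R`, the standardized vector moves by `O(δR)` (`abs_invSqrt_mulVec_sub_le`), and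
anti-concentration turns this into an `O(δR)` error of the distribution function. What remains is
the probability that the deviation of the sample matrix exceeds `δ`. For (i) Chebyshev suffices:
boundedness and bounded variances give fourth moments of order `B²`, hence an error `B²/n` at fixed
`δ`. For (ii) products of sub-Gaussian functions are sub-exponential, Bernstein allows `δ` of order
`M² √(log n / n)`, and with `R` of order `√(log n)` the product `δR` is of order `M² log n / √n`. -/

/-! ### Shifted Gaussian densities and their second order expansion. -/

/-- The density of `N(s, I)` with respect to `N(0, I)`. -/
def shiftDensity {m : ℕ} (s z : Fin m → ℝ) : ℝ :=
  ∏ i, Real.exp (s i * z i - s i ^ 2 / 2)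

lemma shiftDensity_eq {m : ℕ} (s z : Fin m → ℝ) :
    shiftDensity s z = Real.exp (∑ i, s i * z i - (∑ i, s i ^ 2) / 2) := by
  rw [shiftDensity, ← Real.exp_sum, Finset.sum_sub_distrib, Finset.sum_div]

lemma shiftDensity_nonneg {m : ℕ} (s z : Fin m → ℝ) : 0 ≤ shiftDensity s z :=
  Finset.prod_nonneg fun _ _ => (Real.exp_pos _).le

lemma measurable_shiftDensity {m : ℕ} :
    Measurable fun p : (Fin m → ℝ) × (Fin m → ℝ) => shiftDensity p.1 p.2 := by
  unfold shiftDensity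
  fun_prop

lemma gaussianReal_shift_apply (s : ℝ) {t : Set ℝ} (ht : MeasurableSet t) :
    gaussianReal s 1 t =
      ENNReal.ofReal (∫ x, t.indicator (fun x => Real.exp (s * x - s ^ 2 / 2)) x
        ∂gaussianReal 0 1) := by
  rw [gaussianReal_apply_eq_integral _ one_ne_zero, integral_gaussianReal_eq_integral_smul
    one_ne_zero, ← integral_indicator ht]
  congr 1
  refine integral_congr_ae (ae_of_all _ fun x => ?_)
  by_cases hx : x ∈ t
  · simp only [Set.indicator_of_mem hx, gaussianPDFReal, smul_eq_mul, mul_assoc, ← Real.exp_add]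
    congr 3
    simp
    ring
  · simp [Set.indicator_of_notMem hx]

lemma integrable_exp_linear_gaussianReal (a b : ℝ) :
    Integrable (fun x => Real.exp (a * x - b)) (gaussianReal 0 1) := by
  simp_rw [sub_eq_add_neg, Real.exp_add]
  exact (integrable_exp_mul_gaussianReal a).mul_const _

lemma integrable_shiftDensity {m : ℕ} (s : Fin m → ℝ) :
    Integrable (shiftDensity s) (stdNormal m) := by
  unfold stdNormal
  exact Integrable.fintype_prod (f := fun i (x : ℝ) => Real.exp (s i * x - s i ^ 2 / 2))
    fun i => integrable_exp_linear_gaussianReal _ _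

lemma stdNormal_map_add {m : ℕ} (s : Fin m → ℝ) :
    (stdNormal m).map (fun z => s + z) =
      (stdNormal m).withDensity fun z => ENNReal.ofReal (shiftDensity s z) := by
  have h1 : (stdNormal m).map (fun z => s + z) = Measure.pi fun i => gaussianReal (s i) 1 := by
    have := Measure.pi_map_pi (μ := fun _ : Fin m => gaussianReal 0 1)
      (f := fun i x => s i + x) (hμ := fun i => by
        have : IsProbabilityMeasure ((gaussianReal 0 1).map (fun x => s i + x)) :=
          Measure.isProbabilityMeasure_map (by fun_prop)
        infer_instance) (fun i => by fun_prop)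
    simp_rw [gaussianReal_map_const_add, zero_add] at this
    exact this
  rw [h1]
  refine Measure.pi_eq fun t ht => ?_
  rw [withDensity_apply _ (MeasurableSet.univ_pi ht),
    ← ofReal_integral_eq_lintegral_ofReal (integrable_shiftDensity s).restrict
      (ae_of_all _ fun z => shiftDensity_nonneg s z),
    ← integral_indicator (MeasurableSet.univ_pi ht)]
  have h2 : (Set.univ.pi t).indicator (shiftDensity s) =
      fun z => ∏ i, (t i).indicator (fun x => Real.exp (s i * x - s i ^ 2 / 2)) (z i) := by
    ext z
    by_cases hz : z ∈ Set.univ.pi t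
    · rw [Set.indicator_of_mem hz, shiftDensity]
      exact Finset.prod_congr rfl fun i _ => by
        rw [Set.indicator_of_mem (hz i trivial)]
    · rw [Set.indicator_of_notMem hz]
      simp only [Set.mem_univ_pi, not_forall] at hz
      obtain ⟨i, hi⟩ := hz
      exact (Finset.prod_eq_zero (Finset.mem_univ i) (Set.indicator_of_notMem hi _)).symm
  rw [h2, stdNormal, integral_fintype_prod_eq_prod, ENNReal.ofReal_prod_of_nonneg]
  · exact Finset.prod_congr rfl fun i _ => (gaussianReal_shift_apply _ (ht i)).symm
  · exact fun i _ => integral_nonneg fun x => Set.indicator_nonneg (fun _ _ => (Real.exp_pos _).le) _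

/-- The shift moves from `h` to the Gaussian kernel, so expansions in `s` need no smoothness of `h`.
-/
lemma integral_stdNormal_add {m : ℕ} (s : Fin m → ℝ) {h : (Fin m → ℝ) → ℝ} (hh : Measurable h) :
    ∫ z, h (s + z) ∂stdNormal m = ∫ z, shiftDensity s z * h z ∂stdNormal m := by
  rw [← integral_map (φ := fun z => s + z) (by fun_prop) hh.aestronglyMeasurable,
    stdNormal_map_add, integral_withDensity_eq_integral_toReal_smul]
  · refine integral_congr_ae (ae_of_all _ fun z => ?_)
    simp [ENNReal.toReal_ofReal (shiftDensity_nonneg s z)]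
  · exact (measurable_shiftDensity.comp (measurable_const.prodMk measurable_id)).ennreal_ofReal
  · exact ae_of_all _ fun z => ENNReal.ofReal_lt_top

lemma integral_shiftDensity {m : ℕ} (s : Fin m → ℝ) :
    ∫ z, shiftDensity s z ∂stdNormal m = 1 := by
  simpa using (integral_stdNormal_add s (h := fun _ => 1) measurable_const).symm

/-- The remainder of the second order expansion of `s ↦ shiftDensity s z`. -/
def shiftRemainder {m : ℕ} (s z : Fin m → ℝ) : ℝ :=
  shiftDensity s z - (1 + ∑ i, s i * z i +
    ((∑ i, s i * z i) ^ 2 - ∑ i, s i ^ 2) / 2)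

lemma abs_exp_sub_quadratic_le (y : ℝ) :
    |Real.exp y - 1 - y - y ^ 2 / 2| ≤ |y| ^ 3 * Real.exp |y| := by
  have h2 := Complex.norm_exp_sub_sum_le_norm_mul_exp (y : ℂ) 3
  rw [Finset.sum_range_succ, Finset.sum_range_succ, Finset.sum_range_succ] at h2
  have h3 : (Complex.exp y - (∑ k ∈ Finset.range 0, (y : ℂ) ^ k / (k.factorial : ℂ) +
      (y : ℂ) ^ 0 / (Nat.factorial 0 : ℂ) + (y : ℂ) ^ 1 / (Nat.factorial 1 : ℂ) +
      (y : ℂ) ^ 2 / (Nat.factorial 2 : ℂ))) = ((Real.exp y - 1 - y - y ^ 2 / 2 : ℝ) : ℂ) := by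
    push_cast
    simp [Nat.factorial]
    ring
  rw [h3, Complex.norm_real, Complex.norm_real] at h2
  simpa using h2

lemma sq_sum_le_sum_abs_sq {m : ℕ} (s : Fin m → ℝ) : ∑ i, s i ^ 2 ≤ (∑ i, |s i|) ^ 2 := by
  simpa using Finset.sum_sq_le_sq_sum_of_nonneg (s := Finset.univ) (f := fun i => |s i|)
    fun i _ => abs_nonneg _

lemma abs_sum_mul_le {m : ℕ} (s z : Fin m → ℝ) :
    |∑ i, s i * z i| ≤ (∑ i, |s i|) * ∑ i, |z i| := by
  refine (Finset.abs_sum_le_sum_abs _ _).trans ?_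
  rw [Finset.sum_mul]
  refine Finset.sum_le_sum fun i _ => ?_
  rw [abs_mul]
  exact mul_le_mul_of_nonneg_left
    (Finset.single_le_sum (f := fun i => |z i|) (fun i _ => abs_nonneg _) (Finset.mem_univ i))
    (abs_nonneg _)

/-- For `∑ |s i| ≤ 1` this is Taylor's formula for `exp`. For `∑ |s i| ≥ 1` every term is bounded
separately, since its power of `∑ |s i|` is at most the cube. The density itself stays in the bound:
its integral is `1` whatever `s` is, whereas no `z`-dependent majorant would be uniform in large
`s`. -/
lemma abs_shiftRemainder_le {m : ℕ} (s z : Fin m → ℝ) :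
    |shiftRemainder s z| ≤
      (∑ i, |s i|) ^ 3 * (7 * Real.exp (2 * (∑ i, |z i| + 1)) + shiftDensity s z) := by
  have hx := abs_sum_mul_le s z
  have hq := sq_sum_le_sum_abs_sq s
  have hq0 : 0 ≤ ∑ i, s i ^ 2 := Finset.sum_nonneg fun i _ => sq_nonneg _
  have ha0 : 0 ≤ ∑ i, |s i| := Finset.sum_nonneg fun i _ => abs_nonneg _
  have hb0 : 0 ≤ ∑ i, |z i| := Finset.sum_nonneg fun i _ => abs_nonneg _
  have hK0 := shiftDensity_nonneg s z
  have hK := shiftDensity_eq s z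
  rw [shiftRemainder]
  generalize ∑ i, s i * z i = x at *
  generalize ∑ i, s i ^ 2 = q at *
  generalize ∑ i, |s i| = a at *
  generalize ∑ i, |z i| = b at *
  generalize shiftDensity s z = K at *
  have he1 : b + 1 ≤ Real.exp (b + 1) := by linarith [Real.add_one_le_exp (b + 1)]
  have he2 : Real.exp (2 * (b + 1)) = Real.exp (b + 1) ^ 2 := by rw [← Real.exp_nat_mul]; norm_num
  have he3 : (b + 1) ^ 3 ≤ 6 * Real.exp (b + 1) := by
    have := Real.pow_div_factorial_le_exp (b + 1) (by linarith) 3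
    norm_num [Nat.factorial] at this
    linarith
  have he4 : (b + 1) ^ 2 ≤ Real.exp (2 * (b + 1)) := by
    rw [he2]; exact pow_le_pow_left₀ (by linarith) he1 2
  have he5 : 1 ≤ Real.exp (2 * (b + 1)) := Real.one_le_exp (by linarith)
  have he6 : b + 1 ≤ Real.exp (2 * (b + 1)) := by nlinarith
  rcases le_total a 1 with ha | ha
  · have hy : |x - q / 2| ≤ a * (b + 1) := by
      calc |x - q / 2| ≤ |x| + |q / 2| := abs_sub _ _
        _ ≤ a * b + a * 1 := by
            rw [abs_of_nonneg (by positivity : 0 ≤ q / 2)]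
            nlinarith
        _ = a * (b + 1) := by ring
    have hr := abs_exp_sub_quadratic_le (x - q / 2)
    have hr2 : |x - q / 2| ^ 3 * Real.exp |x - q / 2| ≤ a ^ 3 * (6 * Real.exp (2 * (b + 1))) := by
      calc |x - q / 2| ^ 3 * Real.exp |x - q / 2|
          ≤ (a * (b + 1)) ^ 3 * Real.exp (b + 1) := by
            gcongr
            exact hy.trans (by nlinarith)
        _ = a ^ 3 * ((b + 1) ^ 3 * Real.exp (b + 1)) := by ring
        _ ≤ a ^ 3 * ((6 * Real.exp (b + 1)) * Real.exp (b + 1)) := by gcongr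
        _ = _ := by rw [he2]; ring
    -- Expanding in the full exponent `x - q / 2` produces the extra terms `x q` and `q²`, of orders
    -- three and four in `s`.
    have heq : K - (1 + x + (x ^ 2 - q) / 2) =
        (Real.exp (x - q / 2) - 1 - (x - q / 2) - (x - q / 2) ^ 2 / 2) +
          (-(x * q / 2) + q ^ 2 / 8) := by rw [hK]; ring
    have h2 : |-(x * q / 2) + q ^ 2 / 8| ≤ a ^ 3 * (b + 1) := by
      calc |-(x * q / 2) + q ^ 2 / 8| ≤ |x| * q / 2 + q ^ 2 / 8 := by
            refine (abs_add_le _ _).trans ?_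
            rw [abs_neg, abs_div, abs_mul, abs_of_nonneg hq0, abs_of_nonneg (by positivity :
              0 ≤ q ^ 2 / 8)]
            norm_num
        _ ≤ (a * b) * a ^ 2 / 2 + (a ^ 2) ^ 2 / 8 := by gcongr
        _ ≤ a ^ 3 * (b + 1) := by
            have : a ^ 4 ≤ a ^ 3 := pow_le_pow_of_le_one ha0 ha (by norm_num)
            have : 0 ≤ a ^ 3 * b := by positivity
            nlinarith [pow_nonneg ha0 3]
    rw [heq]
    calc _ ≤ a ^ 3 * (6 * Real.exp (2 * (b + 1))) + a ^ 3 * (b + 1) :=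
          (abs_add_le _ _).trans (add_le_add (hr.trans hr2) h2)
      _ ≤ a ^ 3 * (6 * Real.exp (2 * (b + 1))) + a ^ 3 * Real.exp (2 * (b + 1)) := by gcongr
      _ ≤ _ := by
          have : 0 ≤ a ^ 3 * K := by positivity
          nlinarith
  · have h1 : 1 ≤ a ^ 3 := one_le_pow₀ ha
    have h2 : a ≤ a ^ 3 := le_self_pow₀ ha (by norm_num)
    have h3 : a ^ 2 ≤ a ^ 3 := pow_le_pow_right₀ ha (by norm_num)
    have h4 : |1 + x + (x ^ 2 - q) / 2| ≤ 1 + a * b + (a ^ 2 * b ^ 2 + a ^ 2) / 2 := by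
      have hx2 : x ^ 2 ≤ a ^ 2 * b ^ 2 := by
        rw [← mul_pow, ← sq_abs]; exact pow_le_pow_left₀ (abs_nonneg _) hx 2
      have := abs_le.1 hx
      rw [abs_le]
      constructor <;> nlinarith
    calc _ ≤ |K| + |1 + x + (x ^ 2 - q) / 2| := abs_sub _ _
      _ ≤ a ^ 3 * K + (a ^ 3 + a ^ 3 * b + (a ^ 3 * b ^ 2 + a ^ 3) / 2) := by
          rw [abs_of_nonneg hK0]
          have : 1 * K ≤ a ^ 3 * K := by gcongr
          have : a * b ≤ a ^ 3 * b := by gcongr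
          have : a ^ 2 * b ^ 2 ≤ a ^ 3 * b ^ 2 := by gcongr
          linarith
      _ = a ^ 3 * (3 / 2 + b + b ^ 2 / 2 + K) := by ring
      _ ≤ _ := by
          gcongr
          nlinarith

lemma integrable_exp_abs_gaussianReal (c : ℝ) :
    Integrable (fun x => Real.exp (c * |x|)) (gaussianReal 0 1) := by
  simpa using integrable_exp_mul_abs (X := fun x : ℝ => x) (t := c) (μ := gaussianReal 0 1)
    (integrable_exp_mul_gaussianReal c) (integrable_exp_mul_gaussianReal (-c))

lemma integrable_exp_sum_abs_stdNormal {m : ℕ} (c : ℝ) :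
    Integrable (fun z : Fin m → ℝ => Real.exp (c * ∑ i, |z i|)) (stdNormal m) := by
  simp_rw [Finset.mul_sum, Real.exp_sum]
  exact Integrable.fintype_prod (f := fun _ (x : ℝ) => Real.exp (c * |x|))
    fun i => integrable_exp_abs_gaussianReal c

lemma integrable_sum_abs_pow_stdNormal {m : ℕ} (k : ℕ) :
    Integrable (fun z : Fin m → ℝ => (∑ i, |z i|) ^ k) (stdNormal m) := by
  refine ((integrable_exp_sum_abs_stdNormal (m := m) 1).const_mul (k.factorial : ℝ)).mono'
    (Continuous.aestronglyMeasurable (by fun_prop)) (ae_of_all _ fun z => ?_)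
  have h0 : 0 ≤ ∑ i, |z i| := Finset.sum_nonneg fun i _ => abs_nonneg _
  have := Real.pow_div_factorial_le_exp _ h0 k
  rw [div_le_iff₀ (by positivity)] at this
  rw [Real.norm_of_nonneg (by positivity), one_mul]
  linarith

/-! ### Standardized laws. -/

/-- The law `ρ` on `ℝ^m` has mean zero, identity covariance and a finite third moment. -/
structure IsStandardized {m : ℕ} (ρ : Measure (Fin m → ℝ)) : Prop where
  integrable_cube : Integrable (fun x => (∑ i, |x i|) ^ 3) ρ
  mean_eq_zero : ∀ i, ∫ x, x i ∂ρ = 0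
  cov_eq : ∀ i j, ∫ x, x i * x j ∂ρ = if i = j then 1 else 0

/-- The third absolute moment of a law on `ℝ^m`, with respect to the `ℓ¹` norm. -/
def cubeMoment {m : ℕ} (ρ : Measure (Fin m → ℝ)) : ℝ := ∫ x, (∑ i, |x i|) ^ 3 ∂ρ

lemma cubeMoment_nonneg {m : ℕ} (ρ : Measure (Fin m → ℝ)) : 0 ≤ cubeMoment ρ :=
  integral_nonneg fun _ => by positivity

lemma abs_le_sum_abs {m : ℕ} (x : Fin m → ℝ) (i : Fin m) : |x i| ≤ ∑ j, |x j| :=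
  Finset.single_le_sum (f := fun j => |x j|) (fun _ _ => abs_nonneg _) (Finset.mem_univ i)

section Standardized

variable {m : ℕ} {ρ : Measure (Fin m → ℝ)} [IsProbabilityMeasure ρ]

lemma IsStandardized.integrable_mul (hρ : IsStandardized ρ) (i j : Fin m) :
    Integrable (fun x => x i * x j) ρ := by
  refine (hρ.integrable_cube.add (integrable_const 1)).mono'
    (Continuous.aestronglyMeasurable (by fun_prop))
    (ae_of_all _ fun x => ?_)
  have hi := abs_le_sum_abs x i
  have hj := abs_le_sum_abs x j
  simp only [Real.norm_eq_abs, abs_mul, Pi.add_apply]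
  have h0 : 0 ≤ ∑ i, |x i| := Finset.sum_nonneg fun i _ => abs_nonneg _
  generalize ∑ i, |x i| = y at *
  have : |x i| * |x j| ≤ y * y := mul_le_mul hi hj (abs_nonneg _) h0
  rcases le_total y 1 with h | h
  · nlinarith [pow_nonneg h0 3]
  · nlinarith [mul_nonneg h0 h0]

lemma IsStandardized.integrable_eval (hρ : IsStandardized ρ) (i : Fin m) :
    Integrable (fun x => x i) ρ := by
  refine ((hρ.integrable_mul i i).add (integrable_const 1)).mono'
    (Continuous.aestronglyMeasurable (by fun_prop))
    (ae_of_all _ fun x => ?_)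
  simp only [Real.norm_eq_abs, Pi.add_apply]
  rw [abs_le]
  constructor <;> nlinarith [sq_nonneg (x i + 1), sq_nonneg (x i - 1)]

/-- Integrate `y² ≤ 2/3 y³ + 1/3` for one coordinate of unit variance. This lets the third moment of
the Gaussian law be absorbed into a multiple of that of `ρ`. -/
lemma IsStandardized.one_le_cubeMoment (hρ : IsStandardized ρ) (hm : 0 < m) :
    1 ≤ cubeMoment ρ := by
  have h : ∫ x, x ⟨0, hm⟩ * x ⟨0, hm⟩ ∂ρ ≤ ∫ x, (2 / 3 * (∑ i, |x i|) ^ 3 + 1 / 3) ∂ρ := by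
    refine integral_mono (hρ.integrable_mul _ _)
      ((hρ.integrable_cube.const_mul _).add (integrable_const _)) fun x => ?_
    have hi := abs_le_sum_abs x ⟨0, hm⟩
    have h1 : |x ⟨0, hm⟩| ^ 3 ≤ (∑ i, |x i|) ^ 3 := pow_le_pow_left₀ (abs_nonneg _) hi 3
    have h2 : x ⟨0, hm⟩ * x ⟨0, hm⟩ = |x ⟨0, hm⟩| ^ 2 := by rw [sq_abs, sq]
    simp only [h2]
    have h3 := abs_nonneg (x ⟨0, hm⟩)
    generalize |x ⟨0, hm⟩| = y at *
    nlinarith [mul_nonneg (sq_nonneg (y - 1)) (by linarith : 0 ≤ 2 * y + 1)]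
  rw [hρ.cov_eq, integral_add (hρ.integrable_cube.const_mul _) (integrable_const _),
    integral_const_mul] at h
  simp at h
  unfold cubeMoment
  linarith

end Standardized

lemma isStandardized_stdNormal (m : ℕ) : IsStandardized (stdNormal m) where
  integrable_cube := integrable_sum_abs_pow_stdNormal 3
  mean_eq_zero i := by
    rw [stdNormal, integral_comp_eval (μ := fun _ : Fin m => gaussianReal 0 1) (i := i)
      (f := fun x => x) (by fun_prop)]
    simp
  cov_eq i j := by
    have hint : ∀ i, ∫ x, x i ∂stdNormal m = 0 := fun i => by
      rw [stdNormal, integral_comp_eval (μ := fun _ : Fin m => gaussianReal 0 1) (i := i)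
        (f := fun x => x) (by fun_prop)]
      simp
    split_ifs with h
    · subst h
      rw [stdNormal, integral_comp_eval (μ := fun _ : Fin m => gaussianReal 0 1) (i := i)
        (f := fun x => x * x) (by fun_prop)]
      have := variance_fun_id_gaussianReal (μ := 0) (v := 1)
      rw [variance_eq_integral (by fun_prop)] at this
      simpa [sq] using this
    · have := (iIndepFun_pi (μ := fun _ : Fin m => gaussianReal 0 1) (X := fun _ x => x)
        (fun i => by fun_prop)).indepFun h
      have h2 := this.integral_fun_mul_eq_mul_integral
        (Continuous.aestronglyMeasurable (by fun_prop))
        (Continuous.aestronglyMeasurable (by fun_prop))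
      rw [stdNormal, h2]
      have := hint i
      rw [stdNormal] at this
      rw [this, zero_mul]

/-! ### Expansion of Gaussian smoothings of bounded functions. -/

/-- The constant in the total variation comparison of Gaussian smoothings. -/
def kernelConst (m : ℕ) : ℝ :=
  7 * ∫ z : Fin m → ℝ, Real.exp (2 * (∑ i, |z i| + 1)) ∂stdNormal m + 1

lemma one_le_kernelConst (m : ℕ) : 1 ≤ kernelConst m := by
  have : 0 ≤ ∫ z : Fin m → ℝ, Real.exp (2 * (∑ i, |z i| + 1)) ∂stdNormal m :=
    integral_nonneg fun z => (Real.exp_pos _).le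
  unfold kernelConst
  linarith

lemma integrable_exp_two_mul_stdNormal (m : ℕ) :
    Integrable (fun z : Fin m → ℝ => Real.exp (2 * (∑ i, |z i| + 1))) (stdNormal m) := by
  simp_rw [mul_add, Real.exp_add]
  exact (integrable_exp_sum_abs_stdNormal 2).mul_const _

lemma integrable_mul_of_abs_le {α : Type*} [MeasurableSpace α] {μ : Measure α} {f h : α → ℝ}
    {B : ℝ} (hf : Integrable f μ) (hh : Measurable h) (hB : ∀ x, |h x| ≤ B) :
    Integrable (fun x => f x * h x) μ :=
  hf.mul_bdd (c := B) hh.aestronglyMeasurable (ae_of_all _ hB)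

lemma integral_add_add_sub_half {α : Type*} [MeasurableSpace α] {μ : Measure α}
    {f g p q : α → ℝ} (hf : Integrable f μ) (hg : Integrable g μ) (hp : Integrable p μ)
    (hq : Integrable q μ) :
    ∫ x, (f x + g x + (p x - q x) / 2) ∂μ =
      ∫ x, f x ∂μ + ∫ x, g x ∂μ + (∫ x, p x ∂μ - ∫ x, q x ∂μ) / 2 := by
  rw [← integral_add hf hg, ← integral_sub hp hq, ← integral_div]
  exact integral_add (hf.add hg) ((hp.sub hq).div_const 2)

lemma integrable_shiftRemainder {m : ℕ} (s : Fin m → ℝ) :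
    Integrable (shiftRemainder s) (stdNormal m) := by
  refine (((integrable_exp_two_mul_stdNormal m).const_mul 7).add
    (integrable_shiftDensity s)).const_mul ((∑ i, |s i|) ^ 3) |>.mono' ?_
    (ae_of_all _ fun z => abs_shiftRemainder_le s z)
  refine Measurable.aestronglyMeasurable ?_
  have := (measurable_shiftDensity (m := m)).comp (measurable_const (a := s) |>.prodMk measurable_id)
  unfold shiftRemainder
  exact Measurable.sub this (by fun_prop)

lemma integral_abs_shiftRemainder_le {m : ℕ} (s : Fin m → ℝ) :
    ∫ z, |shiftRemainder s z| ∂stdNormal m ≤ kernelConst m * (∑ i, |s i|) ^ 3 := by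
  calc ∫ z, |shiftRemainder s z| ∂stdNormal m
      ≤ ∫ z, (∑ i, |s i|) ^ 3 * (7 * Real.exp (2 * (∑ i, |z i| + 1)) + shiftDensity s z)
          ∂stdNormal m :=
        integral_mono (integrable_shiftRemainder s).abs
          ((((integrable_exp_two_mul_stdNormal m).const_mul 7).add
            (integrable_shiftDensity s)).const_mul _) fun z => abs_shiftRemainder_le s z
    _ = _ := by
        rw [integral_const_mul, integral_add ((integrable_exp_two_mul_stdNormal m).const_mul 7)
          (integrable_shiftDensity s), integral_const_mul, integral_shiftDensity, kernelConst]
        ring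

section Expansion

variable {m : ℕ} {h : (Fin m → ℝ) → ℝ} {B : ℝ}

/-- Second order expansion of a Gaussian smoothing, with a remainder of third order. -/
lemma abs_integral_add_sub_quadratic_le (hh : Measurable h) (hB : ∀ x, |h x| ≤ B)
    (s : Fin m → ℝ) :
    |∫ z, h (s + z) ∂stdNormal m - (∫ z, h z ∂stdNormal m + ∑ i, s i * ∫ z, z i * h z ∂stdNormal m +
      (∑ i, ∑ j, s i * s j * ∫ z, z i * z j * h z ∂stdNormal m -
        (∑ i, s i * s i) * ∫ z, h z ∂stdNormal m) / 2)| ≤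
      B * (kernelConst m * (∑ i, |s i|) ^ 3) := by
  have hstd := isStandardized_stdNormal m
  have i0 : Integrable h (stdNormal m) := by
    simpa using integrable_mul_of_abs_le (integrable_const (1 : ℝ)) hh hB
  have i1 : ∀ i, Integrable (fun z => z i * h z) (stdNormal m) := fun i =>
    integrable_mul_of_abs_le (hstd.integrable_eval i) hh hB
  have i2 : ∀ i j, Integrable (fun z => z i * z j * h z) (stdNormal m) := fun i j =>
    integrable_mul_of_abs_le (hstd.integrable_mul i j) hh hB
  have e : ∫ z, (1 + ∑ i, s i * z i + ((∑ i, s i * z i) ^ 2 - ∑ i, s i ^ 2) / 2) * h z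
      ∂stdNormal m = ∫ z, h z ∂stdNormal m + ∑ i, s i * ∫ z, z i * h z ∂stdNormal m +
      (∑ i, ∑ j, s i * s j * ∫ z, z i * z j * h z ∂stdNormal m -
        (∑ i, s i * s i) * ∫ z, h z ∂stdNormal m) / 2 := by
    have : ∀ z, (1 + ∑ i, s i * z i + ((∑ i, s i * z i) ^ 2 - ∑ i, s i ^ 2) / 2) * h z =
        h z + ∑ i, s i * (z i * h z) + (∑ i, ∑ j, s i * s j * (z i * z j * h z) -
          (∑ i, s i * s i) * h z) / 2 := by
      intro z
      have h1 : ∑ i, s i * (z i * h z) = (∑ i, s i * z i) * h z := by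
        rw [Finset.sum_mul]; exact Finset.sum_congr rfl fun i _ => by ring
      have h2 : ∑ i, ∑ j, s i * s j * (z i * z j * h z) = (∑ i, s i * z i) ^ 2 * h z := by
        rw [sq, Finset.sum_mul_sum, Finset.sum_mul]
        refine Finset.sum_congr rfl fun i _ => ?_
        rw [Finset.sum_mul]
        exact Finset.sum_congr rfl fun i _ => by ring
      rw [h1, h2]
      simp_rw [sq]
      ring
    simp_rw [this]
    have j1 : Integrable (fun z => ∑ i, s i * (z i * h z)) (stdNormal m) :=
      integrable_finsetSum _ fun i _ => (i1 i).const_mul _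
    have j2 : Integrable (fun z => ∑ i, ∑ j, s i * s j * (z i * z j * h z)) (stdNormal m) :=
      integrable_finsetSum _ fun i _ => integrable_finsetSum _ fun j _ => (i2 i j).const_mul _
    rw [integral_add_add_sub_half i0 j1 j2 (i0.const_mul _), integral_const_mul,
      integral_finsetSum _ fun i _ => (i1 i).const_mul _,
      integral_finsetSum _ fun i _ => integrable_finsetSum _ fun j _ => (i2 i j).const_mul _]
    simp_rw [integral_const_mul]
    congr 3
    refine Finset.sum_congr rfl fun i _ => ?_
    rw [integral_finsetSum _ fun j _ => (i2 i j).const_mul _]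
    simp_rw [integral_const_mul]
  rw [integral_stdNormal_add s hh, ← e]
  have iK := integrable_mul_of_abs_le (integrable_shiftDensity s) hh hB
  have iR := integrable_mul_of_abs_le (integrable_shiftRemainder s) hh hB
  have iQ : Integrable (fun z => (1 + ∑ i, s i * z i +
      ((∑ i, s i * z i) ^ 2 - ∑ i, s i ^ 2) / 2) * h z) (stdNormal m) := by
    refine (iK.sub iR).congr (ae_of_all _ fun z => ?_)
    simp only [Pi.sub_apply, shiftRemainder]
    ring
  rw [← integral_sub iK iQ]
  have hB0 : 0 ≤ B := (abs_nonneg _).trans (hB 0)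
  calc _ = |∫ z, shiftRemainder s z * h z ∂stdNormal m| := by
        congr 2; ext z; rw [shiftRemainder]; ring
    _ ≤ ∫ z, |shiftRemainder s z * h z| ∂stdNormal m := abs_integral_le_integral_abs
    _ ≤ ∫ z, B * |shiftRemainder s z| ∂stdNormal m := by
        refine integral_mono iR.abs ((integrable_shiftRemainder s).abs.const_mul B) fun z => ?_
        simp only [abs_mul]
        rw [mul_comm]
        exact mul_le_mul_of_nonneg_right (hB z) (abs_nonneg _)
    _ ≤ _ := by
        rw [integral_const_mul]
        exact mul_le_mul_of_nonneg_left (integral_abs_shiftRemainder_le s) hB0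

lemma measurable_integral_add (hh : Measurable h) :
    Measurable fun x => ∫ z, h (x + z) ∂stdNormal m :=
  (StronglyMeasurable.integral_prod_right'
    (f := fun p : (Fin m → ℝ) × (Fin m → ℝ) => h (p.1 + p.2))
    (hh.comp (measurable_fst.add measurable_snd)).stronglyMeasurable).measurable

lemma abs_integral_le_of_abs_le {α : Type*} [MeasurableSpace α] {μ : Measure α}
    [IsProbabilityMeasure μ] {f : α → ℝ} (hB : ∀ x, |f x| ≤ B) : |∫ x, f x ∂μ| ≤ B := by
  simpa using norm_integral_le_of_norm_le_const (μ := μ) (f := f) (ae_of_all _ hB)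

/-- Integrating the expansion at `s • x` over `ρ`, the linear term vanishes and the quadratic form
reduces to its trace. The main part is therefore the same for every standardized law, and comparing
two such laws leaves only the cubic remainders. -/
lemma abs_integral_standardized_sub_le {ρ : Measure (Fin m → ℝ)} [IsProbabilityMeasure ρ]
    (hρ : IsStandardized ρ) (hh : Measurable h) (hB : ∀ x, |h x| ≤ B) (s : ℝ) :
    |∫ x, ∫ z, h (s • x + z) ∂stdNormal m ∂ρ - (∫ z, h z ∂stdNormal m +
      s ^ 2 * (∑ i, ∫ z, z i * z i * h z ∂stdNormal m - m * ∫ z, h z ∂stdNormal m) / 2)| ≤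
      B * kernelConst m * |s| ^ 3 * cubeMoment ρ := by
  set H := ∫ z, h z ∂stdNormal m
  set H1 : Fin m → ℝ := fun i => ∫ z, z i * h z ∂stdNormal m
  set H2 : Fin m → Fin m → ℝ := fun i j => ∫ z, z i * z j * h z ∂stdNormal m
  have k1 : Integrable (fun x : Fin m → ℝ => ∑ i, s * x i * H1 i) ρ :=
    integrable_finsetSum _ fun i _ => ((hρ.integrable_eval i).const_mul s).mul_const _
  have k2 : ∀ i j, Integrable (fun x : Fin m → ℝ => s ^ 2 * (x i * x j) * H2 i j) ρ := fun i j =>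
    ((hρ.integrable_mul i j).const_mul _).mul_const _
  have k3 : ∀ i, Integrable (fun x : Fin m → ℝ => s ^ 2 * (x i * x i)) ρ := fun i =>
    (hρ.integrable_mul i i).const_mul _
  have k2' : Integrable (fun x : Fin m → ℝ => ∑ i, ∑ j, s ^ 2 * (x i * x j) * H2 i j) ρ :=
    integrable_finsetSum _ fun i _ => integrable_finsetSum _ fun j _ => k2 i j
  have k3' : Integrable (fun x : Fin m → ℝ => (∑ i, s ^ 2 * (x i * x i)) * H) ρ :=
    (integrable_finsetSum _ fun i _ => k3 i).mul_const _
  set Q : (Fin m → ℝ) → ℝ := fun x => H + ∑ i, s * x i * H1 i +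
    (∑ i, ∑ j, s ^ 2 * (x i * x j) * H2 i j - (∑ i, s ^ 2 * (x i * x i)) * H) / 2
  have kQ : Integrable Q ρ :=
    ((integrable_const _).add k1).add ((k2'.sub k3').div_const 2)
  have eQ : ∫ x, Q x ∂ρ = H + s ^ 2 * (∑ i, H2 i i - m * H) / 2 := by
    simp only [Q]
    rw [integral_add_add_sub_half (integrable_const _) k1 k2' k3',
      integral_finsetSum _ fun i _ => ((hρ.integrable_eval i).const_mul s).mul_const _,
      integral_finsetSum _ fun i _ => integrable_finsetSum _ fun j _ => k2 i j,
      integral_mul_const, integral_finsetSum _ fun i _ => k3 i]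
    have e1 : ∀ i, ∫ x : Fin m → ℝ, s * x i * H1 i ∂ρ = 0 := fun i => by
      rw [integral_mul_const, integral_const_mul, hρ.mean_eq_zero]; ring
    have e2 : ∀ i, ∫ x : Fin m → ℝ, ∑ j, s ^ 2 * (x i * x j) * H2 i j ∂ρ = s ^ 2 * H2 i i := by
      intro i
      rw [integral_finsetSum _ fun j _ => k2 i j]
      simp_rw [integral_mul_const, integral_const_mul, hρ.cov_eq]
      simp
    simp_rw [e1, e2, integral_const_mul, hρ.cov_eq]
    simp [← Finset.mul_sum]
    ring
  have kL : Integrable (fun x => ∫ z, h (s • x + z) ∂stdNormal m) ρ := by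
    refine (integrable_const B).mono' ?_ (ae_of_all _ fun x => ?_)
    · exact ((measurable_integral_add hh).comp
        (measurable_id.const_smul s)).aestronglyMeasurable
    · exact abs_integral_le_of_abs_le fun z => hB _
  rw [← eQ, ← integral_sub kL kQ]
  refine abs_integral_le_integral_abs.trans ?_
  calc _ ≤ ∫ x, B * kernelConst m * |s| ^ 3 * (∑ i, |x i|) ^ 3 ∂ρ := by
        refine integral_mono (kL.sub kQ).abs (hρ.integrable_cube.const_mul _) fun x => ?_
        have := abs_integral_add_sub_quadratic_le hh hB (s • x)
        have e3 : ∑ i, |(s • x) i| = |s| * ∑ i, |x i| := by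
          simp [abs_mul, Finset.mul_sum]
        rw [e3] at this
        refine le_of_eq_of_le ?_ (this.trans (le_of_eq (by ring)))
        simp only [Q, H, H1, H2, Pi.smul_apply, smul_eq_mul]
        have e4 : ∀ i j, s * x i * (s * x j) = s ^ 2 * (x i * x j) := fun i j => by ring
        simp only [e4]
    _ = _ := by rw [integral_const_mul, cubeMoment]

/-- Total variation comparison of the Gaussian smoothings of two standardized laws. -/
lemma abs_integral_smoothing_sub_le {ρ : Measure (Fin m → ℝ)} [IsProbabilityMeasure ρ]
    (hρ : IsStandardized ρ) (hh : Measurable h) (hB : ∀ x, |h x| ≤ B) (s : ℝ) :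
    |∫ x, ∫ z, h (s • x + z) ∂stdNormal m ∂ρ -
      ∫ x, ∫ z, h (s • x + z) ∂stdNormal m ∂stdNormal m| ≤
      B * kernelConst m * |s| ^ 3 * (cubeMoment ρ + cubeMoment (stdNormal m)) := by
  have h1 := abs_integral_standardized_sub_le hρ hh hB s
  have h2 := abs_integral_standardized_sub_le (isStandardized_stdNormal m) hh hB s
  rw [abs_le] at *
  constructor <;> nlinarith

end Expansion

/-! ### Isotropic Gaussian laws: convolution and anti-concentration on boxes. -/

/-- The law `N(0, v I_m)`. -/
def gaussN (m : ℕ) (v : ℝ) : Measure (Fin m → ℝ) := Measure.pi fun _ => gaussianReal 0 v.toNNReal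

instance (m : ℕ) (v : ℝ) : IsProbabilityMeasure (gaussN m v) := by
  unfold gaussN; infer_instance

lemma gaussN_one (m : ℕ) : gaussN m 1 = stdNormal m := by simp [gaussN, stdNormal]

lemma stdNormal_map_smul (m : ℕ) (c : ℝ) :
    (stdNormal m).map (fun z => c • z) = gaussN m (c ^ 2) := by
  have := Measure.pi_map_pi (μ := fun _ : Fin m => gaussianReal 0 1)
    (f := fun _ x => c * x) (hμ := fun i => by
      have : IsProbabilityMeasure ((gaussianReal 0 1).map (fun x => c * x)) :=
        Measure.isProbabilityMeasure_map (by fun_prop)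
      infer_instance) (fun i => by fun_prop)
  simp_rw [gaussianReal_map_const_mul, mul_zero, mul_one] at this
  have h : NNReal.mk (c ^ 2) (sq_nonneg c) = (c ^ 2).toNNReal := by
    rw [Real.toNNReal_of_nonneg (sq_nonneg c)]
  rw [h] at this
  exact this

lemma pi_conv_pi {ι : Type*} [Fintype ι] (μ ν : ι → Measure ℝ) [∀ i, IsProbabilityMeasure (μ i)]
    [∀ i, IsProbabilityMeasure (ν i)] :
    Measure.pi μ ∗ Measure.pi ν = Measure.pi fun i => μ i ∗ ν i := by
  rw [Measure.conv, ← (measurePreserving_arrowProdEquivProdArrow ℝ ℝ ι μ ν).map_eq,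
    Measure.map_map (by fun_prop) (MeasurableEquiv.measurable _)]
  exact Measure.pi_map_pi (μ := fun i => (μ i).prod (ν i)) (f := fun i x => x.1 + x.2)
    (hμ := fun i => by
      have : IsProbabilityMeasure (((μ i).prod (ν i)).map (fun x => x.1 + x.2)) :=
        Measure.isProbabilityMeasure_map (by fun_prop)
      infer_instance) (fun i => by fun_prop)

lemma gaussN_conv_gaussN (m : ℕ) {u v : ℝ} (hu : 0 ≤ u) (hv : 0 ≤ v) :
    gaussN m u ∗ gaussN m v = gaussN m (u + v) := by
  rw [gaussN, gaussN, pi_conv_pi, gaussN]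
  simp_rw [gaussianReal_conv_gaussianReal, add_zero, Real.toNNReal_add hu hv]

lemma conv_real_apply {m : ℕ} (θ τ : Measure (Fin m → ℝ)) [IsProbabilityMeasure θ]
    [IsProbabilityMeasure τ] {A : Set (Fin m → ℝ)} (hA : MeasurableSet A) :
    (θ ∗ τ).real A = ∫ y, τ.real ((fun x => y + x) ⁻¹' A) ∂θ := by
  rw [← integral_indicator_one hA, integral_conv]
  · refine integral_congr_ae (ae_of_all _ fun y => ?_)
    simp only
    rw [← integral_indicator_one (hA.preimage (measurable_const_add y))]
    rfl
  · exact (integrable_const 1).indicator hA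

/-- Translates of boxes are boxes, so a uniform bound over boxes survives convolution. -/
lemma preimage_add_Icc {m : ℕ} (a b y : Fin m → ℝ) :
    (fun x => y + x) ⁻¹' Set.Icc a b = Set.Icc (a - y) (b - y) := by
  ext x
  simp only [Set.mem_preimage, Set.mem_Icc, Pi.le_def, Pi.add_apply, Pi.sub_apply]
  constructor
  · rintro ⟨h1, h2⟩
    exact ⟨fun i => by linarith [h1 i], fun i => by linarith [h2 i]⟩
  · rintro ⟨h1, h2⟩
    exact ⟨fun i => by linarith [h1 i], fun i => by linarith [h2 i]⟩

lemma measurable_real_preimage_add {m : ℕ} (τ : Measure (Fin m → ℝ)) [IsProbabilityMeasure τ]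
    {A : Set (Fin m → ℝ)} (hA : MeasurableSet A) :
    Measurable fun y => τ.real ((fun x => y + x) ⁻¹' A) :=
  (measurable_measure_prodMk_left (ν := τ)
    (hA.preimage (measurable_fst.add measurable_snd))).ennreal_toReal

lemma gaussianReal_real_Icc_le (x : ℝ) {r : ℝ} (hr : 0 ≤ r) :
    (gaussianReal 0 1).real (Set.Icc x (x + r)) ≤ r := by
  rw [measureReal_def, gaussianReal_apply_eq_integral _ one_ne_zero, ENNReal.toReal_ofReal
    (integral_nonneg fun y => gaussianPDFReal_nonneg _ _ _)]
  have hb : ∀ y, gaussianPDFReal 0 1 y ≤ 1 := fun y => by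
    rw [gaussianPDFReal]
    have h1 : (√(2 * Real.pi * (1 : NNReal)))⁻¹ ≤ 1 := by
      refine inv_le_one_of_one_le₀ ?_
      rw [Real.one_le_sqrt]
      have := Real.pi_gt_three
      simp
      linarith
    have h2 : Real.exp (-(y - 0) ^ 2 / (2 * (1 : NNReal))) ≤ 1 := by
      rw [Real.exp_le_one_iff]
      simp
      nlinarith [sq_nonneg y]
    exact mul_le_one₀ h1 (Real.exp_pos _).le h2
  calc ∫ y in Set.Icc x (x + r), gaussianPDFReal 0 1 y
      ≤ ∫ y in Set.Icc x (x + r), (1 : ℝ) :=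
        setIntegral_mono (integrable_gaussianPDFReal 0 1).integrableOn
          (by simp) hb
    _ = r := by simp [hr]

lemma gaussN_real_slab_le {m : ℕ} {v : ℝ} (hv : 0 < v) (i : Fin m) (x : ℝ) {r : ℝ} (hr : 0 ≤ r) :
    (gaussN m v).real {z | z i ∈ Set.Icc x (x + r)} ≤ r / √v := by
  have hs := Real.sqrt_pos.2 hv
  have h1 : gaussN m v = (stdNormal m).map (fun z => √v • z) := by
    rw [stdNormal_map_smul, Real.sq_sqrt hv.le]
  have hm : MeasurableSet {z : Fin m → ℝ | z i ∈ Set.Icc x (x + r)} :=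
    measurableSet_Icc.preimage (measurable_pi_apply i)
  have h2 : (stdNormal m).map (fun z => z i) = gaussianReal 0 1 :=
    (measurePreserving_eval (fun _ : Fin m => gaussianReal 0 1) i).map_eq
  rw [h1, map_measureReal_apply (by fun_prop) hm]
  have h3 : (fun z : Fin m → ℝ => √v • z) ⁻¹' {z | z i ∈ Set.Icc x (x + r)} =
      (fun z : Fin m → ℝ => z i) ⁻¹' Set.Icc (x / √v) (x / √v + r / √v) := by
    ext z
    simp only [Set.mem_preimage, Set.mem_ofPred_eq, Set.mem_Icc, Pi.smul_apply, smul_eq_mul,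
      ← add_div]
    rw [div_le_iff₀' hs, le_div_iff₀' hs]
  rw [h3, ← map_measureReal_apply (by fun_prop) measurableSet_Icc, h2]
  exact gaussianReal_real_Icc_le _ (by positivity)

/-- Anti-concentration of the Gaussian law near the boundary of a box. -/
lemma gaussN_real_enlarge_le {m : ℕ} {v : ℝ} (hv : 0 < v) (a b : Fin m → ℝ) {r : ℝ} (hr : 0 ≤ r) :
    (gaussN m v).real (Set.Icc (fun i => a i - r) (fun i => b i + r)) ≤
      (gaussN m v).real (Set.Icc a b) + 2 * m * r / √v := by
  -- A point gained by the enlargement lies in a slab of width `r` along one of the `2m` faces.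
  have hsub : Set.Icc (fun i => a i - r) (fun i => b i + r) ⊆
      Set.Icc a b ∪ ⋃ i : Fin m, ({z | z i ∈ Set.Icc (a i - r) (a i - r + r)} ∪
        {z | z i ∈ Set.Icc (b i) (b i + r)}) := by
    intro z hz
    by_cases h : z ∈ Set.Icc a b
    · exact Or.inl h
    · right
      simp only [Set.mem_Icc, Pi.le_def, not_and_or, not_forall, not_le] at h hz
      simp only [Set.mem_iUnion]
      rcases h with ⟨i, hi⟩ | ⟨i, hi⟩
      · exact ⟨i, Or.inl ⟨hz.1 i, by linarith⟩⟩
      · exact ⟨i, Or.inr ⟨hi.le, hz.2 i⟩⟩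
  refine (measureReal_mono hsub).trans ((measureReal_union_le _ _).trans ?_)
  gcongr
  refine (measureReal_iUnion_fintype_le _).trans ?_
  calc ∑ i : Fin m, _ ≤ ∑ i : Fin m, (r / √v + r / √v) := by
        refine Finset.sum_le_sum fun i _ => (measureReal_union_le _ _).trans (add_le_add ?_ ?_)
        · exact gaussN_real_slab_le hv i _ hr
        · exact gaussN_real_slab_le hv i _ hr
    _ = _ := by simp; ring

/-- Any mass above `1/2` would serve: in the smoothing argument the shifts inside this box must
outweigh those outside. -/
lemma exists_stdNormal_box (m : ℕ) :
    ∃ r : ℝ, 0 ≤ r ∧ 3 / 4 ≤ (stdNormal m).real (Set.Icc (fun _ => -r) (fun _ => r)) := by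
  have hmono : Monotone fun n : ℕ => Set.Icc (fun _ : Fin m => -(n : ℝ)) (fun _ => (n : ℝ)) := by
    intro k l hkl
    have : (k : ℝ) ≤ l := by exact_mod_cast hkl
    exact Set.Icc_subset_Icc (fun _ => by linarith) (fun _ => this)
  have hU : ⋃ n : ℕ, Set.Icc (fun _ : Fin m => -(n : ℝ)) (fun _ => (n : ℝ)) = Set.univ := by
    refine Set.eq_univ_of_forall fun z => ?_
    obtain ⟨n, hn⟩ := exists_nat_ge (∑ i, |z i|)
    refine Set.mem_iUnion.2 ⟨n, fun i => ?_, fun i => ?_⟩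
    · have := abs_le.1 ((abs_le_sum_abs z i).trans hn)
      exact this.1
    · have := abs_le.1 ((abs_le_sum_abs z i).trans hn)
      exact this.2
  have ht := tendsto_measure_iUnion_atTop (μ := stdNormal m) hmono
  rw [hU, measure_univ] at ht
  have ht' := (ENNReal.tendsto_toReal ENNReal.one_ne_top).comp ht
  obtain ⟨n, hn⟩ := (ht'.eventually (eventually_ge_nhds (by norm_num :
    (3 / 4 : ℝ) < (1 : ENNReal).toReal))).exists
  exact ⟨n, n.cast_nonneg, hn⟩

/-! ### The smoothing inequality on boxes. -/

section Smoothing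

variable {m : ℕ}

/-- A uniform bound on boxes for the distance of two laws, in terms of the one of their Gaussian
smoothings. -/
lemma exists_smoothing_bound (m : ℕ) : ∃ C : ℝ, 0 ≤ C ∧
    ∀ (τ : Measure (Fin m → ℝ)) [IsProbabilityMeasure τ] (v ε δ : ℝ), 0 < v → 0 ≤ ε →
      (∀ a b, |(gaussN m (ε ^ 2) ∗ τ).real (Set.Icc a b) -
        (gaussN m (ε ^ 2) ∗ gaussN m v).real (Set.Icc a b)| ≤ δ) →
      ∀ a b, |τ.real (Set.Icc a b) - (gaussN m v).real (Set.Icc a b)| ≤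
        2 * δ + C * ε / √v := by
  obtain ⟨r, hr0, hr⟩ := exists_stdNormal_box m
  refine ⟨6 * m * r, by positivity, fun τ _ v ε δ hv hε hδ => ?_⟩
  set ν := gaussN m v with hν
  set D : (Fin m → ℝ) × (Fin m → ℝ) → ℝ := fun p =>
    τ.real (Set.Icc p.1 p.2) - ν.real (Set.Icc p.1 p.2) with hD
  have hD1 : ∀ p, |D p| ≤ 1 := fun p => by
    have h1 := measureReal_le_one (μ := τ) (s := Set.Icc p.1 p.2)
    have h2 := measureReal_le_one (μ := ν) (s := Set.Icc p.1 p.2)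
    have h3 := measureReal_nonneg (μ := τ) (s := Set.Icc p.1 p.2)
    have h4 := measureReal_nonneg (μ := ν) (s := Set.Icc p.1 p.2)
    rw [abs_le]
    constructor <;> simp only [hD] <;> linarith
  have hbdd : BddAbove (Set.range fun p => |D p|) := ⟨1, by rintro _ ⟨p, rfl⟩; exact hD1 p⟩
  set Δ := ⨆ p, |D p|
  have hΔ : ∀ p, |D p| ≤ Δ := fun p => le_ciSup hbdd p
  -- Anti-concentration bound for enlarging a box by `2rε` on every side: `rε` for the chosen
  -- enlargement and `rε` for the shift by `ε • z` with `z ∈ G`.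
  set η := 4 * m * r * ε / √v with hη
  set G : Set (Fin m → ℝ) := Set.Icc (fun _ => -r) (fun _ => r)
  have hG : MeasurableSet G := measurableSet_Icc
  set p := (stdNormal m).real G
  have hp1 : p ≤ 1 := measureReal_le_one
  have hsm : ∀ a b, ∫ z, D (a - ε • z, b - ε • z) ∂stdNormal m =
      (gaussN m (ε ^ 2) ∗ τ).real (Set.Icc a b) - (gaussN m (ε ^ 2) ∗ ν).real (Set.Icc a b) := by
    intro a b
    have hi : ∀ κ : Measure (Fin m → ℝ), IsProbabilityMeasure κ →
        Integrable (fun y => κ.real ((fun x => y + x) ⁻¹' Set.Icc a b)) (gaussN m (ε ^ 2)) :=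
      fun κ _ => (integrable_const (1 : ℝ)).mono'
        (measurable_real_preimage_add κ measurableSet_Icc).aestronglyMeasurable
        (ae_of_all _ fun y => by
          rw [Real.norm_of_nonneg measureReal_nonneg]; exact measureReal_le_one)
    rw [conv_real_apply _ _ measurableSet_Icc, conv_real_apply _ _ measurableSet_Icc,
      ← integral_sub (hi τ inferInstance) (hi ν inferInstance), ← stdNormal_map_smul, integral_map]
    · simp_rw [preimage_add_Icc]; rfl
    · fun_prop
    · exact ((measurable_real_preimage_add τ measurableSet_Icc).sub
        (measurable_real_preimage_add ν measurableSet_Icc)).aestronglyMeasurable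
  have hDm : ∀ a b, Integrable (fun z => D (a - ε • z, b - ε • z)) (stdNormal m) := by
    intro a b
    refine (integrable_const (1 : ℝ)).mono' ?_ (ae_of_all _ fun z => hD1 _)
    have := (((measurable_real_preimage_add τ (measurableSet_Icc (a := a) (b := b))).sub
        (measurable_real_preimage_add ν (measurableSet_Icc (a := a) (b := b)))).comp
        (measurable_id.const_smul ε)).aestronglyMeasurable (μ := stdNormal m)
    refine this.congr (ae_of_all _ fun z => ?_)
    simp only [Function.comp, Pi.sub_apply, preimage_add_Icc, hD, id, Pi.smul_apply]
  have hsplit : ∀ x y : ℝ, ∫ z, (G.indicator (fun _ => x) z + Gᶜ.indicator (fun _ => y) z)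
      ∂stdNormal m = p * x + (1 - p) * y := by
    intro x y
    rw [integral_add ((integrable_const _).indicator hG) ((integrable_const _).indicator hG.compl),
      integral_indicator_const _ hG, integral_indicator_const _ hG.compl,
      probReal_compl_eq_one_sub hG]
    simp [p]
  have hbox : ∀ z ∈ G, ∀ i, |ε * z i| ≤ r * ε := by
    intro z hz i
    rw [abs_mul, abs_of_nonneg hε, mul_comm]
    exact mul_le_mul_of_nonneg_right (abs_le.2 ⟨hz.1 i, hz.2 i⟩) hε
  have hrε : 0 ≤ r * ε := by positivity
  -- The smoothed difference is an average of `D` over shifted copies of the enlarged box. For `z ∈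
  -- G` the copy still contains the original box, so the mass under `τ` does not drop, while the
  -- Gaussian mass grows by at most `η`. For other `z` only `D ≥ -Δ` is used. The lower bound
  -- shrinks the box instead.
  have upper : ∀ a b, p * (D (a, b) - η) - (1 - p) * Δ ≤ δ := by
    intro a b
    set a' : Fin m → ℝ := fun i => a i - r * ε
    set b' : Fin m → ℝ := fun i => b i + r * ε
    have h := (abs_le.1 (hδ a' b')).2
    rw [← hsm] at h
    refine le_trans (le_of_eq_of_le ?_ (integral_mono (((integrable_const
      (D (a, b) - η)).indicator hG).add ((integrable_const (-Δ)).indicator hG.compl))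
        (hDm a' b') fun z => ?_)) h
    · have := hsplit (D (a, b) - η) (-Δ)
      simp only [Pi.add_apply]
      rw [this]; ring
    · simp only [Pi.add_apply]
      by_cases hz : z ∈ G
      · rw [Set.indicator_of_mem hz, Set.indicator_of_notMem (by simpa using hz), add_zero]
        have hb := fun i => abs_le.1 (hbox z hz i)
        have h1 : τ.real (Set.Icc a b) ≤ τ.real (Set.Icc (a' - ε • z) (b' - ε • z)) := by
          refine measureReal_mono (Set.Icc_subset_Icc (fun i => ?_) (fun i => ?_))
          · simp [a']; linarith [(hb i).1]
          · simp [b']; linarith [(hb i).2]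
        have h2 : ν.real (Set.Icc (a' - ε • z) (b' - ε • z)) ≤ ν.real (Set.Icc a b) + η := by
          refine (measureReal_mono (Set.Icc_subset_Icc (fun i => ?_) (fun i => ?_))).trans
            ((gaussN_real_enlarge_le hv a b (r := 2 * (r * ε)) (by positivity)).trans
              (le_of_eq ?_))
          · simp [a']; linarith [(hb i).2]
          · simp [b']; linarith [(hb i).1]
          · rw [hη]; ring
        simp only [hD]
        linarith
      · rw [Set.indicator_of_notMem hz, Set.indicator_of_mem (by simpa using hz), zero_add]
        exact (abs_le.1 (hΔ _)).1
  have lower : ∀ a b, -δ ≤ p * (D (a, b) + η) + (1 - p) * Δ := by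
    intro a b
    set a' : Fin m → ℝ := fun i => a i + r * ε
    set b' : Fin m → ℝ := fun i => b i - r * ε
    have h := (abs_le.1 (hδ a' b')).1
    rw [← hsm] at h
    refine h.trans (le_of_le_of_eq (integral_mono (hDm a' b') (((integrable_const
      (D (a, b) + η)).indicator hG).add ((integrable_const Δ).indicator hG.compl)) fun z => ?_) ?_)
    · simp only [Pi.add_apply]
      by_cases hz : z ∈ G
      · rw [Set.indicator_of_mem hz, Set.indicator_of_notMem (by simpa using hz), add_zero]
        have hb := fun i => abs_le.1 (hbox z hz i)
        have h1 : τ.real (Set.Icc (a' - ε • z) (b' - ε • z)) ≤ τ.real (Set.Icc a b) := by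
          refine measureReal_mono (Set.Icc_subset_Icc (fun i => ?_) (fun i => ?_))
          · simp [a']; linarith [(hb i).2]
          · simp [b']; linarith [(hb i).1]
        have h2 : ν.real (Set.Icc a b) ≤ ν.real (Set.Icc (a' - ε • z) (b' - ε • z)) + η := by
          refine (measureReal_mono (Set.Icc_subset_Icc (fun i => ?_) (fun i => ?_))).trans
            ((gaussN_real_enlarge_le hv (a' - ε • z) (b' - ε • z) (r := 2 * (r * ε))
              (by positivity)).trans (le_of_eq ?_))
          · simp [a']; linarith [(hb i).1]
          · simp [b']; linarith [(hb i).2]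
          · rw [hη]; ring
        simp only [hD]
        linarith
      · rw [Set.indicator_of_notMem hz, Set.indicator_of_mem (by simpa using hz), zero_add]
        exact (abs_le.1 (hΔ _)).2
    · exact hsplit (D (a, b) + η) Δ
  have hη0 : 0 ≤ η := by positivity
  have hΔ0 : 0 ≤ Δ := (abs_nonneg _).trans (hΔ (0, 0))
  have hδ0 : 0 ≤ δ := (abs_nonneg _).trans (hδ 0 0)
  have hp : 3 / 4 ≤ p := hr
  have key : ∀ q, |D q| ≤ η + 4 / 3 * δ + Δ / 3 := by
    rintro ⟨a, b⟩
    have h1 := upper a b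
    have h2 := lower a b
    rw [abs_le]
    constructor
    · by_contra hcon
      push Not at hcon
      nlinarith
    · by_contra hcon
      push Not at hcon
      nlinarith
  -- The supremum is finite, so `Δ / 3` can be absorbed on the left.
  have hfin : Δ ≤ η + 4 / 3 * δ + Δ / 3 := ciSup_le key
  intro a b
  have h3 := hΔ (a, b)
  have h4 : 6 * m * r * ε / √v = 3 / 2 * η := by rw [hη]; ring
  rw [h4]
  simp only [hD] at h3
  linarith

end Smoothing

/-! ### Lindeberg replacement and the Berry–Esseen induction. -/

section Lindeberg

variable {m : ℕ} {ρ : Measure (Fin m → ℝ)} [IsProbabilityMeasure ρ]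

instance isProbabilityMeasure_map_smul (w : ℝ) :
    IsProbabilityMeasure (ρ.map fun x => w • x) :=
  Measure.isProbabilityMeasure_map (by fun_prop)

/-- Rescaling by `σ` turns the noise into a standard one and the shift into `(w / σ) • x`; this is
the origin of the factor `(|w| / σ) ^ 3`. -/
lemma integral_conv_gaussN {h : (Fin m → ℝ) → ℝ} {B : ℝ} (hh : Measurable h)
    (hB : ∀ x, |h x| ≤ B) (w : ℝ) {σ : ℝ} (hσ : 0 < σ) :
    ∫ x, h x ∂(ρ.map (fun x => w • x) ∗ gaussN m (σ ^ 2)) =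
      ∫ x, ∫ z, h (σ • ((w / σ) • x + z)) ∂stdNormal m ∂ρ := by
  rw [integral_conv ((integrable_const B).mono' hh.aestronglyMeasurable (ae_of_all _ hB)),
    ← stdNormal_map_smul, integral_map (by fun_prop)]
  · refine integral_congr_ae (ae_of_all _ fun x => ?_)
    simp only
    rw [integral_map (f := fun y => h (w • x + y)) (by fun_prop)
      (hh.comp (measurable_const_add (w • x))).aestronglyMeasurable]
    refine integral_congr_ae (ae_of_all _ fun z => ?_)
    simp only [smul_add, smul_smul, mul_div_cancel₀ _ hσ.ne']
  · exact (StronglyMeasurable.integral_prod_right'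
      (f := fun p : (Fin m → ℝ) × (Fin m → ℝ) => h (p.1 + p.2))
      (hh.comp (measurable_fst.add measurable_snd)).stronglyMeasurable).aestronglyMeasurable

lemma abs_integral_conv_gaussN_sub_le (hρ : IsStandardized ρ) {h : (Fin m → ℝ) → ℝ} {B : ℝ}
    (hh : Measurable h) (hB : ∀ x, |h x| ≤ B) (w : ℝ) {σ : ℝ} (hσ : 0 < σ) :
    |∫ x, h x ∂(ρ.map (fun x => w • x) ∗ gaussN m (σ ^ 2)) -
      ∫ x, h x ∂(gaussN m (w ^ 2) ∗ gaussN m (σ ^ 2))| ≤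
      B * kernelConst m * (|w| / σ) ^ 3 * (cubeMoment ρ + cubeMoment (stdNormal m)) := by
  rw [← stdNormal_map_smul m w, integral_conv_gaussN hh hB w hσ, integral_conv_gaussN hh hB w hσ]
  have := abs_integral_smoothing_sub_le (h := fun x => h (σ • x)) hρ
    (hh.comp (measurable_id.const_smul σ)) (fun x => hB _) (w / σ)
  rwa [abs_div, abs_of_pos hσ] at this

lemma conv_real_eq_integral_indicator (θ τ : Measure (Fin m → ℝ)) [IsProbabilityMeasure θ]
    [IsProbabilityMeasure τ] {A : Set (Fin m → ℝ)} (hA : MeasurableSet A) :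
    (τ ∗ θ).real A = ∫ y, τ.real ((fun x => y + x) ⁻¹' A) ∂θ := by
  rw [Measure.conv_comm, conv_real_apply _ _ hA]

/-- One step of the replacement of summands by Gaussian ones. -/
lemma abs_conv_sub_conv_le (hρ : IsStandardized ρ) (τ : Measure (Fin m → ℝ))
    [IsProbabilityMeasure τ] {v σ Δ : ℝ} (hv : 0 ≤ v) (hσ : 0 < σ)
    (hΔ : ∀ a b, |τ.real (Set.Icc a b) - (gaussN m v).real (Set.Icc a b)| ≤ Δ) (w : ℝ)
    (a b : Fin m → ℝ) :
    |((τ ∗ ρ.map (fun x => w • x)) ∗ gaussN m (σ ^ 2)).real (Set.Icc a b) -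
      (τ ∗ gaussN m (w ^ 2 + σ ^ 2)).real (Set.Icc a b)| ≤
      kernelConst m * (cubeMoment ρ + cubeMoment (stdNormal m)) * |w| ^ 3 *
        (Δ / σ ^ 3 + 1 / √(σ ^ 2 + v) ^ 3) := by
  have hA : MeasurableSet (Set.Icc a b) := measurableSet_Icc
  rw [Measure.conv_assoc, ← gaussN_conv_gaussN m (sq_nonneg w) (sq_nonneg σ)]
  set θ₁ := ρ.map (fun x => w • x) ∗ gaussN m (σ ^ 2) with hθ₁
  set θ₂ := gaussN m (w ^ 2) ∗ gaussN m (σ ^ 2) with hθ₂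
  set σ' := √(σ ^ 2 + v)
  have hσ' : 0 < σ' := Real.sqrt_pos.2 (by positivity)
  have hσ'2 : σ' ^ 2 = σ ^ 2 + v := Real.sq_sqrt (by positivity)
  -- Write `τ` as `N(0, v)` plus a signed difference. The Gaussian part adds its variance `v` to the
  -- noise, so its error has the larger denominator `√(σ² + v) ^ 3`.
  have e1 : gaussN m v ∗ θ₁ = ρ.map (fun x => w • x) ∗ gaussN m (σ' ^ 2) := by
    rw [hθ₁, Measure.conv_comm, Measure.conv_assoc, gaussN_conv_gaussN m (sq_nonneg σ) hv, hσ'2]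
  have e2 : gaussN m v ∗ θ₂ = gaussN m (w ^ 2) ∗ gaussN m (σ' ^ 2) := by
    rw [hθ₂, Measure.conv_comm, Measure.conv_assoc, gaussN_conv_gaussN m (sq_nonneg σ) hv, hσ'2]
  have b1 := abs_integral_conv_gaussN_sub_le hρ (B := 1)
    (h := (Set.Icc a b).indicator 1) (measurable_one.indicator hA)
    (fun x => by
      by_cases hx : x ∈ Set.Icc a b
      · simp [Set.indicator_of_mem hx]
      · simp [Set.indicator_of_notMem hx]) w hσ'
  rw [integral_indicator_one hA, integral_indicator_one hA, ← e1, ← e2,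
    conv_real_eq_integral_indicator _ _ hA, conv_real_eq_integral_indicator _ _ hA] at b1
  -- The signed difference, as a function of the translation of the box, is bounded by `Δ`; only the
  -- noise `σ` is available here, but the error carries the factor `Δ`.
  have b2 := abs_integral_conv_gaussN_sub_le hρ (B := Δ)
    (h := fun y => τ.real ((fun x => y + x) ⁻¹' Set.Icc a b) -
      (gaussN m v).real ((fun x => y + x) ⁻¹' Set.Icc a b))
    ((measurable_real_preimage_add _ hA).sub (measurable_real_preimage_add _ hA))
    (fun y => by rw [preimage_add_Icc]; exact hΔ _ _) w hσ
  have hi : ∀ κ θ : Measure (Fin m → ℝ), IsProbabilityMeasure κ → IsProbabilityMeasure θ →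
      Integrable (fun y => κ.real ((fun x => y + x) ⁻¹' Set.Icc a b)) θ :=
    fun κ θ _ _ => (integrable_const (1 : ℝ)).mono'
      (measurable_real_preimage_add κ measurableSet_Icc).aestronglyMeasurable
      (ae_of_all _ fun y => by
        rw [Real.norm_of_nonneg measureReal_nonneg]; exact measureReal_le_one)
  rw [← hθ₁, ← hθ₂, integral_sub (hi _ _ inferInstance inferInstance)
    (hi _ _ inferInstance inferInstance), integral_sub (hi _ _ inferInstance inferInstance)
    (hi _ _ inferInstance inferInstance)] at b2
  rw [conv_real_eq_integral_indicator _ _ hA, conv_real_eq_integral_indicator _ _ hA]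
  have e3 : kernelConst m * (cubeMoment ρ + cubeMoment (stdNormal m)) * |w| ^ 3 *
        (Δ / σ ^ 3 + 1 / σ' ^ 3) =
      Δ * kernelConst m * (|w| / σ) ^ 3 * (cubeMoment ρ + cubeMoment (stdNormal m)) +
      1 * kernelConst m * (|w| / σ') ^ 3 * (cubeMoment ρ + cubeMoment (stdNormal m)) := by
    rw [div_pow, div_pow]; ring
  rw [e3]
  rw [abs_le] at *
  constructor <;> linarith

variable (ρ) in
/-- The law of `∑ k < n, w k • ζ k` for independent `ζ k` with law `ρ`. -/
def weightedSumLaw (w : ℕ → ℝ) : ℕ → Measure (Fin m → ℝ)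
  | 0 => Measure.dirac 0
  | n + 1 => weightedSumLaw w n ∗ ρ.map fun x => w n • x

instance (w : ℕ → ℝ) (n : ℕ) : IsProbabilityMeasure (weightedSumLaw ρ w n) := by
  induction n with
  | zero => unfold weightedSumLaw; infer_instance
  | succ n ih => unfold weightedSumLaw; infer_instance

/-- A discrete form of `∫ u^{-3/2} du = -2 u^{-1/2}`: each summand is at most an increment of `2 /
√u`, and these telescope. -/
lemma sum_div_sqrt_cube_le (w : ℕ → ℝ) (u : ℕ → ℝ) (n : ℕ) (hu : ∀ i ≤ n, 0 < u i)
    (hstep : ∀ i < n, u (i + 1) = u i - w i ^ 2) :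
    ∑ i ∈ Finset.range n, w i ^ 2 / √(u i) ^ 3 ≤ 2 / √(u n) := by
  have h : ∀ i < n, w i ^ 2 / √(u i) ^ 3 ≤ 2 / √(u (i + 1)) - 2 / √(u i) := by
    intro i hi
    have hx := Real.sqrt_pos.2 (hu i hi.le)
    have hy := Real.sqrt_pos.2 (hu (i + 1) hi)
    have hx2 := Real.sq_sqrt (hu i hi.le).le
    have hy2 := Real.sq_sqrt (hu (i + 1) hi).le
    have hw : w i ^ 2 = √(u i) ^ 2 - √(u (i + 1)) ^ 2 := by rw [hx2, hy2, hstep i hi]; ring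
    have hle : √(u (i + 1)) ≤ √(u i) := by
      refine Real.sqrt_le_sqrt ?_
      rw [hstep i hi]; nlinarith [sq_nonneg (w i)]
    rw [hw]
    generalize √(u i) = x at *
    generalize √(u (i + 1)) = y at *
    rw [div_sub_div _ _ hy.ne' hx.ne', div_le_div_iff₀ (by positivity) (by positivity)]
    have h1 : (2 * x - y * 2) * x ^ 3 - (x ^ 2 - y ^ 2) * (y * x) =
      (x - y) * x * (2 * x ^ 2 - x * y - y ^ 2) := by ring
    have h2 : 0 ≤ (x - y) * x * (2 * x ^ 2 - x * y - y ^ 2) := by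
      refine mul_nonneg (mul_nonneg (by linarith) hx.le) ?_
      nlinarith
    linarith
  calc _ ≤ ∑ i ∈ Finset.range n, (2 / √(u (i + 1)) - 2 / √(u i)) :=
        Finset.sum_le_sum fun i hi => h i (Finset.mem_range.1 hi)
    _ = 2 / √(u n) - 2 / √(u 0) := Finset.sum_range_sub (fun i => 2 / √(u i)) n
    _ ≤ 2 / √(u n) := by
        have : 0 ≤ 2 / √(u 0) := by positivity
        linarith

lemma abs_real_sub_real_le_one {α β : Type*} [MeasurableSpace α] [MeasurableSpace β]
    (μ : Measure α) (ν : Measure β) [IsProbabilityMeasure μ] [IsProbabilityMeasure ν]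
    (s : Set α) (t : Set β) :
    |μ.real s - ν.real t| ≤ 1 := by
  have h1 := measureReal_le_one (μ := μ) (s := s)
  have h2 := measureReal_le_one (μ := ν) (s := t)
  have h3 := measureReal_nonneg (μ := μ) (s := s)
  have h4 := measureReal_nonneg (μ := ν) (s := t)
  rw [abs_le]
  constructor <;> linarith

/-- Distance on boxes of the Gaussian smoothing of a weighted sum from the Gaussian law, given
bounds for the shorter sums. -/
lemma abs_smoothed_weightedSumLaw_sub_le (hρ : IsStandardized ρ) (w : ℕ → ℝ) (n : ℕ) {ε : ℝ}
    (hε : 0 < ε) (Δ : ℕ → ℝ)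
    (hΔ : ∀ i < n, ∀ a b, |(weightedSumLaw ρ w i).real (Set.Icc a b) -
      (gaussN m (∑ k ∈ Finset.range i, w k ^ 2)).real (Set.Icc a b)| ≤ Δ i)
    (a b : Fin m → ℝ) :
    |(weightedSumLaw ρ w n ∗ gaussN m (ε ^ 2)).real (Set.Icc a b) -
      (gaussN m (∑ k ∈ Finset.range n, w k ^ 2) ∗ gaussN m (ε ^ 2)).real (Set.Icc a b)| ≤
      ∑ i ∈ Finset.range n, kernelConst m * (cubeMoment ρ + cubeMoment (stdNormal m)) *
        |w i| ^ 3 * (Δ i / √(ε ^ 2 + ∑ k ∈ Finset.Ico (i + 1) n, w k ^ 2) ^ 3 +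
          1 / √(ε ^ 2 + ∑ k ∈ Finset.Ico (i + 1) n, w k ^ 2 +
            ∑ k ∈ Finset.range i, w k ^ 2) ^ 3) := by
  -- In `E i` the first `i` summands are the original ones and the others are Gaussian, merged with
  -- the noise. Step `i` thus has smoothing variance `ε²` plus the variance of the later summands.
  set E : ℕ → ℝ := fun i => (weightedSumLaw ρ w i ∗
    gaussN m (ε ^ 2 + ∑ k ∈ Finset.Ico i n, w k ^ 2)).real (Set.Icc a b) with hE
  have hE0 : E 0 = (gaussN m (∑ k ∈ Finset.range n, w k ^ 2) ∗
      gaussN m (ε ^ 2)).real (Set.Icc a b) := by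
    simp only [hE, weightedSumLaw, Measure.dirac_zero_conv, Finset.range_eq_Ico]
    rw [gaussN_conv_gaussN m (Finset.sum_nonneg fun _ _ => sq_nonneg _) (sq_nonneg ε), add_comm]
  have hEn : E n = (weightedSumLaw ρ w n ∗ gaussN m (ε ^ 2)).real (Set.Icc a b) := by
    simp [hE]
  rw [← hE0, ← hEn, ← Finset.sum_range_sub E n]
  refine (Finset.abs_sum_le_sum_abs _ _).trans (Finset.sum_le_sum fun i hi => ?_)
  have hi' := Finset.mem_range.1 hi
  have hs0 : 0 ≤ ∑ k ∈ Finset.Ico (i + 1) n, w k ^ 2 :=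
    Finset.sum_nonneg fun _ _ => sq_nonneg _
  have hsq : √(ε ^ 2 + ∑ k ∈ Finset.Ico (i + 1) n, w k ^ 2) ^ 2 =
      ε ^ 2 + ∑ k ∈ Finset.Ico (i + 1) n, w k ^ 2 := Real.sq_sqrt (by positivity)
  have := abs_conv_sub_conv_le hρ (weightedSumLaw ρ w i)
    (Finset.sum_nonneg fun _ _ => sq_nonneg _)
    (Real.sqrt_pos.2 (by positivity : 0 < ε ^ 2 + ∑ k ∈ Finset.Ico (i + 1) n, w k ^ 2))
    (hΔ i hi') (w i) a b
  rw [hsq] at this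
  refine le_of_eq_of_le ?_ this
  simp only [hE, weightedSumLaw]
  congr 5
  rw [Finset.sum_eq_sum_Ico_succ_bot hi']
  ring

set_option maxHeartbeats 1600000 in
/-- A Berry–Esseen bound on boxes for weighted sums of independent standardized vectors. -/
theorem exists_berryEsseen_box {m : ℕ} (hm : 0 < m) : ∃ K : ℝ, 0 ≤ K ∧
    ∀ (ρ : Measure (Fin m → ℝ)) [IsProbabilityMeasure ρ], IsStandardized ρ →
    ∀ (w : ℕ → ℝ) (W : ℝ), (∀ k, |w k| ≤ W) → ∀ n, 0 < ∑ k ∈ Finset.range n, w k ^ 2 →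
    ∀ a b, |(weightedSumLaw ρ w n).real (Set.Icc a b) -
      (gaussN m (∑ k ∈ Finset.range n, w k ^ 2)).real (Set.Icc a b)| ≤
        K * (cubeMoment ρ * W) / √(∑ k ∈ Finset.range n, w k ^ 2) := by
  obtain ⟨C, hC0, hC⟩ := exists_smoothing_bound m
  set c := kernelConst m * (1 + cubeMoment (stdNormal m)) with hc
  have hk1 := one_le_kernelConst m
  have hg0 := cubeMoment_nonneg (stdNormal m)
  have hc0 : 0 < c := by positivity
  -- `A` makes the contribution of the induction hypothesis, `9 c K / A`, at most `K / 2`; then `K`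
  -- is twice the sum of the remaining errors, so that the induction reproduces `K`. The bound `2 ≤
  -- A` makes the noise dominate a single weight.
  set A := max 2 (18 * c) with hA
  have hA2 : 2 ≤ A := le_max_left _ _
  have hAc : 18 * c ≤ A := le_max_right _ _
  set K := 2 * (C * A + 8 * c) with hK
  have hK0 : 0 ≤ K := by positivity
  refine ⟨K, hK0, fun ρ _ hρ w W hW n => ?_⟩
  have hβ := hρ.one_le_cubeMoment hm
  set β := cubeMoment ρ
  induction n using Nat.strong_induction_on with
  | _ n ih =>
  intro hV
  set V := ∑ k ∈ Finset.range n, w k ^ 2 with hVdef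
  have hsV := Real.sqrt_pos.2 hV
  have hsV2 := Real.sq_sqrt hV.le
  have hW0 : 0 < W := by
    refine lt_of_le_of_ne ((abs_nonneg _).trans (hW 0)) fun h => hV.ne' ?_
    refine Finset.sum_eq_zero fun k _ => ?_
    have := hW k
    rw [← h] at this
    simp [abs_nonpos_iff.1 this]
  set ε := A * (β * W) with hε
  have hβW : 0 < β * W := by positivity
  have hε0 : 0 < ε := by positivity
  have hεW : 2 * W ≤ ε := by
    rw [hε]
    nlinarith [mul_le_mul_of_nonneg_right hβ hW0.le]
  have hεW2 : 4 * W ^ 2 ≤ ε ^ 2 := by nlinarith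
  have hw2 : ∀ k, w k ^ 2 ≤ W ^ 2 := fun k => by
    rw [← sq_abs]; exact pow_le_pow_left₀ (abs_nonneg _) (hW k) 2
  set v : ℕ → ℝ := fun i => ∑ k ∈ Finset.range i, w k ^ 2 with hv
  have hv0 : ∀ i, 0 ≤ v i := fun i => Finset.sum_nonneg fun _ _ => sq_nonneg _
  have hvV : ∀ i ≤ n, v i ≤ V := fun i hi =>
    Finset.sum_le_sum_of_subset_of_nonneg (Finset.range_subset_range.2 hi)
      fun _ _ _ => sq_nonneg _
  have hvs : ∀ i, v (i + 1) = v i + w i ^ 2 := fun i => Finset.sum_range_succ _ _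
  -- A lower bound for the smoothing variance at step `i`: since `w i ^ 2 ≤ ε ^ 2 / 2`, half of `ε²`
  -- pays for the current summand, and `u` decreases exactly by `w i ^ 2`.
  set u : ℕ → ℝ := fun i => ε ^ 2 / 2 + V - v i with hu
  have hupos : ∀ i ≤ n, 0 < u i := fun i hi => by
    have := hvV i hi
    have : 0 < ε ^ 2 := by positivity
    simp only [hu]
    linarith
  have hsum := sum_div_sqrt_cube_le w u n hupos fun i _ => by simp only [hu, hvs]; ring
  have hun : 2 / √(u n) ≤ 3 / ε := by
    have h1 : u n = ε ^ 2 / 2 := by simp [hu, hv, hVdef]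
    have h2 : 2 / 3 * ε ≤ √(u n) := by
      refine Real.le_sqrt_of_sq_le ?_
      rw [h1]
      nlinarith [sq_nonneg ε]
    rw [div_le_div_iff₀ (Real.sqrt_pos.2 (hupos n le_rfl)) hε0]
    linarith
  -- While at most half of the variance is used up, the later Gaussians smooth at scale `√V` and the
  -- trivial bound is enough. Afterwards `√(v i)` is comparable to `√V`, and the induction
  -- hypothesis is as good as the target.
  set Δ : ℕ → ℝ := fun i => if v i ≤ V / 2 then 1 else K * (β * W) / √(v i) with hΔdef
  have hΔ : ∀ i < n, ∀ a b, |(weightedSumLaw ρ w i).real (Set.Icc a b) -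
      (gaussN m (∑ k ∈ Finset.range i, w k ^ 2)).real (Set.Icc a b)| ≤ Δ i := by
    intro i hi a b
    simp only [hΔdef]
    split_ifs with h
    · exact abs_real_sub_real_le_one _ _ _ _
    · exact ih i hi (by push Not at h; simp only [hv] at h; linarith) a b
  have hterm : ∀ i < n, kernelConst m * (β + cubeMoment (stdNormal m)) *
        |w i| ^ 3 * (Δ i / √(ε ^ 2 + ∑ k ∈ Finset.Ico (i + 1) n, w k ^ 2) ^ 3 +
          1 / √(ε ^ 2 + ∑ k ∈ Finset.Ico (i + 1) n, w k ^ 2 +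
            ∑ k ∈ Finset.range i, w k ^ 2) ^ 3) ≤
      c * (β * W) * (4 / √V ^ 3 * w i ^ 2 +
        3 / 2 * (K * (β * W) / √V) * (w i ^ 2 / √(u i) ^ 3)) := by
    intro i hi
    have hIco : ∑ k ∈ Finset.Ico (i + 1) n, w k ^ 2 = V - v (i + 1) := by
      rw [Finset.sum_Ico_eq_sub _ hi]
    have hui := hupos i hi.le
    have hwi := hw2 i
    have hle1 : u i ≤ ε ^ 2 + ∑ k ∈ Finset.Ico (i + 1) n, w k ^ 2 := by
      rw [hIco, hvs]; simp only [hu]; nlinarith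
    have hle2 : V ≤ ε ^ 2 + ∑ k ∈ Finset.Ico (i + 1) n, w k ^ 2 +
        ∑ k ∈ Finset.range i, w k ^ 2 := by
      rw [hIco, hvs]
      change V ≤ ε ^ 2 + (V - (v i + w i ^ 2)) + v i
      nlinarith
    have hsu := Real.sqrt_pos.2 hui
    have hs1 := Real.sqrt_le_sqrt hle1
    have hs2 := Real.sqrt_le_sqrt hle2
    have hw3 : |w i| ^ 3 ≤ W * w i ^ 2 := by
      rw [pow_succ, sq_abs, mul_comm]
      exact mul_le_mul_of_nonneg_right (hW i) (sq_nonneg _)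
    have hc' : kernelConst m * (β + cubeMoment (stdNormal m)) ≤ c * β := by
      rw [hc, mul_assoc]
      gcongr
      nlinarith
    have hΔ0 : 0 ≤ Δ i := by
      simp only [hΔdef]; split_ifs <;> positivity
    have hΔi : Δ i / √(ε ^ 2 + ∑ k ∈ Finset.Ico (i + 1) n, w k ^ 2) ^ 3 ≤
        3 / √V ^ 3 + 3 / 2 * (K * (β * W) / √V) * (1 / √(u i) ^ 3) := by
      simp only [hΔdef]
      split_ifs with h
      -- The left side is `0.7 √V`: one has `0.7² ≤ 1/2`, and `3 · 0.7³ ≥ 1` gives the constant `3`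
      -- below.
      · have h1 : 2 / 3 * √V + √V / 30 ≤ √(ε ^ 2 + ∑ k ∈ Finset.Ico (i + 1) n, w k ^ 2) := by
          refine Real.le_sqrt_of_sq_le ?_
          have : V / 2 ≤ u i := by
            simp only [hu]; nlinarith [sq_nonneg ε]
          nlinarith
        have h2 : 1 / √(ε ^ 2 + ∑ k ∈ Finset.Ico (i + 1) n, w k ^ 2) ^ 3 ≤ 3 / √V ^ 3 := by
          have h3 : (7 / 10 * √V) ^ 3 ≤ √(ε ^ 2 + ∑ k ∈ Finset.Ico (i + 1) n, w k ^ 2) ^ 3 :=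
            pow_le_pow_left₀ (by positivity) (by linarith) 3
          have h4 : 0 < √V ^ 3 := by positivity
          rw [div_le_div_iff₀ (by nlinarith) h4]
          nlinarith
        have h5 : 0 ≤ 3 / 2 * (K * (β * W) / √V) * (1 / √(u i) ^ 3) := by positivity
        linarith
      · push Not at h
        have hvi : 0 < v i := by linarith
        have h1 : 2 / 3 * √V ≤ √(v i) := by
          refine Real.le_sqrt_of_sq_le ?_
          nlinarith
        have h2 : K * (β * W) / √(v i) ≤ 3 / 2 * (K * (β * W) / √V) := by
          calc K * (β * W) / √(v i) ≤ K * (β * W) / (2 / 3 * √V) := by gcongr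
            _ = _ := by field_simp
        have h3 : K * (β * W) / √(v i) / √(ε ^ 2 + ∑ k ∈ Finset.Ico (i + 1) n, w k ^ 2) ^ 3 ≤
            3 / 2 * (K * (β * W) / √V) / √(u i) ^ 3 := by gcongr
        have h4 : 0 ≤ 3 / √V ^ 3 := by positivity
        rw [mul_one_div]
        linarith
    have h1V : 1 / √(ε ^ 2 + ∑ k ∈ Finset.Ico (i + 1) n, w k ^ 2 +
            ∑ k ∈ Finset.range i, w k ^ 2) ^ 3 ≤ 1 / √V ^ 3 := by gcongr
    calc _ ≤ (c * β) * (W * w i ^ 2) * ((3 / √V ^ 3 + 3 / 2 * (K * (β * W) / √V) *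
          (1 / √(u i) ^ 3)) + 1 / √V ^ 3) := by
          gcongr
      _ = _ := by ring
  have hδ : ∀ a b, |(gaussN m (ε ^ 2) ∗ weightedSumLaw ρ w n).real (Set.Icc a b) -
        (gaussN m (ε ^ 2) ∗ gaussN m V).real (Set.Icc a b)| ≤
        c * (β * W) / √V * (4 + 9 / 2 * (K / A)) := by
    intro a b
    rw [Measure.conv_comm (gaussN m (ε ^ 2)), Measure.conv_comm (gaussN m (ε ^ 2))]
    refine (abs_smoothed_weightedSumLaw_sub_le hρ w n hε0 Δ hΔ a b).trans ?_
    refine (Finset.sum_le_sum fun i hi => hterm i (Finset.mem_range.1 hi)).trans ?_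
    rw [← Finset.mul_sum, Finset.sum_add_distrib, ← Finset.mul_sum, ← Finset.mul_sum, ← hVdef]
    have h1 : 4 / √V ^ 3 * V = 4 / √V := by
      nth_rw 2 [← hsV2]
      field_simp
    have h2 : 3 / 2 * (K * (β * W) / √V) * ∑ i ∈ Finset.range n, w i ^ 2 / √(u i) ^ 3 ≤
        3 / 2 * (K * (β * W) / √V) * (3 / ε) := by
      gcongr
      exact hsum.trans hun
    have h3 : 3 / 2 * (K * (β * W) / √V) * (3 / ε) = 9 / 2 * (K / A) / √V := by
      rw [hε]
      field_simp
      ring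
    calc _ ≤ c * (β * W) * (4 / √V + 9 / 2 * (K / A) / √V) := by
          rw [h1]
          gcongr
          exact h2.trans h3.le
      _ = _ := by ring
  intro a b
  refine (hC (weightedSumLaw ρ w n) V ε _ hV hε0.le hδ a b).trans ?_
  -- The choice of `ε` proportional to `A β W` has put `A` in the denominator of the inductive term,
  -- so this half of `K` closes the induction.
  have h1 : c * (K / A) ≤ K / 18 := by
    rw [← mul_div_assoc, div_le_div_iff₀ (by positivity) (by norm_num)]
    nlinarith
  calc 2 * (c * (β * W) / √V * (4 + 9 / 2 * (K / A))) + C * ε / √V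
      = β * W / √V * (8 * c + 9 * (c * (K / A)) + C * A) := by rw [hε]; ring
    _ ≤ β * W / √V * (8 * c + 9 * (K / 18) + C * A) := by gcongr
    _ = K * (β * W) / √V := by rw [hK]; ring

end Lindeberg

/-! ### Perturbation of square roots of positive definite matrices. -/

section MatrixCalculus

variable {m : ℕ} {A B : Matrix (Fin m) (Fin m) ℝ}

lemma continuousOn_spectrum (f : ℝ → ℝ) (A : Matrix (Fin m) (Fin m) ℝ) :
    ContinuousOn f (spectrum ℝ A) :=
  Matrix.finite_real_spectrum.continuousOn f

lemma posSemidef_cfc (hA : A.IsHermitian) {f : ℝ → ℝ} (hf : ∀ t ∈ spectrum ℝ A, 0 ≤ f t) :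
    (cfc f A).PosSemidef := by
  rw [hA.cfc_eq, Matrix.IsHermitian.cfc, Unitary.conjStarAlgAut_apply]
  refine Matrix.PosSemidef.mul_mul_conjTranspose_same (Matrix.posSemidef_diagonal_iff.2 fun i => ?_)
    (hA.eigenvectorUnitary : Matrix (Fin m) (Fin m) ℝ)
  exact hf _ (by rw [hA.spectrum_real_eq_range_eigenvalues]; exact ⟨i, rfl⟩)

lemma cfc_mul_cfc (f g : ℝ → ℝ) (A : Matrix (Fin m) (Fin m) ℝ) :
    cfc f A * cfc g A = cfc (fun t => f t * g t) A :=
  (cfc_mul f g A (continuousOn_spectrum f A) (continuousOn_spectrum g A)).symm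

lemma cfc_sub_smul_one (hA : A.IsHermitian) (f : ℝ → ℝ) (c : ℝ) :
    cfc f A - c • (1 : Matrix (Fin m) (Fin m) ℝ) = cfc (fun t => f t - c) A := by
  rw [cfc_sub f (fun _ => c) A (continuousOn_spectrum f A) continuousOn_const,
    cfc_const c A hA.isSelfAdjoint, Algebra.algebraMap_eq_smul_one]

lemma smul_one_sub_cfc (hA : A.IsHermitian) (f : ℝ → ℝ) (c : ℝ) :
    c • (1 : Matrix (Fin m) (Fin m) ℝ) - cfc f A = cfc (fun t => c - f t) A := by
  rw [cfc_sub (fun _ => c) f A continuousOn_const (continuousOn_spectrum f A),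
    cfc_const c A hA.isSelfAdjoint, Algebra.algebraMap_eq_smul_one]

lemma posSemidef_sub_of_spectrum (hA : A.IsHermitian) {c : ℝ} (h : spectrum ℝ A ⊆ Set.Ici c) :
    (A - c • (1 : Matrix (Fin m) (Fin m) ℝ)).PosSemidef := by
  have h1 := posSemidef_cfc hA (f := fun t => id t - c) fun t ht => sub_nonneg.2 (h ht)
  rwa [← cfc_sub_smul_one hA, cfc_id ℝ A hA.isSelfAdjoint] at h1

lemma spectrum_subset_Ici_of_posSemidef {c : ℝ}
    (h : (A - c • (1 : Matrix (Fin m) (Fin m) ℝ)).PosSemidef) : spectrum ℝ A ⊆ Set.Ici c := by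
  intro t ht
  have h1 : t - c ∈ spectrum ℝ (A - algebraMap ℝ (Matrix (Fin m) (Fin m) ℝ) c) := by
    rw [← spectrum.sub_singleton_eq]
    exact Set.sub_mem_sub ht rfl
  rw [Algebra.algebraMap_eq_smul_one, h.isHermitian.spectrum_real_eq_range_eigenvalues] at h1
  obtain ⟨i, hi⟩ := h1
  have := h.eigenvalues_nonneg i
  simp only [Set.mem_Ici]
  linarith

/-- The quadratic form changes by at most `δ (∑ |x i|)²`, which is at most `m δ |x|²` by
Cauchy–Schwarz. -/
lemma spectrum_subset_of_abs_sub_le (hA : A.IsHermitian) (hB : B.IsHermitian) {c δ : ℝ}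
    (h : spectrum ℝ A ⊆ Set.Ici c) (hδ : ∀ i j, |B i j - A i j| ≤ δ) (hmδ : m * δ ≤ c / 2) :
    spectrum ℝ B ⊆ Set.Ici (c / 2) := by
  refine spectrum_subset_Ici_of_posSemidef (Matrix.posSemidef_iff_dotProduct_mulVec.2 ⟨?_, ?_⟩)
  · exact hB.sub (by simp [Matrix.IsHermitian])
  · intro x
    have h1 := (posSemidef_sub_of_spectrum hA h).dotProduct_mulVec_nonneg x
    have h2 : |x ⬝ᵥ (B - A) *ᵥ x| ≤ δ * (∑ i, |x i|) ^ 2 := by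
      simp only [dotProduct, Matrix.mulVec, Finset.mul_sum]
      refine (Finset.abs_sum_le_sum_abs _ _).trans ?_
      rw [sq, Finset.sum_mul_sum, Finset.mul_sum]
      refine Finset.sum_le_sum fun i _ => (Finset.abs_sum_le_sum_abs _ _).trans ?_
      rw [Finset.mul_sum]
      refine Finset.sum_le_sum fun j _ => ?_
      rw [abs_mul, abs_mul, Matrix.sub_apply]
      calc |x i| * (|B i j - A i j| * |x j|) = |B i j - A i j| * (|x i| * |x j|) := by ring
        _ ≤ δ * (|x i| * |x j|) := mul_le_mul_of_nonneg_right (hδ i j) (by positivity)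
    have h3 : (∑ i, |x i|) ^ 2 ≤ m * (x ⬝ᵥ x) := by
      have := sq_sum_le_card_mul_sum_sq (s := Finset.univ) (f := fun i => |x i|)
      simpa [dotProduct, sq] using this
    have hx0 : 0 ≤ x ⬝ᵥ x := Finset.sum_nonneg fun i _ => mul_self_nonneg _
    simp only [star_trivial, Matrix.sub_mulVec, dotProduct_sub, Matrix.smul_mulVec,
      Matrix.one_mulVec, dotProduct_smul, smul_eq_mul] at h1 h2 ⊢
    have h4 := (abs_le.1 h2).1
    rcases isEmpty_or_nonempty (Fin m) with he | ⟨⟨i⟩⟩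
    · simp [dotProduct]
    have hδ0 : 0 ≤ δ := (abs_nonneg _).trans (hδ i i)
    nlinarith [mul_le_mul_of_nonneg_left h3 hδ0, mul_le_mul_of_nonneg_right hmδ hx0]

lemma sqrt_mul_sqrt {c : ℝ} (hc : 0 < c) (hA : A.IsHermitian) (h : spectrum ℝ A ⊆ Set.Ici c) :
    cfc Real.sqrt A * cfc Real.sqrt A = A := by
  rw [cfc_mul_cfc]
  nth_rw 2 [← cfc_id ℝ A hA.isSelfAdjoint]
  exact cfc_congr fun t ht => Real.mul_self_sqrt (hc.le.trans (h ht))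

lemma invSqrt_mul_sqrt {c : ℝ} (hc : 0 < c) (hA : A.IsHermitian) (h : spectrum ℝ A ⊆ Set.Ici c) :
    Learner.invSqrt A * cfc Real.sqrt A = 1 := by
  rw [Learner.invSqrt, cfc_mul_cfc, ← cfc_one ℝ A hA.isSelfAdjoint]
  exact cfc_congr fun t ht => inv_mul_cancel₀ (Real.sqrt_pos.2 (hc.trans_le (h ht))).ne'

lemma sqrt_mul_invSqrt {c : ℝ} (hc : 0 < c) (hA : A.IsHermitian) (h : spectrum ℝ A ⊆ Set.Ici c) :
    cfc Real.sqrt A * Learner.invSqrt A = 1 := by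
  rw [Learner.invSqrt, cfc_mul_cfc, ← cfc_one ℝ A hA.isSelfAdjoint]
  exact cfc_congr fun t ht => mul_inv_cancel₀ (Real.sqrt_pos.2 (hc.trans_le (h ht))).ne'

lemma invSqrt_mul_mul_invSqrt {c : ℝ} (hc : 0 < c) (hA : A.IsHermitian) (h : spectrum ℝ A ⊆ Set.Ici c) :
    Learner.invSqrt A * A * Learner.invSqrt A = 1 := by
  nth_rw 2 [← sqrt_mul_sqrt hc hA h]
  rw [← mul_assoc, invSqrt_mul_sqrt hc hA h, one_mul, sqrt_mul_invSqrt hc hA h]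

lemma isHermitian_cfc (f : ℝ → ℝ) (A : Matrix (Fin m) (Fin m) ℝ) : (cfc f A).IsHermitian :=
  cfc_predicate (p := IsSelfAdjoint) f A

/-- The squared norm of row `i` of `A^{-1/2}` is the diagonal entry `(A⁻¹) i i`, at most `1 / c`. -/
lemma abs_invSqrt_apply_le {c : ℝ} (hc : 0 < c) (hA : A.IsHermitian) (h : spectrum ℝ A ⊆ Set.Ici c)
    (i j : Fin m) : |Learner.invSqrt A i j| ≤ 1 / √c := by
  have h1 : ((1 / c) • (1 : Matrix (Fin m) (Fin m) ℝ) -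
      Learner.invSqrt A * Learner.invSqrt A).PosSemidef := by
    rw [Learner.invSqrt, cfc_mul_cfc, smul_one_sub_cfc hA]
    refine posSemidef_cfc hA fun t ht => ?_
    rw [← mul_inv, Real.mul_self_sqrt (hc.le.trans (h ht)), sub_nonneg, one_div]
    exact inv_anti₀ hc (h ht)
  have h2 := h1.diag_nonneg (i := i)
  have hsymm : ∀ k, Learner.invSqrt A k i = Learner.invSqrt A i k := fun k => by
    unfold Learner.invSqrt
    simpa using (isHermitian_cfc (fun t : ℝ => (√t)⁻¹) A).apply i k
  simp only [Matrix.sub_apply, Matrix.smul_apply, Matrix.one_apply_eq, Matrix.mul_apply, hsymm,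
    smul_eq_mul, mul_one] at h2
  have h3 : Learner.invSqrt A i j * Learner.invSqrt A i j ≤
      ∑ k, Learner.invSqrt A i k * Learner.invSqrt A i k :=
    Finset.single_le_sum (f := fun k => Learner.invSqrt A i k * Learner.invSqrt A i k)
      (fun k _ => mul_self_nonneg _) (Finset.mem_univ j)
  rw [← Real.sqrt_one, ← Real.sqrt_div zero_le_one]
  refine Real.abs_le_sqrt ?_
  rw [sq]
  linarith

/-- The square root of positive definite matrices is Lipschitz in the Frobenius norm. -/
lemma abs_sqrt_sub_sqrt_le {c δ : ℝ} (hc : 0 < c) (hA : A.IsHermitian) (hB : B.IsHermitian)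
    (h : spectrum ℝ A ⊆ Set.Ici c) (h' : spectrum ℝ B ⊆ Set.Ici c)
    (hδ : ∀ i j, |A i j - B i j| ≤ δ) (i j : Fin m) :
    |cfc Real.sqrt A i j - cfc Real.sqrt B i j| ≤ m * δ / (2 * √c) := by
  set X := cfc Real.sqrt A with hX
  set Y := cfc Real.sqrt B with hY
  set D := X - Y with hD
  have hsc := Real.sqrt_pos.2 hc
  have hδ0 : 0 ≤ δ := (abs_nonneg _).trans (hδ i j)
  have hDH : Dᴴ = D := ((isHermitian_cfc Real.sqrt A).sub (isHermitian_cfc Real.sqrt B))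
  have hPX : (X - √c • (1 : Matrix (Fin m) (Fin m) ℝ)).PosSemidef := by
    rw [hX, cfc_sub_smul_one hA]
    exact posSemidef_cfc hA fun t ht => sub_nonneg.2 (Real.sqrt_le_sqrt (h ht))
  have hPY : (Y - √c • (1 : Matrix (Fin m) (Fin m) ℝ)).PosSemidef := by
    rw [hY, cfc_sub_smul_one hB]
    exact posSemidef_cfc hB fun t ht => sub_nonneg.2 (Real.sqrt_le_sqrt (h' ht))
  have t1 := (hPX.conjTranspose_mul_mul_same D).trace_nonneg
  have t2 := (hPY.conjTranspose_mul_mul_same D).trace_nonneg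
  rw [hDH] at t1 t2
  -- With `X² = A` and `Y² = B` this is a Sylvester equation for `D = X - Y`. Tested against `D` in
  -- the trace it is coercive, because `X` and `Y` are at least `√c`; Cauchy–Schwarz for the
  -- Frobenius product then bounds `D`.
  have e1 : A - B = X * D + D * Y := by
    have a1 := sqrt_mul_sqrt hc hA h
    have a2 := sqrt_mul_sqrt hc hB h'
    rw [← hX] at a1
    rw [← hY] at a2
    rw [← a1, ← a2, hD]
    noncomm_ring
  have e2 : (D * (A - B)).trace = (D * X * D).trace + (D * Y * D).trace := by
    rw [e1, mul_add, Matrix.trace_add, ← mul_assoc, ← mul_assoc]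
    congr 1
    rw [mul_assoc, Matrix.trace_mul_comm, mul_assoc, Matrix.trace_mul_comm D (Y * D), 
      Matrix.trace_mul_comm]
  have e3 : (D * D).trace = ∑ i, ∑ j, D i j ^ 2 := by
    have hs : ∀ i j, D j i = D i j := fun i j => by
      simpa using congrFun (congrFun hDH i) j
    simp only [Matrix.trace, Matrix.diag, Matrix.mul_apply]
    exact Finset.sum_congr rfl fun i _ => Finset.sum_congr rfl fun j _ => by rw [hs, sq]
  have e4 : (D * (A - B)).trace = ∑ p : Fin m × Fin m, D p.1 p.2 * (A - B) p.2 p.1 := by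
    simp only [Matrix.trace, Matrix.diag, Matrix.mul_apply]
    rw [Fintype.sum_prod_type]
  have e5 : (D * D).trace = ∑ p : Fin m × Fin m, D p.1 p.2 ^ 2 := by
    rw [e3, Fintype.sum_prod_type]
  have hcs : ((D * (A - B)).trace) ^ 2 ≤ (D * D).trace * (m * δ) ^ 2 := by
    rw [e4, e5]
    refine (Finset.sum_mul_sq_le_sq_mul_sq _ _ _).trans ?_
    refine mul_le_mul_of_nonneg_left ?_ (Finset.sum_nonneg fun _ _ => sq_nonneg _)
    calc ∑ p : Fin m × Fin m, (A - B) p.2 p.1 ^ 2 ≤ ∑ p : Fin m × Fin m, δ ^ 2 := by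
          refine Finset.sum_le_sum fun p _ => ?_
          rw [← sq_abs]
          exact pow_le_pow_left₀ (abs_nonneg _) (hδ _ _) 2
      _ = (m * δ) ^ 2 := by simp; ring
  have hlow : 2 * √c * (D * D).trace ≤ (D * (A - B)).trace := by
    simp only [mul_sub, sub_mul, Matrix.mul_smul, mul_one, Matrix.smul_mul, Matrix.trace_sub,
      Matrix.trace_smul, smul_eq_mul] at t1 t2
    rw [e2]
    linarith
  have hF0 : 0 ≤ (D * D).trace := by
    rw [e5]; exact Finset.sum_nonneg fun _ _ => sq_nonneg _
  have hF : (D * D).trace ≤ (m * δ / (2 * √c)) ^ 2 := by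
    rcases hF0.eq_or_lt with h0 | h0
    · rw [← h0]; positivity
    · have h1 : (2 * √c * (D * D).trace) ^ 2 ≤ (D * D).trace * (m * δ) ^ 2 :=
        (pow_le_pow_left₀ (by positivity) hlow 2).trans hcs
      rw [div_pow, le_div_iff₀ (by positivity)]
      refine le_of_mul_le_mul_left ?_ h0
      linarith
  have hij : D i j ^ 2 ≤ (D * D).trace := by
    rw [e5]
    exact Finset.single_le_sum (f := fun p : Fin m × Fin m => D p.1 p.2 ^ 2)
      (fun _ _ => sq_nonneg _) (Finset.mem_univ (i, j))
  exact abs_le_of_sq_le_sq (hij.trans hF) (by positivity)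

/-- Perturbation of `A^{-1/2} V` in `A`. -/
lemma abs_invSqrt_mulVec_sub_le {c δ r : ℝ} (hc : 0 < c) (hA : A.IsHermitian) (hB : B.IsHermitian)
    (h : spectrum ℝ A ⊆ Set.Ici c) (hδ : ∀ i j, |B i j - A i j| ≤ δ) (hmδ : m * δ ≤ c / 2)
    (V : Fin m → ℝ) (hV : ∀ i, |(Learner.invSqrt A *ᵥ V) i| ≤ r) (i : Fin m) :
    |(Learner.invSqrt B *ᵥ V) i - (Learner.invSqrt A *ᵥ V) i| ≤ m ^ 3 * δ / c * r := by
  have hc2 : 0 < c / 2 := by positivity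
  have hsc := Real.sqrt_pos.2 hc2
  have hsc2 := Real.mul_self_sqrt hc2.le
  have hδ0 : 0 ≤ δ := (abs_nonneg _).trans (hδ i i)
  have hr0 : 0 ≤ r := (abs_nonneg _).trans (hV i)
  have hBs := spectrum_subset_of_abs_sub_le hA hB h hδ hmδ
  have hAs : spectrum ℝ A ⊆ Set.Ici (c / 2) :=
    h.trans (Set.Ici_subset_Ici.2 (by linarith))
  set W := Learner.invSqrt A *ᵥ V with hW
  -- The identity `B^{-1/2} - A^{-1/2} = B^{-1/2} (√A - √B) A^{-1/2}` expresses the error through `W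
  -- = A^{-1/2} V`, the vector that is bounded by `r`.
  have e : Learner.invSqrt B *ᵥ V - W =
      Learner.invSqrt B *ᵥ ((cfc Real.sqrt A - cfc Real.sqrt B) *ᵥ W) := by
    have e1 : cfc Real.sqrt A *ᵥ W = V := by
      rw [hW, Matrix.mulVec_mulVec, sqrt_mul_invSqrt hc hA h, Matrix.one_mulVec]
    have e2 : Learner.invSqrt B *ᵥ (cfc Real.sqrt B *ᵥ W) = W := by
      rw [Matrix.mulVec_mulVec, invSqrt_mul_sqrt hc2 hB hBs, Matrix.one_mulVec]
    rw [Matrix.sub_mulVec, Matrix.mulVec_sub, e1, e2]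
  have hentry := congrFun e i
  rw [Pi.sub_apply] at hentry
  rw [hentry]
  have hD : ∀ k, |((cfc Real.sqrt A - cfc Real.sqrt B) *ᵥ W) k| ≤
      m * (m * δ / (2 * √(c / 2)) * r) := by
    intro k
    simp only [Matrix.mulVec, dotProduct]
    refine (Finset.abs_sum_le_sum_abs _ _).trans ?_
    calc ∑ l, |(cfc Real.sqrt A - cfc Real.sqrt B) k l * W l|
        ≤ ∑ _l : Fin m, m * δ / (2 * √(c / 2)) * r := by
          refine Finset.sum_le_sum fun l _ => ?_
          rw [abs_mul]
          refine mul_le_mul ?_ (hV l) (abs_nonneg _) (by positivity)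
          exact abs_sqrt_sub_sqrt_le hc2 hA hB hAs hBs
            (fun i j => by rw [abs_sub_comm]; exact hδ i j) k l
      _ = _ := by simp
  generalize (cfc Real.sqrt A - cfc Real.sqrt B) *ᵥ W = U at *
  simp only [Matrix.mulVec, dotProduct]
  refine (Finset.abs_sum_le_sum_abs _ _).trans ?_
  calc ∑ l, |Learner.invSqrt B i l * U l|
      ≤ ∑ _l : Fin m, 1 / √(c / 2) * (m * (m * δ / (2 * √(c / 2)) * r)) := by
        refine Finset.sum_le_sum fun l _ => ?_
        rw [abs_mul]
        exact mul_le_mul (abs_invSqrt_apply_le hc2 hB hBs i l) (hD l) (abs_nonneg _)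
          (by positivity)
    _ = m ^ 3 * δ * r / (2 * (√(c / 2) * √(c / 2))) := by
        simp
        field_simp
    _ = _ := by rw [hsc2]; field_simp

end MatrixCalculus

/-! ### Measurability of the functional calculus. -/

section MeasurableCalculus

variable {m : ℕ} {α : Type*} [MeasurableSpace α] {A : α → Matrix (Fin m) (Fin m) ℝ}

/-- The spectrum is finite, so pointwise convergence of the functions is enough. -/
lemma tendsto_cfc_apply {A : Matrix (Fin m) (Fin m) ℝ} (hA : A.IsHermitian) {p : ℕ → ℝ → ℝ}
    {f : ℝ → ℝ} (h : ∀ t, Tendsto (fun n => p n t) atTop (𝓝 (f t))) (i j : Fin m) :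
    Tendsto (fun n => cfc (p n) A i j) atTop (𝓝 (cfc f A i j)) := by
  have e : ∀ g : ℝ → ℝ, cfc g A i j = ∑ k, (hA.eigenvectorUnitary : Matrix (Fin m) (Fin m) ℝ) i k *
      g (hA.eigenvalues k) * star (hA.eigenvectorUnitary : Matrix (Fin m) (Fin m) ℝ) k j := by
    intro g
    rw [hA.cfc_eq, Matrix.IsHermitian.cfc, Unitary.conjStarAlgAut_apply, Matrix.mul_apply]
    simp [Matrix.mul_diagonal]
  simp_rw [e]
  exact tendsto_finsetSum _ fun k _ => ((h _).const_mul _).mul_const _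

lemma measurable_aeval_apply (hA : ∀ i j, Measurable fun x => A x i j) (p : Polynomial ℝ)
    (i j : Fin m) : Measurable fun x => Polynomial.aeval (A x) p i j := by
  have hpow : ∀ (k : ℕ) (i j : Fin m), Measurable fun x => (A x ^ k) i j := by
    intro k
    induction k with
    | zero => intro i j; simp only [pow_zero]; exact measurable_const
    | succ k ih =>
      intro i j
      simp only [pow_succ, Matrix.mul_apply]
      exact Finset.measurable_sum _ fun l _ => (ih i l).mul (hA l j)
  simp only [Polynomial.aeval_eq_sum_range, Matrix.sum_apply, Matrix.smul_apply, smul_eq_mul]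
  exact Finset.measurable_sum _ fun k _ => (hpow k i j).const_mul _

lemma measurable_cfc_apply_of_tendsto {p : ℕ → ℝ → ℝ} {f : ℝ → ℝ}
    (hH : ∀ x, (A x).IsHermitian) (hp : ∀ n i j, Measurable fun x => cfc (p n) (A x) i j)
    (h : ∀ t, Tendsto (fun n => p n t) atTop (𝓝 (f t))) (i j : Fin m) :
    Measurable fun x => cfc f (A x) i j :=
  measurable_of_tendsto_metrizable (fun n => hp n i j)
    (tendsto_pi_nhds.2 fun x => tendsto_cfc_apply (hH x) h i j)

lemma exists_polynomial_tendsto {f : ℝ → ℝ} (hf : Continuous f) :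
    ∃ p : ℕ → Polynomial ℝ, ∀ t, Tendsto (fun n => (p n).eval t) atTop (𝓝 (f t)) := by
  have h := fun n : ℕ => exists_polynomial_near_of_continuousOn (-(n : ℝ)) n f hf.continuousOn
    (1 / ((n : ℝ) + 1)) (by positivity)
  choose p hp using h
  refine ⟨p, fun t => ?_⟩
  rw [tendsto_iff_dist_tendsto_zero]
  refine squeeze_zero' (Eventually.of_forall fun _ => dist_nonneg) ?_
    tendsto_one_div_add_atTop_nhds_zero_nat
  obtain ⟨N, hN⟩ := exists_nat_ge |t|
  filter_upwards [eventually_ge_atTop N] with n hn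
  have hn' : |t| ≤ n := hN.trans (by exact_mod_cast hn)
  exact (hp n t (abs_le.1 hn')).le

lemma measurable_cfc_apply {f : ℝ → ℝ} (hf : Continuous f)
    (hH : ∀ x, (A x).IsHermitian) (hA : ∀ i j, Measurable fun x => A x i j) (i j : Fin m) :
    Measurable fun x => cfc f (A x) i j := by
  obtain ⟨p, hp⟩ := exists_polynomial_tendsto hf
  refine measurable_cfc_apply_of_tendsto (p := fun n t => (p n).eval t) hH (fun n i j => ?_) hp i j
  have : ∀ x, cfc (fun t => (p n).eval t) (A x) = Polynomial.aeval (A x) (p n) := fun x =>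
    cfc_polynomial (p n) (A x) (hH x)
  simp_rw [this]
  exact measurable_aeval_apply hA (p n) i j

/-- `t ↦ (√t)⁻¹` takes the value `0` for `t ≤ 0` and jumps at `0`, hence is not itself a case of
`measurable_cfc_apply`; it is the pointwise limit of the continuous functions `√t / (max t 0 + 1 /
(n + 1))`. -/
lemma measurable_invSqrt_apply (hH : ∀ x, (A x).IsHermitian)
    (hA : ∀ i j, Measurable fun x => A x i j) (i j : Fin m) :
    Measurable fun x => Learner.invSqrt (A x) i j := by
  refine measurable_cfc_apply_of_tendsto (p := fun n t => √t / (max t 0 + 1 / ((n : ℝ) + 1))) hH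
    (fun n i j => measurable_cfc_apply ?_ hH hA i j) (fun t => ?_) i j
  · refine Continuous.div (by fun_prop) (by fun_prop) fun t => ?_
    have : 0 ≤ max t 0 := le_max_right _ _
    positivity
  · rcases le_or_gt t 0 with ht | ht
    · simp [Real.sqrt_eq_zero_of_nonpos ht]
    · have h1 : (√t)⁻¹ = √t / (max t 0 + 0) := by
        rw [max_eq_left ht.le, add_zero, Real.sqrt_div_self', one_div]
      rw [h1]
      refine Tendsto.div tendsto_const_nhds
        (tendsto_const_nhds.add tendsto_one_div_add_atTop_nhds_zero_nat) ?_
      rw [max_eq_left ht.le, add_zero]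
      exact ht.ne'

end MeasurableCalculus

/-! ### Sums over finite index sets. -/

section SumLaw

variable {m : ℕ} {ρ : Measure (Fin m → ℝ)}

lemma weightedSumLaw_congr {w w' : ℕ → ℝ} {n : ℕ} (h : ∀ k < n, w k = w' k) :
    weightedSumLaw ρ w n = weightedSumLaw ρ w' n := by
  induction n with
  | zero => rfl
  | succ n ih =>
    simp only [weightedSumLaw]
    rw [ih fun k hk => h k (hk.trans n.lt_succ_self), h n n.lt_succ_self]

/-- The Berry–Esseen induction runs over initial segments of `ℕ`; here an arbitrary finite index set
is enumerated, with zero weights beyond it so that the bound `W` holds for all `k`. -/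
lemma exists_weightedSumLaw_eq_map {ι Ω : Type*} [MeasurableSpace Ω] {P : Measure Ω}
    [IsProbabilityMeasure P] [IsProbabilityMeasure ρ] {ξ : ι → Ω → Fin m → ℝ} (hξ : ∀ i, Measurable (ξ i))
    (hind : iIndepFun ξ P) (hlaw : ∀ i, P.map (ξ i) = ρ) (wt : ι → ℝ) {W : ℝ} (hW0 : 0 ≤ W)
    (hW : ∀ i, |wt i| ≤ W) (s : Finset ι) :
    ∃ w : ℕ → ℝ, (∀ k, |w k| ≤ W) ∧ ∑ k ∈ Finset.range s.card, w k ^ 2 = ∑ i ∈ s, wt i ^ 2 ∧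
      P.map (fun ω => ∑ i ∈ s, wt i • ξ i ω) = weightedSumLaw ρ w s.card := by
  classical
  induction s using Finset.induction_on with
  | empty =>
    refine ⟨fun _ => 0, fun k => by simpa using hW0, by simp, ?_⟩
    simp [weightedSumLaw]
  | insert a s ha ih =>
    obtain ⟨w, h1, h2, h3⟩ := ih
    have hcong : ∀ k < s.card, (if k = s.card then wt a else w k) = w k := fun k hk =>
      if_neg hk.ne
    refine ⟨fun k => if k = s.card then wt a else w k, fun k => ?_, ?_, ?_⟩
    · dsimp only
      split_ifs
      · exact hW a
      · exact h1 k
    · rw [Finset.card_insert_of_notMem ha, Finset.sum_range_succ, Finset.sum_insert ha,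
        ← h2, add_comm]
      congr 1
      · simp
      · exact Finset.sum_congr rfl fun k hk => by
          simp only [hcong k (Finset.mem_range.1 hk)]
    · rw [Finset.card_insert_of_notMem ha, weightedSumLaw, weightedSumLaw_congr hcong, ← h3]
      have hm : ∀ i, Measurable fun ω => wt i • ξ i ω := fun i => by
        have := hξ i
        fun_prop
      have hind' : iIndepFun (fun i ω => wt i • ξ i ω) P :=
        hind.comp (fun i x => wt i • x) fun i => by fun_prop
      have hi := hind'.indepFun_finsetSum_of_notMem hm ha
      have e1 : (fun ω => ∑ i ∈ insert a s, wt i • ξ i ω) =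
          (∑ i ∈ s, fun ω => wt i • ξ i ω) + fun ω => wt a • ξ a ω := by
        ext ω : 1
        rw [Finset.sum_insert ha, add_comm, Pi.add_apply, Finset.sum_apply]
      have e2 : (∑ i ∈ s, fun ω => wt i • ξ i ω) = fun ω => ∑ i ∈ s, wt i • ξ i ω := by
        ext ω : 1
        rw [Finset.sum_apply]
      rw [e1, hi.map_add_eq_map_conv_map₀ (by rw [e2]; fun_prop) (hm a).aemeasurable, e2]
      simp only [if_true]
      congr 1
      rw [← hlaw a, Measure.map_map (by fun_prop) (hξ a)]
      rfl

end SumLaw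

/-- Berry–Esseen bound on boxes for weighted sums, with weights normalized in `ℓ²`, of independent
random vectors with a common standardized law. -/
theorem exists_berryEsseen_box_sum {m : ℕ} (hm : 0 < m) : ∃ K : ℝ, 0 ≤ K ∧
    ∀ {ι : Type} {Ω : Type u} [MeasurableSpace Ω] (P : Measure Ω) [IsProbabilityMeasure P]
      (ρ : Measure (Fin m → ℝ)) [IsProbabilityMeasure ρ] (ξ : ι → Ω → Fin m → ℝ)
      (wt : ι → ℝ) (W : ℝ) (s : Finset ι), IsStandardized ρ → (∀ i, Measurable (ξ i)) →
      iIndepFun ξ P → (∀ i, P.map (ξ i) = ρ) → 0 ≤ W → (∀ i, |wt i| ≤ W) →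
      ∑ i ∈ s, wt i ^ 2 = 1 → ∀ a b,
      |P.real {ω | ∑ i ∈ s, wt i • ξ i ω ∈ Set.Icc a b} - (stdNormal m).real (Set.Icc a b)| ≤
        K * (cubeMoment ρ * W) := by
  obtain ⟨K, hK0, hK⟩ := exists_berryEsseen_box hm
  refine ⟨K, hK0, fun P _ ρ _ ξ wt W s hρ hξ hind hlaw hW0 hW hsum a b => ?_⟩
  obtain ⟨w, h1, h2, h3⟩ := exists_weightedSumLaw_eq_map hξ hind hlaw wt hW0 hW s
  have hv : ∑ k ∈ Finset.range s.card, w k ^ 2 = 1 := h2.trans hsum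
  have h := hK ρ hρ w W h1 s.card (by rw [hv]; exact one_pos) a b
  rw [hv, gaussN_one, Real.sqrt_one, div_one, ← h3,
    map_measureReal_apply (by fun_prop) measurableSet_Icc] at h
  exact h

/-! ### From boxes to the distribution function of the maximum. -/

lemma maxAbs_le_iff {m : ℕ} (hm : 0 < m) (z : Fin m → ℝ) (t : ℝ) :
    maxAbs z ≤ t ↔ z ∈ Set.Icc (fun _ => -t) (fun _ => t) := by
  have : Nonempty (Fin m) := ⟨⟨0, hm⟩⟩
  rw [maxAbs, ciSup_le_iff (Set.finite_range _).bddAbove]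
  simp only [abs_le, Set.mem_Icc, Pi.le_def, forall_and]

/-- Comparison of the distribution function of a perturbation of `max_j |W_j|` with the one of
`max_j |Z_j|`, given a bound on boxes for the approximation of the law of `W` by the one of `Z`. -/
lemma abs_real_le_sub_maxAbs_le {m : ℕ} (hm : 0 < m) {Ω : Type*} [MeasurableSpace Ω]
    (P : Measure Ω) [IsProbabilityMeasure P] (T : Ω → ℝ) {W : Ω → Fin m → ℝ} (hW : Measurable W)
    (Bad : Set Ω) {e R η : ℝ} (hη : 0 ≤ η)
    (he : ∀ a b, |P.real {ω | W ω ∈ Set.Icc a b} - (stdNormal m).real (Set.Icc a b)| ≤ e)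
    (hT : ∀ ω, ω ∉ Bad → (∀ j, |W ω j| ≤ R) → |T ω - maxAbs (W ω)| ≤ η) (t : ℝ) :
    |P.real {ω | T ω ≤ t} - (stdNormal m).real {z | maxAbs z ≤ t}| ≤
      2 * e + P.real Bad +
        (1 - (stdNormal m).real (Set.Icc (fun _ => -R) (fun _ => R))) + 2 * m * η := by
  have hset : ∀ s : ℝ, {z : Fin m → ℝ | maxAbs z ≤ s} = Set.Icc (fun _ => -s) (fun _ => s) :=
    fun s => by ext z; exact maxAbs_le_iff hm z s
  have hmeas : ∀ a b, MeasurableSet {ω | W ω ∈ Set.Icc a b} := fun a b =>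
    measurableSet_Icc.preimage hW
  set box : ℝ → Set (Fin m → ℝ) := fun s => Set.Icc (fun _ => -s) (fun _ => s) with hbox
  -- That `W` leaves the box of radius `R` is again compared with the Gaussian law; this costs the
  -- second `e` in the bound.
  have hout : P.real {ω | W ω ∈ box R}ᶜ ≤ e + (1 - (stdNormal m).real (box R)) := by
    rw [probReal_compl_eq_one_sub (hmeas _ _)]
    have := (abs_le.1 (he (fun _ => -R) (fun _ => R))).1
    linarith
  have hanti : ∀ s, (stdNormal m).real (box (s + η)) ≤ (stdNormal m).real (box s) + 2 * m * η := by
    intro s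
    have := gaussN_real_enlarge_le one_pos (fun _ : Fin m => -s) (fun _ => s) hη
    rw [gaussN_one, Real.sqrt_one, div_one] at this
    refine le_of_eq_of_le ?_ this
    simp only [hbox]
    congr 2
    ext i
    ring
  have hR : ∀ ω, ω ∈ {ω | W ω ∈ box R} → ∀ j, |W ω j| ≤ R := fun ω hω j =>
    abs_le.2 ⟨hω.1 j, hω.2 j⟩
  rw [hset]
  have upper : P.real {ω | T ω ≤ t} ≤ (P.real {ω | W ω ∈ box (t + η)} + P.real Bad) +
      P.real {ω | W ω ∈ box R}ᶜ := by
    refine (measureReal_mono ?_).trans ((measureReal_union_le _ _).trans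
      (add_le_add_left (measureReal_union_le _ _) _))
    intro ω hω
    by_cases hb : ω ∈ Bad
    · exact Or.inl (Or.inr hb)
    by_cases hr : ω ∈ {ω | W ω ∈ box R}
    · refine Or.inl (Or.inl ((maxAbs_le_iff hm _ _).1 ?_))
      have := abs_le.1 (hT ω hb (hR ω hr))
      have hω' : T ω ≤ t := hω
      linarith
    · exact Or.inr hr
  have lower : P.real {ω | W ω ∈ box (t - η)} ≤ (P.real {ω | T ω ≤ t} + P.real Bad) +
      P.real {ω | W ω ∈ box R}ᶜ := by
    refine (measureReal_mono ?_).trans ((measureReal_union_le _ _).trans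
      (add_le_add_left (measureReal_union_le _ _) _))
    intro ω hω
    by_cases hb : ω ∈ Bad
    · exact Or.inl (Or.inr hb)
    by_cases hr : ω ∈ {ω | W ω ∈ box R}
    · refine Or.inl (Or.inl ?_)
      have h1 := abs_le.1 (hT ω hb (hR ω hr))
      have h2 := (maxAbs_le_iff hm _ _).2 hω
      change T ω ≤ t
      linarith
    · exact Or.inr hr
  have h1 := abs_le.1 (he (fun _ => -(t + η)) (fun _ => t + η))
  have h2 := abs_le.1 (he (fun _ => -(t - η)) (fun _ => t - η))
  have h3 := hanti t
  have h4 := hanti (t - η)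
  rw [sub_add_cancel] at h4
  rw [abs_le]
  constructor
  · linarith [h2.1]
  · linarith [h1.2]

/-! ### Sample sizes. -/

section Sizes

/-- A lower bound for the proportion of the observations in each test part. -/
def testRatio (c₁ c₂ : ℝ) : ℝ := (1 - c₂) * min c₁ (1 - c₂)

lemma testRatio_pos {c₁ c₂ : ℝ} (hc₁ : 0 < c₁) (hc₂ : c₂ < 1) : 0 < testRatio c₁ c₂ :=
  mul_pos (by linarith) (lt_min hc₁ (by linarith))

variable {S : TwoSample.{u}} {c₁ c₂ : ℝ}

lemma TwoSample.SizesBalanced.two_le_n (h : S.SizesBalanced c₁ c₂) (hc₁ : 0 < c₁)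
    (hc₂ : c₂ < 1) : 2 ≤ S.n := by
  obtain ⟨⟨h1, h2⟩, -, -⟩ := h
  have hn : 0 < S.n := by
    -- For `n = 0` the ratio is `0` by the convention for division, below `c₁`.
    rcases Nat.eq_zero_or_pos S.n with h0 | h0
    · rw [h0] at h1; simp at h1; linarith
    · exact h0
  have hnR : (0 : ℝ) < S.n := by exact_mod_cast hn
  rw [le_div_iff₀ hnR] at h1
  rw [div_le_iff₀ hnR] at h2
  have hx : 0 < S.nx := by
    have : (0 : ℝ) < S.nx := by nlinarith
    exact_mod_cast this
  have hlt : S.nx < S.n := by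
    have : (S.nx : ℝ) < S.n := by nlinarith
    exact_mod_cast this
  omega

/-- The samples have sizes at least `c₁ n` and `(1 - c₂) n`, and each keeps a fraction at least `1 -
c₂` for testing. -/
lemma TwoSample.SizesBalanced.le_nTest (h : S.SizesBalanced c₁ c₂) (hc₁ : 0 < c₁)
    (hc₂ : c₂ < 1) :
    testRatio c₁ c₂ * S.n ≤ S.nxTest ∧ testRatio c₁ c₂ * S.n ≤ S.nyTest := by
  have hn2 := h.two_le_n hc₁ hc₂
  obtain ⟨⟨h1, h2⟩, ⟨-, h3⟩, ⟨-, h4⟩⟩ := h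
  have hnR : (0 : ℝ) < S.n := by exact_mod_cast (by omega : 0 < S.n)
  rw [le_div_iff₀ hnR] at h1
  rw [div_le_iff₀ hnR] at h2
  have hsum : (S.n : ℝ) = S.nx + S.ny := by simp [TwoSample.n]
  have hx : (0 : ℝ) < S.nx := by nlinarith
  have hy : (0 : ℝ) < S.ny := by nlinarith
  rw [div_le_iff₀ hx] at h3
  rw [div_le_iff₀ hy] at h4
  have ex : (S.nxTest : ℝ) = S.nx - S.fitX.card := by
    rw [TwoSample.nxTest, Finset.card_compl, Fintype.card_fin, Nat.cast_sub]
    simpa using Finset.card_le_univ S.fitX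
  have ey : (S.nyTest : ℝ) = S.ny - S.fitY.card := by
    rw [TwoSample.nyTest, Finset.card_compl, Fintype.card_fin, Nat.cast_sub]
    simpa using Finset.card_le_univ S.fitY
  have hm1 : min c₁ (1 - c₂) * S.n ≤ c₁ * S.n := by gcongr; exact min_le_left _ _
  have hm2 : min c₁ (1 - c₂) * S.n ≤ (1 - c₂) * S.n := by gcongr; exact min_le_right _ _
  rw [ex, ey, testRatio, mul_assoc]
  constructor
  · nlinarith [mul_le_mul_of_nonneg_left (hm1.trans h1) (by linarith : 0 ≤ 1 - c₂)]
  · nlinarith [mul_le_mul_of_nonneg_left hm2 (by linarith : 0 ≤ 1 - c₂)]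

end Sizes

/-! ### The statistic for fixed functions, as a weighted sum of standardized vectors. -/

section FixedWitness

variable {m : ℕ} (S : TwoSample.{u}) (g : Fin m → (Fin S.d → ℝ) → ℝ)

/-- Mean of `g j` over the test part of the first sample. -/
def testMeanX (j : Fin m) (ω : S.Ω) : ℝ :=
  (1 / (S.nxTest : ℝ)) * ∑ i ∈ S.fitXᶜ, g j (S.X i ω)

/-- Mean of `g j` over the test part of the second sample. -/
def testMeanY (j : Fin m) (ω : S.Ω) : ℝ :=
  (1 / (S.nyTest : ℝ)) * ∑ i ∈ S.fitYᶜ, g j (S.Y i ω)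

/-- The difference of the means of `g j` over the two test parts. -/
def testStat (ω : S.Ω) (j : Fin m) : ℝ := testMeanX S g j ω - testMeanY S g j ω

/-- The pooled sample covariance matrix of the functions `g j` over the two test parts. -/
def testCov (ω : S.Ω) : Matrix (Fin m) (Fin m) ℝ :=
  Matrix.of fun j k =>
    (S.nyTest : ℝ) / (S.nxTest + S.nyTest) * ((1 / (S.nxTest : ℝ)) * ∑ i ∈ S.fitXᶜ,
      (g j (S.X i ω) - testMeanX S g j ω) * (g k (S.X i ω) - testMeanX S g k ω)) +
    (S.nxTest : ℝ) / (S.nxTest + S.nyTest) * ((1 / (S.nyTest : ℝ)) * ∑ i ∈ S.fitYᶜ,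
      (g j (S.Y i ω) - testMeanY S g j ω) * (g k (S.Y i ω) - testMeanY S g k ω))

/-- The aggregated max statistic of the functions `g j`. -/
def testMax (ω : S.Ω) : ℝ :=
  ⨆ j : Fin m, Learner.scale S * |(Learner.invSqrt (testCov S g ω) *ᵥ testStat S g ω) j|

/-- The mean of `g j` under the first population. -/
def popMean (j : Fin m) : ℝ := ∫ x, g j x ∂S.μ

/-- The covariance matrix of the functions `g j` under the first population. -/
def popCov : Matrix (Fin m) (Fin m) ℝ :=
  Matrix.of fun j k => ∫ x, (g j x - popMean S g j) * (g k x - popMean S g k) ∂S.μ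

/-- The sum over `j` of the third absolute central moments of `g j`. -/
def popCube : ℝ := ∑ j, ∫ x, |g j x - popMean S g j| ^ 3 ∂S.μ

/-- The standardization of the functions `g j`. -/
def standardize (x : Fin S.d → ℝ) : Fin m → ℝ :=
  Learner.invSqrt (popCov S g) *ᵥ fun j => g j x - popMean S g j

lemma isHermitian_popCov : (popCov S g).IsHermitian := by
  ext j k
  simp [popCov, mul_comm]

lemma isHermitian_testCov (ω : S.Ω) : (testCov S g ω).IsHermitian := by
  ext j k
  simp [testCov, mul_comm]

variable {S g} {B : ℝ}

lemma abs_popMean_le (hB : ∀ j x, |g j x| ≤ B) (j : Fin m) : |popMean S g j| ≤ B :=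
  abs_integral_le_of_abs_le (hB j)

lemma abs_sub_popMean_le (hB : ∀ j x, |g j x| ≤ B) (j : Fin m) (x : Fin S.d → ℝ) :
    |g j x - popMean S g j| ≤ 2 * B :=
  (abs_sub _ _).trans (by linarith [hB j x, abs_popMean_le hB j])

lemma integrable_of_abs_le {α : Type*} [MeasurableSpace α] {μ : Measure α}
    [IsProbabilityMeasure μ] {f : α → ℝ} {B : ℝ} (hf : Measurable f) (hB : ∀ x, |f x| ≤ B) :
    Integrable f μ :=
  (integrable_const B).mono' hf.aestronglyMeasurable (ae_of_all _ hB)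

lemma integrable_centered (hg : ∀ j, Measurable (g j)) (hB : ∀ j x, |g j x| ≤ B) (j : Fin m) :
    Integrable (fun x => g j x - popMean S g j) S.μ :=
  integrable_of_abs_le ((hg j).sub_const _) (abs_sub_popMean_le hB j)

lemma integrable_centered_mul (hg : ∀ j, Measurable (g j)) (hB : ∀ j x, |g j x| ≤ B)
    (j k : Fin m) :
    Integrable (fun x => (g j x - popMean S g j) * (g k x - popMean S g k)) S.μ :=
  integrable_mul_of_abs_le (integrable_centered hg hB j) ((hg k).sub_const _)
    (abs_sub_popMean_le hB k)

lemma integral_centered (hg : ∀ j, Measurable (g j)) (hB : ∀ j x, |g j x| ≤ B) (j : Fin m) :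
    ∫ x, (g j x - popMean S g j) ∂S.μ = 0 := by
  rw [integral_sub (integrable_of_abs_le (hg j) (hB j)) (integrable_const _)]
  simp [popMean]

lemma measurable_standardize (hg : ∀ j, Measurable (g j)) : Measurable (standardize S g) := by
  refine measurable_pi_lambda _ fun i => ?_
  simp only [standardize, Matrix.mulVec, dotProduct]
  exact Finset.measurable_sum _ fun j _ => ((hg j).sub_const _).const_mul _

lemma integrable_centered_cube (hg : ∀ j, Measurable (g j)) (hB : ∀ j x, |g j x| ≤ B)
    (j : Fin m) : Integrable (fun x => |g j x - popMean S g j| ^ 3) S.μ := by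
  refine integrable_of_abs_le (B := (2 * B) ^ 3) ?_ fun x => ?_
  · have := hg j
    exact ((this.sub_const _).abs).pow_const 3
  · rw [abs_of_nonneg (by positivity)]
    exact pow_le_pow_left₀ (abs_nonneg _) (abs_sub_popMean_le hB j x) 3

/-- The entries of `Σ^{-1/2}` are at most `1 / √c`, and the power mean inequality moves the cube
inside the sum. -/
lemma sum_abs_standardize_cube_le {c : ℝ} (hc : 0 < c) (h : spectrum ℝ (popCov S g) ⊆ Set.Ici c)
    (x : Fin S.d → ℝ) : (∑ i, |standardize S g x i|) ^ 3 ≤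
      (m / √c) ^ 3 * (m ^ 2 * ∑ j, |g j x - popMean S g j| ^ 3) := by
  have h1 : ∑ i, |standardize S g x i| ≤ m / √c * ∑ j, |g j x - popMean S g j| := by
    calc ∑ i, |standardize S g x i| ≤ ∑ _i : Fin m, 1 / √c * ∑ j, |g j x - popMean S g j| := by
          refine Finset.sum_le_sum fun i _ => ?_
          simp only [standardize, Matrix.mulVec, dotProduct]
          refine (Finset.abs_sum_le_sum_abs _ _).trans ?_
          rw [Finset.mul_sum]
          refine Finset.sum_le_sum fun j _ => ?_
          rw [abs_mul]
          exact mul_le_mul_of_nonneg_right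
            (abs_invSqrt_apply_le hc (isHermitian_popCov S g) h i j) (abs_nonneg _)
      _ = _ := by simp; ring
  have h2 : (∑ j, |g j x - popMean S g j|) ^ 3 ≤ m ^ 2 * ∑ j, |g j x - popMean S g j| ^ 3 := by
    have := pow_sum_div_card_le_sum_pow (s := Finset.univ)
      (f := fun j => |g j x - popMean S g j|) (fun j _ => abs_nonneg _) 2
    rcases Nat.eq_zero_or_pos m with h0 | h0
    · subst h0; simp
    · rw [div_le_iff₀ (by simpa using by positivity)] at this
      simpa [mul_comm] using this
  calc _ ≤ (m / √c * ∑ j, |g j x - popMean S g j|) ^ 3 := by gcongr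
    _ = (m / √c) ^ 3 * (∑ j, |g j x - popMean S g j|) ^ 3 := by ring
    _ ≤ _ := by gcongr

lemma integrable_standardize_cube {c : ℝ} (hc : 0 < c) (hg : ∀ j, Measurable (g j))
    (hB : ∀ j x, |g j x| ≤ B) (h : spectrum ℝ (popCov S g) ⊆ Set.Ici c) :
    Integrable (fun x => (∑ i, |standardize S g x i|) ^ 3) S.μ := by
  refine (((integrable_finsetSum Finset.univ fun j _ =>
    integrable_centered_cube hg hB j).const_mul (m ^ 2 : ℝ)).const_mul ((m / √c) ^ 3)).mono' ?_
    (ae_of_all _ fun x => ?_)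
  · have h1 : Continuous fun y : Fin m → ℝ => (∑ i, |y i|) ^ 3 := by fun_prop
    exact (h1.measurable.comp (measurable_standardize hg)).aestronglyMeasurable
  · rw [Real.norm_of_nonneg (by positivity)]
    exact sum_abs_standardize_cube_le hc h x

lemma isStandardized_map_standardize {c : ℝ} (hc : 0 < c) (hg : ∀ j, Measurable (g j))
    (hB : ∀ j x, |g j x| ≤ B) (h : spectrum ℝ (popCov S g) ⊆ Set.Ici c) :
    IsStandardized (S.μ.map (standardize S g)) where
  integrable_cube := by
    rw [integrable_map_measure (Continuous.aestronglyMeasurable (by fun_prop))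
      (measurable_standardize hg).aemeasurable]
    exact integrable_standardize_cube hc hg hB h
  mean_eq_zero i := by
    rw [integral_map (measurable_standardize hg).aemeasurable
      (Continuous.aestronglyMeasurable (by fun_prop))]
    simp only [standardize, Matrix.mulVec, dotProduct]
    rw [integral_finsetSum _ fun j _ => (integrable_centered hg hB j).const_mul _]
    simp [integral_const_mul, integral_centered hg hB]
  cov_eq i j := by
    rw [integral_map (measurable_standardize hg).aemeasurable
      (Continuous.aestronglyMeasurable (by fun_prop))]
    have e : ∀ x, standardize S g x i * standardize S g x j =
        ∑ k, ∑ l, Learner.invSqrt (popCov S g) i k *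
          ((g k x - popMean S g k) * (g l x - popMean S g l)) *
          Learner.invSqrt (popCov S g) j l := by
      intro x
      simp only [standardize, Matrix.mulVec, dotProduct]
      rw [Finset.sum_mul_sum]
      exact Finset.sum_congr rfl fun k _ => Finset.sum_congr rfl fun l _ => by ring
    simp_rw [e]
    have hi : ∀ k l, Integrable (fun x => Learner.invSqrt (popCov S g) i k *
          ((g k x - popMean S g k) * (g l x - popMean S g l)) *
          Learner.invSqrt (popCov S g) j l) S.μ := fun k l =>
      ((integrable_centered_mul hg hB k l).const_mul _).mul_const _
    rw [integral_finsetSum _ fun k _ => integrable_finsetSum _ fun l _ => hi k l]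
    have e2 : ∀ k, ∫ x, ∑ l, Learner.invSqrt (popCov S g) i k *
          ((g k x - popMean S g k) * (g l x - popMean S g l)) *
          Learner.invSqrt (popCov S g) j l ∂S.μ =
        ∑ l, Learner.invSqrt (popCov S g) i k * popCov S g k l *
          Learner.invSqrt (popCov S g) l j := by
      intro k
      rw [integral_finsetSum _ fun l _ => hi k l]
      refine Finset.sum_congr rfl fun l _ => ?_
      rw [integral_mul_const, integral_const_mul]
      congr 1
      unfold Learner.invSqrt
      simpa using (isHermitian_cfc (fun t : ℝ => (√t)⁻¹) (popCov S g)).apply l j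
    simp_rw [e2]
    have e3 := congrFun (congrFun (invSqrt_mul_mul_invSqrt hc (isHermitian_popCov S g) h) i) j
    rw [Matrix.one_apply] at e3
    rw [← e3, Matrix.mul_apply, Finset.sum_comm]
    refine Finset.sum_congr rfl fun l _ => ?_
    rw [Matrix.mul_apply, Finset.sum_mul]

lemma cubeMoment_map_standardize_le {c : ℝ} (hc : 0 < c) (hg : ∀ j, Measurable (g j))
    (hB : ∀ j x, |g j x| ≤ B) (h : spectrum ℝ (popCov S g) ⊆ Set.Ici c) :
    cubeMoment (S.μ.map (standardize S g)) ≤ (m / √c) ^ 3 * m ^ 2 * popCube S g := by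
  rw [cubeMoment, integral_map (measurable_standardize hg).aemeasurable
    (Continuous.aestronglyMeasurable (by fun_prop)), popCube,
    ← integral_finsetSum _ fun j _ => integrable_centered_cube hg hB j, ← integral_const_mul]
  refine integral_mono (integrable_standardize_cube hc hg hB h)
    ((integrable_finsetSum Finset.univ fun j _ =>
      integrable_centered_cube hg hB j).const_mul _) fun x => ?_
  refine (sum_abs_standardize_cube_le hc h x).trans (le_of_eq ?_)
  ring

variable (S) in
/-- The weights of the observations in the scaled difference of the test means. -/
def testWeight : Fin S.nx ⊕ Fin S.ny → ℝ :=
  Sum.elim (fun _ => Learner.scale S / S.nxTest) (fun _ => -(Learner.scale S / S.nyTest))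

lemma scale_nonneg : 0 ≤ Learner.scale S := Real.sqrt_nonneg _

lemma scale_sq : Learner.scale S ^ 2 =
    (S.nxTest : ℝ) * S.nyTest / (S.nxTest + S.nyTest) := Real.sq_sqrt (by positivity)

lemma sum_testWeight_smul {E : Type*} [AddCommGroup E] [Module ℝ E]
    (ξ : Fin S.nx ⊕ Fin S.ny → E) :
    ∑ i ∈ S.fitXᶜ.disjSum S.fitYᶜ, testWeight S i • ξ i =
      (Learner.scale S / S.nxTest) • ∑ i ∈ S.fitXᶜ, ξ (Sum.inl i) -
        (Learner.scale S / S.nyTest) • ∑ i ∈ S.fitYᶜ, ξ (Sum.inr i) := by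
  rw [Finset.sum_disjSum]
  simp [testWeight, Finset.smul_sum, sub_eq_add_neg]

/-- With test sizes `a` and `b` the sum is `scale² (1/a + 1/b) = 1`; this is why the factor `ab / (a
+ b)` is the right one. -/
lemma sum_testWeight_sq (ha : 0 < S.nxTest) (hb : 0 < S.nyTest) :
    ∑ i ∈ S.fitXᶜ.disjSum S.fitYᶜ, testWeight S i ^ 2 = 1 := by
  have ha' : (0 : ℝ) < S.nxTest := by exact_mod_cast ha
  have hb' : (0 : ℝ) < S.nyTest := by exact_mod_cast hb
  rw [Finset.sum_disjSum]
  simp only [testWeight, Sum.elim_inl, Sum.elim_inr, Finset.sum_const, nsmul_eq_mul, neg_sq, div_pow,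
    scale_sq]
  change (S.nxTest : ℝ) * _ + (S.nyTest : ℝ) * _ = 1
  field_simp
  ring

/-- With test sizes `a` and `b`, a squared weight of the first sample is `b / (a (a + b)) ≤ 1 / a`,
and symmetrically for the second. -/
lemma abs_testWeight_le {q : ℝ} (hq : 0 < q) (ha : q ≤ S.nxTest) (hb : q ≤ S.nyTest)
    (i : Fin S.nx ⊕ Fin S.ny) : |testWeight S i| ≤ 1 / √q := by
  have ha' : (0 : ℝ) < S.nxTest := hq.trans_le ha
  have hb' : (0 : ℝ) < S.nyTest := hq.trans_le hb
  have h1 : Learner.scale S / S.nxTest ≤ 1 / √q := by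
    rw [← Real.sqrt_one, ← Real.sqrt_div zero_le_one]
    refine Real.le_sqrt_of_sq_le ?_
    rw [div_pow, scale_sq, div_div, div_le_div_iff₀ (by positivity) hq]
    nlinarith [mul_pos ha' hb', mul_le_mul_of_nonneg_left ha (mul_pos ha' hb').le, pow_pos ha' 3]
  have h2 : Learner.scale S / S.nyTest ≤ 1 / √q := by
    rw [← Real.sqrt_one, ← Real.sqrt_div zero_le_one]
    refine Real.le_sqrt_of_sq_le ?_
    rw [div_pow, scale_sq, div_div, div_le_div_iff₀ (by positivity) hq]
    nlinarith [mul_pos ha' hb', mul_le_mul_of_nonneg_left hb (mul_pos ha' hb').le, pow_pos hb' 3]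
  rcases i with i | i
  · simp only [testWeight, Sum.elim_inl]
    rwa [abs_of_nonneg (div_nonneg scale_nonneg ha'.le)]
  · simp only [testWeight, Sum.elim_inr, abs_neg]
    rwa [abs_of_nonneg (div_nonneg scale_nonneg hb'.le)]

/-- The observation with a given index. -/
def TwoSample.obs (S : TwoSample.{u}) (i : Fin S.nx ⊕ Fin S.ny) : S.Ω → Fin S.d → ℝ :=
  Sum.elim S.X S.Y i

lemma measurable_obs (i : Fin S.nx ⊕ Fin S.ny) : Measurable (S.obs i) := by
  rcases i with i | i
  · exact S.measurable_X i
  · exact S.measurable_Y i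

lemma law_obs (h0 : S.Null) (i : Fin S.nx ⊕ Fin S.ny) : S.P.map (S.obs i) = S.μ := by
  rcases i with i | i
  · exact S.law_X i
  · exact (S.law_Y i).trans h0.symm

/-- The weights sum to zero, so any common centering `θ` may be inserted. -/
lemma scale_smul_testStat (θ : Fin m → ℝ) (ha : 0 < S.nxTest) (hb : 0 < S.nyTest) (ω : S.Ω) :
    Learner.scale S • testStat S g ω = ∑ i ∈ S.fitXᶜ.disjSum S.fitYᶜ,
      testWeight S i • fun j => g j (S.obs i ω) - θ j := by
  have ha' : (0 : ℝ) < S.nxTest := by exact_mod_cast ha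
  have hb' : (0 : ℝ) < S.nyTest := by exact_mod_cast hb
  rw [sum_testWeight_smul]
  ext j
  simp only [Pi.smul_apply, testStat, testMeanX, testMeanY, smul_eq_mul, Pi.sub_apply,
    Finset.sum_apply, TwoSample.obs, Sum.elim_inl, Sum.elim_inr, Finset.sum_sub_distrib,
    Finset.sum_const, nsmul_eq_mul]
  change _ = Learner.scale S / S.nxTest * (_ - (S.nxTest : ℝ) * _) -
    Learner.scale S / S.nyTest * (_ - (S.nyTest : ℝ) * _)
  field_simp
  ring

lemma invSqrt_mulVec_scale_smul_testStat (ha : 0 < S.nxTest) (hb : 0 < S.nyTest) (ω : S.Ω) :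
    Learner.invSqrt (popCov S g) *ᵥ (Learner.scale S • testStat S g ω) =
      ∑ i ∈ S.fitXᶜ.disjSum S.fitYᶜ, testWeight S i • standardize S g (S.obs i ω) := by
  rw [scale_smul_testStat (popMean S g) ha hb, Matrix.mulVec_sum]
  exact Finset.sum_congr rfl fun i _ => by rw [Matrix.mulVec_smul, standardize]

lemma testMax_eq_maxAbs (ω : S.Ω) : testMax S g ω =
    maxAbs (Learner.invSqrt (testCov S g ω) *ᵥ (Learner.scale S • testStat S g ω)) := by
  simp [testMax, maxAbs, Matrix.mulVec_smul, abs_mul, abs_of_nonneg (scale_nonneg (S := S))]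

lemma abs_maxAbs_sub_le (hm : 0 < m) {x y : Fin m → ℝ} {η : ℝ} (h : ∀ j, |x j - y j| ≤ η) :
    |maxAbs x - maxAbs y| ≤ η := by
  have : Nonempty (Fin m) := ⟨⟨0, hm⟩⟩
  have key : ∀ x y : Fin m → ℝ, (∀ j, |x j - y j| ≤ η) → maxAbs x ≤ maxAbs y + η := by
    intro x y h
    refine ciSup_le fun j => ?_
    have h1 : |y j| ≤ maxAbs y := le_ciSup (f := fun j => |y j|) (Set.finite_range _).bddAbove j
    have h2 := abs_sub_abs_le_abs_sub (x j) (y j)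
    linarith [h j]
  rw [abs_le]
  have h1 := key x y h
  have h2 := key y x fun j => by rw [abs_sub_comm]; exact h j
  constructor <;> linarith

end FixedWitness

/-- Distance of the distribution function of the max statistic, for fixed functions `g j`, from the
one of `max_j |Z_j|`. -/
theorem exists_testMax_bound {m : ℕ} (hm : 0 < m) {c₁ c₂ c : ℝ} (hc₁ : 0 < c₁) (hc₂ : c₂ < 1)
    (hc : 0 < c) : ∃ C : ℝ, 0 ≤ C ∧
    ∀ (S : TwoSample.{u}) (g : Fin m → (Fin S.d → ℝ) → ℝ) (B δ R : ℝ), S.Null →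
      S.SizesBalanced c₁ c₂ → (∀ j, Measurable (g j)) → (∀ j x, |g j x| ≤ B) →
      spectrum ℝ (popCov S g) ⊆ Set.Ici c → 0 ≤ δ → m * δ ≤ c / 2 → 0 ≤ R → ∀ t,
      |S.P.real {ω | testMax S g ω ≤ t} - (stdNormal m).real {z | maxAbs z ≤ t}| ≤
        C * (popCube S g / √S.n) + S.P.real {ω | ∃ j k, δ < |testCov S g ω j k - popCov S g j k|} +
          (1 - (stdNormal m).real (Set.Icc (fun _ => -R) (fun _ => R))) + C * (δ * R) := by
  obtain ⟨K, hK0, hK⟩ := exists_berryEsseen_box_sum.{u} hm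
  set κ := testRatio c₁ c₂
  have hκ : 0 < κ := testRatio_pos hc₁ hc₂
  set C1 := 2 * K * ((m / √c) ^ 3 * m ^ 2) / √κ
  set C2 := 2 * m * (m ^ 3 / c)
  have hC1 : 0 ≤ C1 := by positivity
  have hC2 : 0 ≤ C2 := by positivity
  refine ⟨C1 + C2, by positivity, fun S g B δ R h0 hS hg hB hspec hδ hmδ hR t => ?_⟩
  have hn2 := hS.two_le_n hc₁ hc₂
  have hn : (0 : ℝ) < S.n := by exact_mod_cast (by omega : 0 < S.n)
  obtain ⟨ha, hb⟩ := hS.le_nTest hc₁ hc₂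
  have hq : 0 < κ * S.n := by positivity
  have ha0 : 0 < S.nxTest := by exact_mod_cast hq.trans_le ha
  have hb0 : 0 < S.nyTest := by exact_mod_cast hq.trans_le hb
  set W : S.Ω → Fin m → ℝ := fun ω => ∑ i ∈ S.fitXᶜ.disjSum S.fitYᶜ,
    testWeight S i • standardize S g (S.obs i ω) with hWdef
  have hmz := measurable_standardize (S := S) hg
  have hmi : ∀ i, Measurable fun ω => standardize S g (S.obs i ω) := fun i =>
    hmz.comp (measurable_obs i)
  have hWm : Measurable W := by fun_prop
  have : IsProbabilityMeasure (S.μ.map (standardize S g)) :=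
    Measure.isProbabilityMeasure_map hmz.aemeasurable
  have hbe := hK S.P (S.μ.map (standardize S g)) (fun i ω => standardize S g (S.obs i ω))
    (testWeight S) (1 / √(κ * S.n)) (S.fitXᶜ.disjSum S.fitYᶜ)
    (isStandardized_map_standardize hc hg hB hspec) hmi
    (S.indep.comp (fun _ => standardize S g) fun _ => hmz)
    (fun i => by
      rw [← law_obs h0 i, Measure.map_map hmz (measurable_obs i)]; rfl)
    (by positivity) (abs_testWeight_le hq ha hb) (sum_testWeight_sq ha0 hb0)
  -- Perturbation bound of `abs_invSqrt_mulVec_sub_le` for a sample matrix within `δ` of the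
  -- population one, on the event `|W_j| ≤ R`.
  set η := m ^ 3 * δ / c * R
  have hmain := abs_real_le_sub_maxAbs_le hm S.P (testMax S g) hWm
    {ω | ∃ j k, δ < |testCov S g ω j k - popCov S g j k|} (R := R) (η := η) (by positivity) hbe
    (fun ω hω hWR => by
      rw [testMax_eq_maxAbs]
      refine abs_maxAbs_sub_le hm fun j => ?_
      have hW' : W ω = Learner.invSqrt (popCov S g) *ᵥ (Learner.scale S • testStat S g ω) :=
        (invSqrt_mulVec_scale_smul_testStat ha0 hb0 ω).symm
      rw [hW'] at hWR ⊢
      refine abs_invSqrt_mulVec_sub_le hc (isHermitian_popCov S g) (isHermitian_testCov S g ω)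
        hspec (fun i j => ?_) hmδ _ hWR j
      by_contra hcon
      exact hω ⟨i, j, not_le.1 hcon⟩) t
  have hcube := cubeMoment_map_standardize_le hc hg hB hspec
  have hcube0 : 0 ≤ popCube S g :=
    Finset.sum_nonneg fun j _ => integral_nonneg fun x => by positivity
  have e1 : 2 * (K * (cubeMoment (S.μ.map (standardize S g)) * (1 / √(κ * S.n)))) ≤
      C1 * (popCube S g / √S.n) := by
    calc _ ≤ 2 * (K * (((m / √c) ^ 3 * m ^ 2 * popCube S g) * (1 / √(κ * S.n)))) := by gcongr
      _ = _ := by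
        rw [Real.sqrt_mul hκ.le]
        simp only [C1]
        field_simp
  have e2 : 2 * m * η = C2 * (δ * R) := by simp only [η, C2]; field_simp
  have e3 : 0 ≤ C2 * (popCube S g / √S.n) := by positivity
  have e4 : 0 ≤ C1 * (δ * R) := by positivity
  rw [e2] at hmain
  linarith

/-! ### Chebyshev and Bernstein inequalities for averages of observations. -/

section Averages

variable {S : TwoSample.{u}} {f : (Fin S.d → ℝ) → ℝ} {B : ℝ}

variable (S) in
/-- The average of `f` over the observations with index in `s`. -/
def obsAvg (f : (Fin S.d → ℝ) → ℝ) (s : Finset (Fin S.nx ⊕ Fin S.ny)) (ω : S.Ω) : ℝ :=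
  (1 / (s.card : ℝ)) * ∑ i ∈ s, f (S.obs i ω)

lemma iIndepFun_obs_comp (hf : Measurable f) : iIndepFun (fun i ω => f (S.obs i ω)) S.P :=
  S.indep.comp (fun _ => f) fun _ => hf

lemma integral_obs_comp (h0 : S.Null) {F : (Fin S.d → ℝ) → ℝ} (hF : Measurable F)
    (i : Fin S.nx ⊕ Fin S.ny) : ∫ ω, F (S.obs i ω) ∂S.P = ∫ x, F x ∂S.μ := by
  rw [← law_obs h0 i, integral_map (measurable_obs i).aemeasurable hF.aestronglyMeasurable]

/-- Chebyshev's inequality for averages of independent observations. -/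
lemma obsAvg_chebyshev (h0 : S.Null) (hf : Measurable f) (hB : ∀ x, |f x| ≤ B)
    (hmean : ∫ x, f x ∂S.μ = 0) {s : Finset (Fin S.nx ⊕ Fin S.ny)} (hs : 0 < s.card) {r : ℝ}
    (hr : 0 < r) :
    S.P.real {ω | r < |obsAvg S f s ω|} ≤ (∫ x, f x ^ 2 ∂S.μ) / (s.card * r ^ 2) := by
  have hs' : (0 : ℝ) < s.card := by exact_mod_cast hs
  have hmf : ∀ i, Measurable fun ω => f (S.obs i ω) := fun i => hf.comp (measurable_obs i)
  have hL2 : ∀ i, MemLp (fun ω => f (S.obs i ω)) 2 S.P := fun i =>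
    MemLp.of_bound (hmf i).aestronglyMeasurable B (ae_of_all _ fun ω => hB _)
  have hsumL2 : MemLp (∑ i ∈ s, fun ω => f (S.obs i ω)) 2 S.P :=
    memLp_finsetSum' s fun i _ => hL2 i
  have hmean' : ∀ i, ∫ ω, f (S.obs i ω) ∂S.P = 0 := fun i => by
    rw [integral_obs_comp h0 hf, hmean]
  have hvar : ∀ i, Var[fun ω => f (S.obs i ω); S.P] = ∫ x, f x ^ 2 ∂S.μ := fun i => by
    rw [variance_eq_integral (hmf i).aemeasurable]
    simp only [hmean', sub_zero]
    exact integral_obs_comp h0 (F := fun x => f x ^ 2) (hf.pow_const 2) i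
  have hvs : Var[∑ i ∈ s, fun ω => f (S.obs i ω); S.P] = s.card * ∫ x, f x ^ 2 ∂S.μ := by
    rw [IndepFun.variance_sum (fun i _ => hL2 i) fun i _ j _ hij =>
      (iIndepFun_obs_comp hf).indepFun hij]
    simp [hvar]
  have hEs : ∫ ω, (∑ i ∈ s, fun ω => f (S.obs i ω)) ω ∂S.P = 0 := by
    simp only [Finset.sum_apply]
    rw [integral_finsetSum _ fun i _ => (hL2 i).integrable (by norm_num)]
    simp [hmean']
  have hcheb := meas_ge_le_variance_div_sq hsumL2 (c := s.card * r) (by positivity)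
  rw [hEs, hvs] at hcheb
  have hsub : {ω | r < |obsAvg S f s ω|} ⊆
      {ω | s.card * r ≤ |(∑ i ∈ s, fun ω => f (S.obs i ω)) ω - 0|} := by
    intro ω hω
    simp only [Set.mem_ofPred_eq, obsAvg, abs_mul, sub_zero, Finset.sum_apply] at hω ⊢
    rw [abs_of_pos (by positivity), one_div, lt_inv_mul_iff₀ hs'] at hω
    exact hω.le
  have hI : 0 ≤ ∫ x, f x ^ 2 ∂S.μ := integral_nonneg fun x => sq_nonneg _
  calc S.P.real {ω | r < |obsAvg S f s ω|} ≤ _ := measureReal_mono hsub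
    _ ≤ s.card * (∫ x, f x ^ 2 ∂S.μ) / (s.card * r) ^ 2 :=
        ENNReal.toReal_le_of_le_ofReal (by positivity) hcheb
    _ = _ := by field_simp

lemma abs_exp_sub_linear_le (y : ℝ) : |Real.exp y - 1 - y| ≤ |y| ^ 2 * Real.exp |y| := by
  have h2 := Complex.norm_exp_sub_sum_le_norm_mul_exp (y : ℂ) 2
  rw [Finset.sum_range_succ, Finset.sum_range_succ] at h2
  have h3 : (Complex.exp y - (∑ k ∈ Finset.range 0, (y : ℂ) ^ k / (k.factorial : ℂ) +
      (y : ℂ) ^ 0 / (Nat.factorial 0 : ℂ) + (y : ℂ) ^ 1 / (Nat.factorial 1 : ℂ))) =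
      ((Real.exp y - 1 - y : ℝ) : ℂ) := by
    push_cast
    simp [Nat.factorial]
    ring
  rw [h3, Complex.norm_real, Complex.norm_real] at h2
  simpa using h2

/-- The moment generating function of a centered sub-exponential function. -/
lemma integral_exp_mul_le {α : Type*} [MeasurableSpace α] {μ : Measure α} [IsProbabilityMeasure μ]
    {f : α → ℝ} (hf : Measurable f) (hB : ∀ x, |f x| ≤ B) (hmean : ∫ x, f x ∂μ = 0) {K C : ℝ}
    (hK : 0 < K) (hexp : ∫ x, Real.exp (|f x| / K) ∂μ ≤ C) {l : ℝ} (hl : |l| ≤ 1 / (2 * K)) :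
    ∫ x, Real.exp (l * f x) ∂μ ≤ Real.exp (8 * C * K ^ 2 * l ^ 2) := by
  have hi0 : Integrable f μ := integrable_of_abs_le hf hB
  have hie : Integrable (fun x => Real.exp (|f x| / K)) μ := by
    refine integrable_of_abs_le (B := Real.exp (B / K)) (hf.abs.div_const K).exp fun x => ?_
    rw [abs_of_pos (Real.exp_pos _)]
    gcongr
    exact hB x
  -- The remainder is at most `(l f)² exp |l f|`. The bound on `|l|` leaves room for two factors
  -- `exp (|f| / (2K))`: one dominates `exp |l f|`, the other dominates `f²` up to `8 K²`.
  have hpt : ∀ x, Real.exp (l * f x) ≤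
      1 + l * f x + 8 * K ^ 2 * l ^ 2 * Real.exp (|f x| / K) := by
    intro x
    have h1 := (abs_le.1 (abs_exp_sub_linear_le (l * f x))).2
    have h2 : |l * f x| ≤ |f x| / (2 * K) := by
      rw [abs_mul]
      calc |l| * |f x| ≤ 1 / (2 * K) * |f x| := by gcongr
        _ = _ := by ring
    have h3 : |f x| ^ 2 ≤ 8 * K ^ 2 * Real.exp (|f x| / (2 * K)) := by
      have := Real.pow_div_factorial_le_exp (|f x| / (2 * K)) (by positivity) 2
      rw [div_pow, div_div, div_le_iff₀ (by positivity)] at this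
      simp only [Nat.factorial] at this
      push_cast at this
      linarith
    have h4 : Real.exp (|f x| / (2 * K)) * Real.exp (|f x| / (2 * K)) = Real.exp (|f x| / K) := by
      rw [← Real.exp_add]; congr 1; field_simp; ring
    calc Real.exp (l * f x) ≤ 1 + l * f x + |l * f x| ^ 2 * Real.exp |l * f x| := by linarith
      _ ≤ 1 + l * f x + l ^ 2 * (8 * K ^ 2 * Real.exp (|f x| / (2 * K))) *
          Real.exp (|f x| / (2 * K)) := by
          rw [abs_mul, mul_pow, sq_abs l, ← abs_mul]
          gcongr
      _ = 1 + l * f x + 8 * K ^ 2 * l ^ 2 *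
          (Real.exp (|f x| / (2 * K)) * Real.exp (|f x| / (2 * K))) := by ring
      _ = _ := by rw [h4]
  have hil : Integrable (fun x => 1 + l * f x) μ := (integrable_const _).add (hi0.const_mul l)
  have hii : Integrable (fun x => 8 * K ^ 2 * l ^ 2 * Real.exp (|f x| / K)) μ := hie.const_mul _
  have hiexp : Integrable (fun x => Real.exp (l * f x)) μ := by
    refine (hil.add hii).mono' (hf.const_mul l).exp.aestronglyMeasurable (ae_of_all _ fun x => ?_)
    rw [Real.norm_of_nonneg (Real.exp_pos _).le]
    exact hpt x
  calc ∫ x, Real.exp (l * f x) ∂μ ≤ ∫ x, (1 + l * f x + 8 * K ^ 2 * l ^ 2 *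
        Real.exp (|f x| / K)) ∂μ := integral_mono hiexp (hil.add hii) hpt
    _ = 1 + 8 * K ^ 2 * l ^ 2 * ∫ x, Real.exp (|f x| / K) ∂μ := by
        rw [integral_add hil hii, integral_add (integrable_const _) (hi0.const_mul l),
          integral_const_mul, integral_const_mul, hmean]
        simp
    _ ≤ 1 + 8 * K ^ 2 * l ^ 2 * C := by gcongr
    _ ≤ _ := by
        have := Real.add_one_le_exp (8 * C * K ^ 2 * l ^ 2)
        linarith

lemma obsSum_upper_tail (h0 : S.Null) (hf : Measurable f) (hB : ∀ x, |f x| ≤ B)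
    (hmean : ∫ x, f x ∂S.μ = 0) {K C r : ℝ} (hK : 0 < K) (hC : 0 < C)
    (hexp : ∫ x, Real.exp (|f x| / K) ∂S.μ ≤ C) (hr : 0 ≤ r) (hrC : r ≤ 8 * C)
    (s : Finset (Fin S.nx ⊕ Fin S.ny)) :
    S.P.real {ω | s.card * (K * r) ≤ ∑ i ∈ s, f (S.obs i ω)} ≤
      Real.exp (-(s.card * r ^ 2 / (32 * C))) := by
  have hmf : ∀ i, Measurable fun ω => f (S.obs i ω) := fun i => hf.comp (measurable_obs i)
  -- The minimizer of the Chernoff exponent `8 C K² l² - l K r`, with minimum `-r² / (32 C)`. The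
  -- condition `r ≤ 8 C` keeps `l` in the range `|l| ≤ 1 / (2K)`.
  set l := r / (16 * C * K) with hl
  have hl0 : 0 ≤ l := by positivity
  have hlK : |l| ≤ 1 / (2 * K) := by
    rw [abs_of_nonneg hl0, hl, div_le_div_iff₀ (by positivity) (by positivity)]
    nlinarith
  have hmgf : mgf (∑ i ∈ s, fun ω => f (S.obs i ω)) S.P l ≤
      Real.exp (8 * C * K ^ 2 * l ^ 2) ^ s.card := by
    rw [(iIndepFun_obs_comp hf).mgf_sum hmf, ← Finset.prod_const]
    refine Finset.prod_le_prod (fun i _ => mgf_nonneg) fun i _ => ?_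
    rw [mgf, integral_obs_comp h0 (F := fun x => Real.exp (l * f x)) (hf.const_mul l).exp]
    exact integral_exp_mul_le hf hB hmean hK hexp hlK
  have hint : Integrable (fun ω => Real.exp (l * (∑ i ∈ s, fun ω => f (S.obs i ω)) ω)) S.P := by
    simp only [Finset.sum_apply]
    refine integrable_of_abs_le (B := Real.exp (l * (s.card * B)))
      ((Finset.measurable_sum s fun i _ => hmf i).const_mul l).exp fun ω => ?_
    rw [abs_of_pos (Real.exp_pos _)]
    gcongr
    calc ∑ i ∈ s, f (S.obs i ω) ≤ ∑ _i ∈ s, B :=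
          Finset.sum_le_sum fun i _ => (le_abs_self _).trans (hB _)
      _ = _ := by simp
  have h := measure_ge_le_exp_mul_mgf (μ := S.P) (X := ∑ i ∈ s, fun ω => f (S.obs i ω))
    (s.card * (K * r)) hl0 hint
  simp only [Finset.sum_apply] at h
  refine h.trans ((mul_le_mul_of_nonneg_left hmgf (Real.exp_pos _).le).trans ?_)
  rw [← Real.exp_nat_mul, ← Real.exp_add]
  refine Real.exp_le_exp.2 (le_of_eq ?_)
  rw [hl]
  field_simp
  ring

/-- Bernstein's inequality for averages of independent observations. -/
lemma obsAvg_bernstein (h0 : S.Null) (hf : Measurable f) (hB : ∀ x, |f x| ≤ B)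
    (hmean : ∫ x, f x ∂S.μ = 0) {K C r : ℝ} (hK : 0 < K) (hC : 0 < C)
    (hexp : ∫ x, Real.exp (|f x| / K) ∂S.μ ≤ C) (hr : 0 ≤ r) (hrC : r ≤ 8 * C)
    {s : Finset (Fin S.nx ⊕ Fin S.ny)} (hs : 0 < s.card) :
    S.P.real {ω | K * r < |obsAvg S f s ω|} ≤
      2 * Real.exp (-(s.card * r ^ 2 / (32 * C))) := by
  have hs' : (0 : ℝ) < s.card := by exact_mod_cast hs
  have h1 := obsSum_upper_tail h0 hf hB hmean hK hC hexp hr hrC s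
  have h2 := obsSum_upper_tail (f := fun x => -f x) h0 hf.neg (fun x => by simpa using hB x)
    (by rw [integral_neg, hmean, neg_zero]) hK hC (by simpa using hexp) hr hrC s
  rw [two_mul]
  refine (measureReal_mono ?_).trans ((measureReal_union_le _ _).trans (add_le_add h1 h2))
  intro ω hω
  simp only [Set.mem_ofPred_eq, obsAvg, abs_mul] at hω
  rw [abs_of_pos (by positivity), one_div, lt_inv_mul_iff₀ hs'] at hω
  rcases le_abs.1 hω.le with h | h
  · exact Or.inl h
  · right
    simpa using h

end Averages

/-! ### Deviation of the pooled sample covariance matrix. -/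

section Covariance

variable {m : ℕ} {S : TwoSample.{u}} {g : Fin m → (Fin S.d → ℝ) → ℝ} {B : ℝ}

variable (S) in
/-- Indices of the test part of the first sample. -/
def testX : Finset (Fin S.nx ⊕ Fin S.ny) := S.fitXᶜ.map Function.Embedding.inl

variable (S) in
/-- Indices of the test part of the second sample. -/
def testY : Finset (Fin S.nx ⊕ Fin S.ny) := S.fitYᶜ.map Function.Embedding.inr

lemma card_testX : (testX S).card = S.nxTest := Finset.card_map _

lemma card_testY : (testY S).card = S.nyTest := Finset.card_map _

variable (S g) in
/-- The centered product of `g j` and `g k`. -/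
def centeredProd (j k : Fin m) (x : Fin S.d → ℝ) : ℝ :=
  (g j x - popMean S g j) * (g k x - popMean S g k) - popCov S g j k

/-- Centering at the sample means instead of `p`, `q` subtracts the product of the two mean errors.
That product is quadratic in the mean errors, whence the `r ^ 2` in `real_testCov_sub_popCov_le`. -/
lemma sampleCov_sub {ι : Type*} (s : Finset ι) (hs : 0 < s.card) (u v : ι → ℝ) (p q Γ : ℝ) :
    (1 / (s.card : ℝ)) * ∑ i ∈ s, (u i - (1 / (s.card : ℝ)) * ∑ l ∈ s, u l) *
      (v i - (1 / (s.card : ℝ)) * ∑ l ∈ s, v l) - Γ =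
    (1 / (s.card : ℝ)) * ∑ i ∈ s, ((u i - p) * (v i - q) - Γ) -
      ((1 / (s.card : ℝ)) * ∑ i ∈ s, (u i - p)) * ((1 / (s.card : ℝ)) * ∑ i ∈ s, (v i - q)) := by
  have hs' : (0 : ℝ) < s.card := by exact_mod_cast hs
  set N : ℝ := (s.card : ℝ)
  set U := ∑ l ∈ s, u l
  set V := ∑ l ∈ s, v l
  have e1 : ∑ i ∈ s, (u i - 1 / N * U) * (v i - 1 / N * V) =
      ∑ i ∈ s, u i * v i - 1 / N * U * V := by
    have : ∀ i, (u i - 1 / N * U) * (v i - 1 / N * V) =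
      u i * v i - 1 / N * V * u i - 1 / N * U * v i + 1 / N * U * (1 / N * V) := fun i => by ring
    simp_rw [this]
    rw [Finset.sum_add_distrib, Finset.sum_sub_distrib, Finset.sum_sub_distrib, ← Finset.mul_sum,
      ← Finset.mul_sum, Finset.sum_const, nsmul_eq_mul]
    change _ - _ * U - _ * V + N * _ = _
    field_simp
    ring
  have e2 : ∑ i ∈ s, ((u i - p) * (v i - q) - Γ) =
      ∑ i ∈ s, u i * v i - q * U - p * V + N * (p * q - Γ) := by
    have : ∀ i, (u i - p) * (v i - q) - Γ =
      u i * v i - q * u i - p * v i + (p * q - Γ) := fun i => by ring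
    simp_rw [this]
    rw [Finset.sum_add_distrib, Finset.sum_sub_distrib, Finset.sum_sub_distrib, ← Finset.mul_sum,
      ← Finset.mul_sum, Finset.sum_const, nsmul_eq_mul]
  rw [e1, e2]
  simp only [Finset.sum_sub_distrib, Finset.sum_const, nsmul_eq_mul]
  change _ = _ - 1 / N * (U - N * p) * (1 / N * (V - N * q))
  field_simp
  ring

/-- The two pooling weights add up to `1`, so `popCov` can be subtracted within each sample. -/
lemma testCov_sub_popCov (ha : 0 < S.nxTest) (hb : 0 < S.nyTest) (ω : S.Ω) (j k : Fin m) :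
    testCov S g ω j k - popCov S g j k =
      (S.nyTest : ℝ) / (S.nxTest + S.nyTest) * (obsAvg S (centeredProd S g j k) (testX S) ω -
        obsAvg S (fun x => g j x - popMean S g j) (testX S) ω *
          obsAvg S (fun x => g k x - popMean S g k) (testX S) ω) +
      (S.nxTest : ℝ) / (S.nxTest + S.nyTest) * (obsAvg S (centeredProd S g j k) (testY S) ω -
        obsAvg S (fun x => g j x - popMean S g j) (testY S) ω *
          obsAvg S (fun x => g k x - popMean S g k) (testY S) ω) := by
  have ha' : (0 : ℝ) < S.nxTest := by exact_mod_cast ha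
  have hb' : (0 : ℝ) < S.nyTest := by exact_mod_cast hb
  have hX := sampleCov_sub S.fitXᶜ ha (fun i => g j (S.X i ω)) (fun i => g k (S.X i ω))
    (popMean S g j) (popMean S g k) (popCov S g j k)
  have hY := sampleCov_sub S.fitYᶜ hb (fun i => g j (S.Y i ω)) (fun i => g k (S.Y i ω))
    (popMean S g j) (popMean S g k) (popCov S g j k)
  simp only [obsAvg, testX, testY, Finset.card_map, Finset.sum_map,
    Function.Embedding.inl_apply, Function.Embedding.inr_apply, TwoSample.obs, Sum.elim_inl,
    Sum.elim_inr, centeredProd]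
  rw [← hX, ← hY]
  simp only [testCov, testMeanX, testMeanY, Matrix.of_apply, TwoSample.nxTest, TwoSample.nyTest]
  have key : (S.nyTest : ℝ) / (S.nxTest + S.nyTest) + S.nxTest / (S.nxTest + S.nyTest) = 1 := by
    field_simp
    ring
  simp only [TwoSample.nxTest, TwoSample.nyTest] at key
  linear_combination popCov S g j k * key

/-- Reduction of the deviation of the sample covariance matrix to the ones of averages of centered
functions. -/
lemma real_testCov_sub_popCov_le (ha : 0 < S.nxTest) (hb : 0 < S.nyTest) {δ δ' r p : ℝ}
    (hr : 0 ≤ r) (hδ : δ' + r ^ 2 ≤ δ)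
    (h1 : ∀ s ∈ ({testX S, testY S} : Set (Finset (Fin S.nx ⊕ Fin S.ny))), ∀ j k,
      S.P.real {ω | δ' < |obsAvg S (centeredProd S g j k) s ω|} ≤ p)
    (h2 : ∀ s ∈ ({testX S, testY S} : Set (Finset (Fin S.nx ⊕ Fin S.ny))), ∀ j,
      S.P.real {ω | r < |obsAvg S (fun x => g j x - popMean S g j) s ω|} ≤ p) :
    S.P.real {ω | ∃ j k, δ < |testCov S g ω j k - popCov S g j k|} ≤ 2 * (m ^ 2 + m) * p := by
  have ha' : (0 : ℝ) < S.nxTest := by exact_mod_cast ha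
  have hb' : (0 : ℝ) < S.nyTest := by exact_mod_cast hb
  set E1 : Finset (Fin S.nx ⊕ Fin S.ny) → Set S.Ω := fun s =>
    ⋃ q : Fin m × Fin m, {ω | δ' < |obsAvg S (centeredProd S g q.1 q.2) s ω|} with hE1
  set E2 : Finset (Fin S.nx ⊕ Fin S.ny) → Set S.Ω := fun s =>
    ⋃ j : Fin m, {ω | r < |obsAvg S (fun x => g j x - popMean S g j) s ω|} with hE2
  have b1 : ∀ s ∈ ({testX S, testY S} : Set (Finset (Fin S.nx ⊕ Fin S.ny))),
      S.P.real (E1 s) ≤ m ^ 2 * p := by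
    intro s hs
    refine (measureReal_iUnion_fintype_le _).trans
      ((Finset.sum_le_sum fun q _ => h1 s hs q.1 q.2).trans (le_of_eq ?_))
    simp [sq]
  have b2 : ∀ s ∈ ({testX S, testY S} : Set (Finset (Fin S.nx ⊕ Fin S.ny))),
      S.P.real (E2 s) ≤ m * p := by
    intro s hs
    refine (measureReal_iUnion_fintype_le _).trans
      ((Finset.sum_le_sum fun j _ => h2 s hs j).trans (le_of_eq ?_))
    simp
  have hX : testX S ∈ ({testX S, testY S} : Set (Finset (Fin S.nx ⊕ Fin S.ny))) := by simp
  have hY : testY S ∈ ({testX S, testY S} : Set (Finset (Fin S.nx ⊕ Fin S.ny))) := by simp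
  have hsub : {ω | ∃ j k, δ < |testCov S g ω j k - popCov S g j k|} ⊆
      (E1 (testX S) ∪ E2 (testX S)) ∪ (E1 (testY S) ∪ E2 (testY S)) := by
    rintro ω ⟨j, k, hjk⟩
    by_contra hcon
    simp only [Set.mem_union, not_or, hE1, hE2, Set.mem_iUnion, not_exists, Set.mem_ofPred_eq,
      not_lt] at hcon
    obtain ⟨⟨x1, x2⟩, ⟨y1, y2⟩⟩ := hcon
    have hside : ∀ s, (∀ q : Fin m × Fin m, |obsAvg S (centeredProd S g q.1 q.2) s ω| ≤ δ') →
        (∀ j, |obsAvg S (fun x => g j x - popMean S g j) s ω| ≤ r) →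
        |obsAvg S (centeredProd S g j k) s ω - obsAvg S (fun x => g j x - popMean S g j) s ω *
          obsAvg S (fun x => g k x - popMean S g k) s ω| ≤ δ := by
      intro s p1 p2
      refine (abs_sub _ _).trans ?_
      rw [abs_mul]
      have := mul_le_mul (p2 j) (p2 k) (abs_nonneg _) hr
      have := p1 (j, k)
      simp only at this
      nlinarith
    have hx := hside _ x1 x2
    have hy := hside _ y1 y2
    rw [testCov_sub_popCov ha hb] at hjk
    refine absurd hjk (not_lt.2 ((abs_add_le _ _).trans ?_))
    rw [abs_mul, abs_mul,
      abs_of_nonneg (by positivity : 0 ≤ (S.nyTest : ℝ) / (S.nxTest + S.nyTest)),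
      abs_of_nonneg (by positivity : 0 ≤ (S.nxTest : ℝ) / (S.nxTest + S.nyTest))]
    calc _ ≤ (S.nyTest : ℝ) / (S.nxTest + S.nyTest) * δ +
          (S.nxTest : ℝ) / (S.nxTest + S.nyTest) * δ := by gcongr
      _ = δ := by field_simp; ring
  refine (measureReal_mono hsub).trans ((measureReal_union_le _ _).trans
    ((add_le_add (measureReal_union_le _ _) (measureReal_union_le _ _)).trans ?_))
  have := b1 _ hX
  have := b1 _ hY
  have := b2 _ hX
  have := b2 _ hY
  linarith

end Covariance

/-! ### Gaussian tails. -/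

lemma gaussianReal_real_abs_gt_le {R : ℝ} (hR : 0 ≤ R) :
    (gaussianReal 0 1).real {x | R < |x|} ≤ 2 * Real.exp (-(R ^ 2 / 2)) := by
  have hup : (gaussianReal 0 1).real {x | R ≤ id x} ≤ Real.exp (-(R ^ 2 / 2)) := by
    refine (measure_ge_le_exp_mul_mgf R hR (integrable_exp_mul_gaussianReal R)).trans
      (le_of_eq ?_)
    rw [mgf_fun_id_gaussianReal, ← Real.exp_add]
    congr 1
    simp
    ring
  have hlow : (gaussianReal 0 1).real {x | id x ≤ -R} ≤ Real.exp (-(R ^ 2 / 2)) := by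
    refine (measure_le_le_exp_mul_mgf (-R) (t := -R) (by linarith)
      (integrable_exp_mul_gaussianReal (-R))).trans (le_of_eq ?_)
    rw [mgf_fun_id_gaussianReal, ← Real.exp_add]
    congr 1
    simp
    ring
  rw [two_mul]
  refine (measureReal_mono ?_).trans ((measureReal_union_le _ _).trans (add_le_add hup hlow))
  intro x hx
  rcases lt_abs.1 (show R < |x| from hx) with h | h
  · exact Or.inl h.le
  · right
    change x ≤ -R
    linarith

lemma one_sub_stdNormal_box_le (m : ℕ) {R : ℝ} (hR : 0 ≤ R) :
    1 - (stdNormal m).real (Set.Icc (fun _ => -R) (fun _ => R)) ≤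
      2 * m * Real.exp (-(R ^ 2 / 2)) := by
  rw [← probReal_compl_eq_one_sub measurableSet_Icc]
  have hsub : (Set.Icc (fun _ : Fin m => -R) (fun _ => R))ᶜ ⊆
      ⋃ j : Fin m, (fun z : Fin m → ℝ => z j) ⁻¹' {x | R < |x|} := by
    intro z hz
    by_contra hcon
    simp only [Set.mem_iUnion, Set.mem_preimage, Set.mem_ofPred_eq, not_exists, not_lt] at hcon
    exact hz ⟨fun j => (abs_le.1 (hcon j)).1, fun j => (abs_le.1 (hcon j)).2⟩
  refine (measureReal_mono hsub).trans ((measureReal_iUnion_fintype_le _).trans ?_)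
  calc ∑ j : Fin m, _ ≤ ∑ _j : Fin m, 2 * Real.exp (-(R ^ 2 / 2)) := by
        refine Finset.sum_le_sum fun j _ => ?_
        have h2 : (stdNormal m).map (fun z => z j) = gaussianReal 0 1 :=
          (measurePreserving_eval (fun _ : Fin m => gaussianReal 0 1) j).map_eq
        rw [← map_measureReal_apply (by fun_prop)
          (show MeasurableSet {x : ℝ | R < |x|} from
            measurableSet_lt measurable_const measurable_id.abs), h2]
        exact gaussianReal_real_abs_gt_le hR
    _ = _ := by simp; ring

lemma integral_sub_add_const {α : Type*} [MeasurableSpace α] {μ : Measure α}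
    [IsProbabilityMeasure μ] {f h : α → ℝ} (hf : Integrable f μ) (hh : Integrable h μ) (k : ℝ) :
    ∫ x, (f x - h x + k) ∂μ = ∫ x, f x ∂μ - ∫ x, h x ∂μ + k := by
  have h1 : ∫ x, (f x - h x + k) ∂μ = ∫ x, (f x - h x) ∂μ + ∫ _x, k ∂μ :=
    integral_add (hf.sub hh) (integrable_const _)
  rw [h1, integral_sub hf hh]
  simp

/-! ### Moments of bounded functions. -/

section Moments

variable {m : ℕ} {S : TwoSample.{u}} {g : Fin m → (Fin S.d → ℝ) → ℝ} {B c : ℝ}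

lemma popCov_diag_le (h : spectrum ℝ (popCov S g) ⊆ Set.Iic c) (j : Fin m) :
    popCov S g j j ≤ c := by
  have hH := isHermitian_popCov S g
  have h1 := posSemidef_cfc hH (f := fun t => c - id t) fun t ht => sub_nonneg.2 (h ht)
  rw [← smul_one_sub_cfc hH, cfc_id ℝ _ hH.isSelfAdjoint] at h1
  have := h1.diag_nonneg (i := j)
  simpa using this

lemma le_popCov_diag (h : spectrum ℝ (popCov S g) ⊆ Set.Ici c) (j : Fin m) :
    c ≤ popCov S g j j := by
  have := (posSemidef_sub_of_spectrum (isHermitian_popCov S g) h).diag_nonneg (i := j)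
  simpa using this

lemma popCov_diag_eq (j : Fin m) :
    popCov S g j j = ∫ x, (g j x - popMean S g j) ^ 2 ∂S.μ := by
  simp [popCov, sq]

lemma measurable_centeredProd (hg : ∀ j, Measurable (g j)) (j k : Fin m) :
    Measurable (centeredProd S g j k) :=
  (((hg j).sub_const _).mul ((hg k).sub_const _)).sub_const _

lemma abs_centered_mul_le (hB : ∀ j x, |g j x| ≤ B) (j k : Fin m) (x : Fin S.d → ℝ) :
    |(g j x - popMean S g j) * (g k x - popMean S g k)| ≤ 4 * B ^ 2 := by
  rw [abs_mul]
  have h1 := abs_sub_popMean_le hB j x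
  have h2 := abs_sub_popMean_le hB k x
  calc _ ≤ (2 * B) * (2 * B) := mul_le_mul h1 h2 (abs_nonneg _) ((abs_nonneg _).trans h1)
    _ = _ := by ring

lemma abs_centeredProd_le (hB : ∀ j x, |g j x| ≤ B) (j k : Fin m) (x : Fin S.d → ℝ) :
    |centeredProd S g j k x| ≤ 8 * B ^ 2 := by
  have h1 := abs_centered_mul_le hB j k x
  have h2 : |popCov S g j k| ≤ 4 * B ^ 2 := abs_integral_le_of_abs_le (abs_centered_mul_le hB j k)
  exact (abs_sub _ _).trans (by linarith)

lemma integral_centeredProd (hg : ∀ j, Measurable (g j)) (hB : ∀ j x, |g j x| ≤ B)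
    (j k : Fin m) : ∫ x, centeredProd S g j k x ∂S.μ = 0 := by
  unfold centeredProd
  rw [integral_sub (integrable_centered_mul hg hB j k) (integrable_const _)]
  simp [popCov]

/-- One squared factor is bounded by `4 B²`, the other is integrated to a variance. With bounded
variances this is of order `B²` and not `B⁴`, which is what makes `B = o(√n)` sufficient. -/
lemma integral_centeredProd_sq_le (hg : ∀ j, Measurable (g j)) (hB : ∀ j x, |g j x| ≤ B)
    (j k : Fin m) : ∫ x, centeredProd S g j k x ^ 2 ∂S.μ ≤ 4 * B ^ 2 * popCov S g k k := by
  have hp : Measurable fun x => (g j x - popMean S g j) * (g k x - popMean S g k) :=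
    ((hg j).sub_const _).mul ((hg k).sub_const _)
  have hi1 := integrable_centered_mul (S := S) hg hB j k
  have hi2 : Integrable (fun x => ((g j x - popMean S g j) * (g k x - popMean S g k)) ^ 2) S.μ := by
    refine integrable_of_abs_le (B := (4 * B ^ 2) ^ 2) (hp.pow_const 2) fun x => ?_
    rw [abs_pow]
    exact pow_le_pow_left₀ (abs_nonneg _) (abs_centered_mul_le hB j k x) 2
  have hi3 : Integrable (fun x => (g k x - popMean S g k) ^ 2) S.μ := by
    simpa [sq] using integrable_centered_mul (S := S) hg hB k k
  have e : ∀ x, centeredProd S g j k x ^ 2 =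
      ((g j x - popMean S g j) * (g k x - popMean S g k)) ^ 2 -
      2 * popCov S g j k * ((g j x - popMean S g j) * (g k x - popMean S g k)) +
      popCov S g j k ^ 2 := fun x => by unfold centeredProd; ring
  have hval : ∫ x, (g j x - popMean S g j) * (g k x - popMean S g k) ∂S.μ = popCov S g j k := by
    simp [popCov]
  calc ∫ x, centeredProd S g j k x ^ 2 ∂S.μ =
      ∫ x, ((g j x - popMean S g j) * (g k x - popMean S g k)) ^ 2 ∂S.μ - popCov S g j k ^ 2 := by
        simp_rw [e]
        rw [integral_sub_add_const hi2 (hi1.const_mul _), integral_const_mul, hval]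
        ring
    _ ≤ ∫ x, ((g j x - popMean S g j) * (g k x - popMean S g k)) ^ 2 ∂S.μ := by
        linarith [sq_nonneg (popCov S g j k)]
    _ ≤ ∫ x, 4 * B ^ 2 * (g k x - popMean S g k) ^ 2 ∂S.μ := by
        refine integral_mono hi2 (hi3.const_mul _) fun x => ?_
        have h1 := abs_sub_popMean_le hB j x
        have h2 : (g j x - popMean S g j) ^ 2 ≤ 4 * B ^ 2 := by
          rw [← sq_abs]
          calc _ ≤ (2 * B) ^ 2 := pow_le_pow_left₀ (abs_nonneg _) h1 2
            _ = _ := by ring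
        simp only [mul_pow]
        exact mul_le_mul_of_nonneg_right h2 (sq_nonneg _)
    _ = _ := by rw [integral_const_mul, popCov_diag_eq]

/-- Again one factor is bounded by `2 B` and the rest is a variance, so the Berry–Esseen term is of
order `B / √n`. -/
lemma popCube_le_of_bounded (hg : ∀ j, Measurable (g j)) (hB : ∀ j x, |g j x| ≤ B)
    (h : spectrum ℝ (popCov S g) ⊆ Set.Iic c) : popCube S g ≤ m * (2 * B * c) := by
  calc popCube S g ≤ ∑ _j : Fin m, 2 * B * c := by
        refine Finset.sum_le_sum fun j _ => ?_
        have hi3 : Integrable (fun x => (g j x - popMean S g j) ^ 2) S.μ := by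
          simpa [sq] using integrable_centered_mul (S := S) hg hB j j
        have hB0 : 0 ≤ B := (abs_nonneg _).trans (hB j 0)
        calc _ ≤ ∫ x, 2 * B * (g j x - popMean S g j) ^ 2 ∂S.μ := by
              refine integral_mono (integrable_centered_cube hg hB j) (hi3.const_mul _) fun x => ?_
              simp only
              rw [pow_succ, sq_abs, mul_comm]
              exact mul_le_mul_of_nonneg_right (abs_sub_popMean_le hB j x) (sq_nonneg _)
          _ = 2 * B * popCov S g j j := by rw [integral_const_mul, popCov_diag_eq]
          _ ≤ _ := by
              gcongr
              exact popCov_diag_le h j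
    _ = _ := by simp

/-- Jensen's inequality through the tangent of `y³` at the mean `A` of `|f|`: `y³ ≥ 3 A² y - 2 A³`
for `y ≥ 0`. -/
lemma abs_integral_cube_le {α : Type*} [MeasurableSpace α] {μ : Measure α}
    [IsProbabilityMeasure μ] {f : α → ℝ} (hf : Measurable f) (hB : ∀ x, |f x| ≤ B) :
    |∫ x, f x ∂μ| ^ 3 ≤ ∫ x, |f x| ^ 3 ∂μ := by
  have hi1 : Integrable (fun x => |f x|) μ := (integrable_of_abs_le hf hB).abs
  have hi3 : Integrable (fun x => |f x| ^ 3) μ := by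
    refine integrable_of_abs_le (B := B ^ 3) (hf.abs.pow_const 3) fun x => ?_
    rw [abs_pow, abs_abs]
    exact pow_le_pow_left₀ (abs_nonneg _) (hB x) 3
  set A := ∫ x, |f x| ∂μ with hA
  have hA0 : 0 ≤ A := integral_nonneg fun x => abs_nonneg _
  calc |∫ x, f x ∂μ| ^ 3 ≤ A ^ 3 := pow_le_pow_left₀ (abs_nonneg _) abs_integral_le_integral_abs 3
    _ = ∫ x, (3 * A ^ 2 * |f x| - 2 * A ^ 3) ∂μ := by
        rw [integral_sub (hi1.const_mul _) (integrable_const _), integral_const_mul, ← hA]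
        simp
        ring
    _ ≤ _ := by
        refine integral_mono ((hi1.const_mul _).sub (integrable_const _)) hi3 fun x => ?_
        have h0 := abs_nonneg (f x)
        simp only
        generalize |f x| = y at *
        nlinarith [mul_nonneg (sq_nonneg (y - A)) (by linarith : 0 ≤ y + 2 * A)]

/-- From `(a + b)³ ≤ 4 (a³ + b³)` and Jensen's inequality for the mean, `8 = 4 + 4`. -/
lemma popCube_le (hg : ∀ j, Measurable (g j)) (hB : ∀ j x, |g j x| ≤ B) :
    popCube S g ≤ 8 * ∑ j, ∫ x, |g j x| ^ 3 ∂S.μ := by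
  rw [popCube, Finset.mul_sum]
  refine Finset.sum_le_sum fun j _ => ?_
  have hi3 : Integrable (fun x => |g j x| ^ 3) S.μ := by
    refine integrable_of_abs_le (B := B ^ 3) ((hg j).abs.pow_const 3) fun x => ?_
    rw [abs_pow, abs_abs]
    exact pow_le_pow_left₀ (abs_nonneg _) (hB j x) 3
  have hJ : |popMean S g j| ^ 3 ≤ ∫ x, |g j x| ^ 3 ∂S.μ := abs_integral_cube_le (hg j) (hB j)
  calc _ ≤ ∫ x, (4 * |g j x| ^ 3 + 4 * |popMean S g j| ^ 3) ∂S.μ := by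
        refine integral_mono (integrable_centered_cube hg hB j)
          ((hi3.const_mul _).add (integrable_const _)) fun x => ?_
        have h1 : |g j x - popMean S g j| ^ 3 ≤ (|g j x| + |popMean S g j|) ^ 3 :=
          pow_le_pow_left₀ (abs_nonneg _) (abs_sub _ _) 3
        have ha := abs_nonneg (g j x)
        have hb := abs_nonneg (popMean S g j)
        refine h1.trans ?_
        generalize |g j x| = a at *
        generalize |popMean S g j| = b at *
        nlinarith [mul_nonneg (add_nonneg ha hb) (sq_nonneg (a - b))]
    _ = 4 * ∫ x, |g j x| ^ 3 ∂S.μ + 4 * |popMean S g j| ^ 3 := by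
        rw [integral_add (hi3.const_mul _) (integrable_const _), integral_const_mul]
        simp
    _ ≤ _ := by linarith

end Moments

/-- Distance of the distribution functions for witnesses with a given bound. -/
theorem exists_testMax_bound_of_bounded {m : ℕ} (hm : 0 < m) {c₁ c₂ c c' : ℝ} (hc₁ : 0 < c₁)
    (hc₂ : c₂ < 1) (hc : 0 < c) (hc' : 0 < c') : ∃ C : ℝ, 0 ≤ C ∧
    ∀ (S : TwoSample.{u}) (g : Fin m → (Fin S.d → ℝ) → ℝ) (B δ R : ℝ), S.Null →
      S.SizesBalanced c₁ c₂ → (∀ j, Measurable (g j)) → (∀ j x, |g j x| ≤ B) →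
      spectrum ℝ (popCov S g) ⊆ Set.Icc c c' → 0 < δ → δ ≤ 1 → m * δ ≤ c / 2 → 0 ≤ R → ∀ t,
      |S.P.real {ω | testMax S g ω ≤ t} - (stdNormal m).real {z | maxAbs z ≤ t}| ≤
        C * (B / √S.n) + C * (((B / √S.n) ^ 2 + 1 / S.n) / δ ^ 2) +
          (1 - (stdNormal m).real (Set.Icc (fun _ => -R) (fun _ => R))) + C * (δ * R) := by
  obtain ⟨C, hC0, hC⟩ := exists_testMax_bound.{u} hm hc₁ hc₂ hc
  set κ := testRatio c₁ c₂
  have hκ : 0 < κ := testRatio_pos hc₁ hc₂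
  set C1 := C * (m * (2 * c'))
  set C2 := 2 * (m ^ 2 + m) * (16 * c' / κ)
  have hC1 : 0 ≤ C1 := by positivity
  have hC2 : 0 ≤ C2 := by positivity
  refine ⟨C + C1 + C2, by positivity, fun S g B δ R h0 hS hg hB hspec hδ hδ1 hmδ hR t => ?_⟩
  have hn2 := hS.two_le_n hc₁ hc₂
  have hn : (0 : ℝ) < S.n := by exact_mod_cast (by omega : 0 < S.n)
  obtain ⟨ha, hb⟩ := hS.le_nTest hc₁ hc₂
  have hq : 0 < κ * S.n := by positivity
  have ha0 : 0 < S.nxTest := by exact_mod_cast hq.trans_le ha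
  have hb0 : 0 < S.nyTest := by exact_mod_cast hq.trans_le hb
  have hB0 : 0 ≤ B := (abs_nonneg _).trans (hB ⟨0, hm⟩ 0)
  have hlow : spectrum ℝ (popCov S g) ⊆ Set.Ici c := hspec.trans Set.Icc_subset_Ici_self
  have hup : spectrum ℝ (popCov S g) ⊆ Set.Iic c' := hspec.trans Set.Icc_subset_Iic_self
  have hmain := hC S g B δ R h0 hS hg hB hlow hδ.le hmδ hR t
  have hcube := popCube_le_of_bounded hg hB hup
  have hcard : ∀ s ∈ ({testX S, testY S} : Set (Finset (Fin S.nx ⊕ Fin S.ny))),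
      κ * S.n ≤ (s.card : ℝ) := by
    intro s hs
    rcases hs with rfl | rfl
    · rw [card_testX]; exact ha
    · rw [card_testY]; exact hb
  -- A common bound for both Chebyshev estimates: `B²` comes from the centered products, the summand
  -- `1` from the means, whose variance is at most `c'`.
  set p := 16 * c' / κ * (((B / √S.n) ^ 2 + 1 / S.n) / δ ^ 2) with hp
  have hpe : p = 16 * c' * (B ^ 2 + 1) / (κ * S.n * δ ^ 2) := by
    rw [hp, div_pow, Real.sq_sqrt hn.le]
    field_simp
  have hbad : S.P.real {ω | ∃ j k, δ < |testCov S g ω j k - popCov S g j k|} ≤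
      2 * (m ^ 2 + m) * p := by
    refine real_testCov_sub_popCov_le ha0 hb0 (δ' := δ / 2) (r := δ / 2) (by positivity)
      (by nlinarith) (fun s hs j k => ?_) (fun s hs j => ?_)
    · have hsc : (0 : ℝ) < s.card := hq.trans_le (hcard s hs)
      refine (obsAvg_chebyshev h0 (measurable_centeredProd hg j k) (abs_centeredProd_le hB j k)
        (integral_centeredProd hg hB j k) (by exact_mod_cast hsc) (by positivity)).trans ?_
      have h1 := integral_centeredProd_sq_le (S := S) hg hB j k
      have h2 : 4 * B ^ 2 * popCov S g k k ≤ 4 * B ^ 2 * c' := by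
        gcongr; exact popCov_diag_le hup k
      rw [hpe]
      calc _ ≤ (4 * B ^ 2 * c') / (κ * S.n * (δ / 2) ^ 2) := by
            gcongr
            · exact h1.trans h2
            · exact hcard s hs
        _ = 16 * c' * B ^ 2 / (κ * S.n * δ ^ 2) := by field_simp; ring
        _ ≤ _ := by
            gcongr
            linarith
    · have hsc : (0 : ℝ) < s.card := hq.trans_le (hcard s hs)
      refine (obsAvg_chebyshev h0 ((hg j).sub_const _) (abs_sub_popMean_le hB j)
        (integral_centered hg hB j) (by exact_mod_cast hsc) (by positivity)).trans ?_
      rw [← popCov_diag_eq, hpe]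
      calc _ ≤ c' / (κ * S.n * (δ / 2) ^ 2) := by
            gcongr
            · exact popCov_diag_le hup j
            · exact hcard s hs
        _ = 4 * c' * 1 / (κ * S.n * δ ^ 2) := by field_simp; ring
        _ ≤ _ := by
            gcongr
            · norm_num
            · nlinarith [sq_nonneg B]
  have e1 : C * (popCube S g / √S.n) ≤ C1 * (B / √S.n) := by
    calc _ ≤ C * (m * (2 * B * c') / √S.n) := by gcongr
      _ = _ := by simp only [C1]; ring
  have e2 : 2 * (m ^ 2 + m) * p = C2 * (((B / √S.n) ^ 2 + 1 / S.n) / δ ^ 2) := by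
    rw [hp]; simp only [C2]; ring
  have q1 : 0 ≤ (C + C2) * (B / √S.n) := by positivity
  have q2 : 0 ≤ (C + C1) * (((B / √S.n) ^ 2 + 1 / S.n) / δ ^ 2) := by positivity
  have q3 : 0 ≤ (C1 + C2) * (δ * R) := by positivity
  rw [e2] at hbad
  linarith

/-! ### Sub-Gaussian functions and the rate with logarithm. -/

section SubGaussian

variable {m : ℕ} {S : TwoSample.{u}} {g : Fin m → (Fin S.d → ℝ) → ℝ} {B M : ℝ}

lemma integrable_exp_sq (hM : 0 < M) (hg : ∀ j, Measurable (g j)) (hB : ∀ j x, |g j x| ≤ B)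
    (j : Fin m) : Integrable (fun x => Real.exp (g j x ^ 2 / M ^ 2)) S.μ := by
  refine integrable_of_abs_le (B := Real.exp (B ^ 2 / M ^ 2))
    (((hg j).pow_const 2).div_const _).exp fun x => ?_
  rw [abs_of_pos (Real.exp_pos _)]
  refine Real.exp_le_exp.2 (div_le_div_of_nonneg_right ?_ (by positivity))
  rw [← sq_abs]
  exact pow_le_pow_left₀ (abs_nonneg _) (hB j x) 2

/-- Integrate `1 + y ≤ exp y` at `y = g² / M²`. -/
lemma integral_sq_le_of_subGaussian (hM : 0 < M) (hg : ∀ j, Measurable (g j))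
    (hB : ∀ j x, |g j x| ≤ B) {j : Fin m}
    (hsub : ∫ x, Real.exp (g j x ^ 2 / M ^ 2) ∂S.μ ≤ 2) : ∫ x, g j x ^ 2 ∂S.μ ≤ M ^ 2 := by
  have hi : Integrable (fun x => g j x ^ 2) S.μ := by
    simpa [sq] using integrable_mul_of_abs_le (integrable_of_abs_le (μ := S.μ) (hg j) (hB j))
      (hg j) (hB j)
  have h1 : ∫ x, (g j x ^ 2 / M ^ 2 + 1) ∂S.μ ≤ ∫ x, Real.exp (g j x ^ 2 / M ^ 2) ∂S.μ :=
    integral_mono ((hi.div_const _).add (integrable_const _)) (integrable_exp_sq hM hg hB j)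
      fun x => Real.add_one_le_exp _
  rw [integral_add (hi.div_const _) (integrable_const _), integral_div] at h1
  simp at h1
  have h2 : (∫ x, g j x ^ 2 ∂S.μ) / M ^ 2 ≤ 1 := by linarith
  rwa [div_le_one (by positivity)] at h2

lemma popCov_diag_add_popMean_sq (hg : ∀ j, Measurable (g j)) (hB : ∀ j x, |g j x| ≤ B)
    (j : Fin m) : popCov S g j j + popMean S g j ^ 2 = ∫ x, g j x ^ 2 ∂S.μ := by
  have hi0 := integrable_of_abs_le (μ := S.μ) (hg j) (hB j)
  have hi : Integrable (fun x => g j x ^ 2) S.μ := by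
    simpa [sq] using integrable_mul_of_abs_le hi0 (hg j) (hB j)
  have e : ∀ x, (g j x - popMean S g j) ^ 2 =
      g j x ^ 2 - 2 * popMean S g j * g j x + popMean S g j ^ 2 := fun x => by ring
  rw [popCov_diag_eq]
  simp_rw [e]
  rw [integral_sub_add_const hi (hi0.const_mul _), integral_const_mul]
  change _ - 2 * popMean S g j * popMean S g j + _ + _ = _
  ring

lemma abs_popCov_le (hg : ∀ j, Measurable (g j)) (hB : ∀ j x, |g j x| ≤ B) (j k : Fin m) :
    |popCov S g j k| ≤ (popCov S g j j + popCov S g k k) / 2 := by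
  have hjj := integrable_centered_mul (S := S) hg hB j j
  have hkk := integrable_centered_mul (S := S) hg hB k k
  have hjk := integrable_centered_mul (S := S) hg hB j k
  calc |popCov S g j k| ≤ ∫ x, |(g j x - popMean S g j) * (g k x - popMean S g k)| ∂S.μ :=
        abs_integral_le_integral_abs
    _ ≤ ∫ x, ((g j x - popMean S g j) * (g j x - popMean S g j) +
          (g k x - popMean S g k) * (g k x - popMean S g k)) / 2 ∂S.μ := by
        refine integral_mono hjk.abs ((hjj.add hkk).div_const 2) fun x => ?_
        simp only [abs_le]
        constructor
        · nlinarith [sq_nonneg (g j x - popMean S g j + (g k x - popMean S g k))]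
        · nlinarith [sq_nonneg (g j x - popMean S g j - (g k x - popMean S g k))]
    _ = _ := by
        rw [integral_div, integral_add hjj hkk]
        rfl

/-- The mean is at most `M` in absolute value, and `y + 1 ≤ y² + 2` with `y = |g| / M`. -/
lemma integral_exp_centered_le (hM : 0 < M) (hg : ∀ j, Measurable (g j))
    (hB : ∀ j x, |g j x| ≤ B)
    (hsub : ∀ j, ∫ x, Real.exp (g j x ^ 2 / M ^ 2) ∂S.μ ≤ 2) (j : Fin m) :
    ∫ x, Real.exp (|g j x - popMean S g j| / M) ∂S.μ ≤ 2 * Real.exp 2 := by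
  have hθ : popMean S g j ^ 2 ≤ M ^ 2 := by
    have h1 := popCov_diag_add_popMean_sq (S := S) hg hB j
    have h2 := integral_sq_le_of_subGaussian hM hg hB (hsub j)
    have h3 : 0 ≤ popCov S g j j := by
      rw [popCov_diag_eq]; exact integral_nonneg fun x => sq_nonneg _
    linarith
  have hθ' : |popMean S g j| ≤ M := abs_le_of_sq_le_sq hθ hM.le
  have hie := integrable_exp_sq (S := S) hM hg hB j
  calc _ ≤ ∫ x, Real.exp 2 * Real.exp (g j x ^ 2 / M ^ 2) ∂S.μ := by
        refine integral_mono_of_nonneg (ae_of_all _ fun x => (Real.exp_pos _).le)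
          (hie.const_mul _) (ae_of_all _ fun x => ?_)
        simp only [← Real.exp_add]
        refine Real.exp_le_exp.2 ?_
        have h1 : |g j x - popMean S g j| / M ≤ |g j x| / M + 1 := by
          rw [div_add_one hM.ne']
          gcongr
          exact (abs_sub _ _).trans (by linarith)
        have h2 : g j x ^ 2 / M ^ 2 = (|g j x| / M) ^ 2 := by rw [div_pow, sq_abs]
        rw [h2]
        nlinarith [sq_nonneg (|g j x| / M - 1 / 2)]
    _ ≤ _ := by
        rw [integral_const_mul, mul_comm]
        gcongr
        exact hsub j

/-- The product is at most `g_j² + g_k² + 4 M²`; dividing by `2 M²` leaves half of each sub-Gaussian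
exponent, and `exp (u/2) exp (v/2) ≤ (exp u + exp v) / 2`. -/
lemma integral_exp_centeredProd_le (hM : 0 < M) (hg : ∀ j, Measurable (g j))
    (hB : ∀ j x, |g j x| ≤ B)
    (hsub : ∀ j, ∫ x, Real.exp (g j x ^ 2 / M ^ 2) ∂S.μ ≤ 2) (j k : Fin m) :
    ∫ x, Real.exp (|centeredProd S g j k x| / (2 * M ^ 2)) ∂S.μ ≤ 2 * Real.exp 2 := by
  have hθ : ∀ j, popCov S g j j + popMean S g j ^ 2 ≤ M ^ 2 := fun j => by
    rw [popCov_diag_add_popMean_sq hg hB j]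
    exact integral_sq_le_of_subGaussian hM hg hB (hsub j)
  have hd : ∀ j, 0 ≤ popCov S g j j := fun j => by
    rw [popCov_diag_eq]; exact integral_nonneg fun x => sq_nonneg _
  have hie := fun j => integrable_exp_sq (S := S) hM hg hB j
  have hpt : ∀ x, |centeredProd S g j k x| ≤ g j x ^ 2 + g k x ^ 2 + 4 * M ^ 2 := by
    intro x
    have h1 : |centeredProd S g j k x| ≤ ((g j x - popMean S g j) ^ 2 +
        (g k x - popMean S g k) ^ 2) / 2 + |popCov S g j k| := by
      refine (abs_sub _ _).trans ?_
      gcongr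
      rw [abs_le]
      constructor
      · nlinarith [sq_nonneg (g j x - popMean S g j + (g k x - popMean S g k))]
      · nlinarith [sq_nonneg (g j x - popMean S g j - (g k x - popMean S g k))]
    have h2 := abs_popCov_le (S := S) hg hB j k
    have h3 := hθ j
    have h4 := hθ k
    have h5 := hd j
    have h6 := hd k
    nlinarith [sq_nonneg (g j x + popMean S g j), sq_nonneg (g k x + popMean S g k)]
  calc _ ≤ ∫ x, Real.exp 2 * ((Real.exp (g j x ^ 2 / M ^ 2) + Real.exp (g k x ^ 2 / M ^ 2)) / 2)
          ∂S.μ := by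
        refine integral_mono_of_nonneg (ae_of_all _ fun x => (Real.exp_pos _).le)
          ((((hie j).add (hie k)).div_const 2).const_mul _) (ae_of_all _ fun x => ?_)
        simp only
        have h1 : |centeredProd S g j k x| / (2 * M ^ 2) ≤
            2 + (g j x ^ 2 / M ^ 2 / 2 + g k x ^ 2 / M ^ 2 / 2) := by
          calc _ ≤ (g j x ^ 2 + g k x ^ 2 + 4 * M ^ 2) / (2 * M ^ 2) := by
                gcongr; exact hpt x
            _ = _ := by field_simp; ring
        refine (Real.exp_le_exp.2 h1).trans ?_
        rw [Real.exp_add 2]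
        gcongr
        have e1 : ∀ y : ℝ, Real.exp y = Real.exp (y / 2) ^ 2 := fun y => by
          rw [sq, ← Real.exp_add]; congr 1; ring
        rw [Real.exp_add, e1 (g j x ^ 2 / M ^ 2), e1 (g k x ^ 2 / M ^ 2)]
        nlinarith [sq_nonneg (Real.exp (g j x ^ 2 / M ^ 2 / 2) - Real.exp (g k x ^ 2 / M ^ 2 / 2))]
    _ ≤ _ := by
        rw [integral_const_mul, integral_div, integral_add (hie j) (hie k), mul_comm]
        have := hsub j
        have := hsub k
        gcongr
        linarith

end SubGaussian

set_option maxHeartbeats 1600000 in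
/-- Distance of the distribution functions for sub-Gaussian witnesses. -/
theorem exists_testMax_bound_of_subGaussian {m : ℕ} (hm : 0 < m) {c₁ c₂ c : ℝ} (hc₁ : 0 < c₁)
    (hc₂ : c₂ < 1) (hc : 0 < c) : ∃ C : ℝ, 0 ≤ C ∧
    ∀ (S : TwoSample.{u}) (g : Fin m → (Fin S.d → ℝ) → ℝ) (B M : ℝ), S.Null →
      S.SizesBalanced c₁ c₂ → (∀ j, Measurable (g j)) → (∀ j x, |g j x| ≤ B) →
      spectrum ℝ (popCov S g) ⊆ Set.Ici c → 0 < M →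
      (∀ j, ∫ x, Real.exp (g j x ^ 2 / M ^ 2) ∂S.μ ≤ 2) → ∀ t,
      |S.P.real {ω | testMax S g ω ≤ t} - (stdNormal m).real {z | maxAbs z ≤ t}| ≤
        C * ((∑ j, ∫ x, |g j x| ^ 3 ∂S.μ) / √S.n) + C * (M ^ 2 * Real.log S.n / √S.n) := by
  obtain ⟨C, hC0, hC⟩ := exists_testMax_bound.{u} hm hc₁ hc₂ hc
  set κ := testRatio c₁ c₂
  have hκ : 0 < κ := testRatio_pos hc₁ hc₂
  have hm' : (0 : ℝ) < m := by exact_mod_cast hm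
  set C₀ := 2 * Real.exp 2
  have hC₀ : 0 < C₀ := by positivity
  have hC₀1 : 1 ≤ C₀ := by
    have := Real.one_le_exp (by norm_num : (0 : ℝ) ≤ 2)
    simp only [C₀]; linarith
  -- Chosen so that the Bernstein exponent at `r = A √(log n / n)` is at least `log n` when the test
  -- part has at least `κ n` observations.
  set A := √(32 * C₀ / κ) with hA
  have hA0 : 0 < A := Real.sqrt_pos.2 (by positivity)
  have hA2 : A ^ 2 = 32 * C₀ / κ := Real.sq_sqrt (by positivity)
  have hlog2 : 0 < Real.log 2 := Real.log_pos (by norm_num)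
  set l2 := √(Real.log 2) with hl2
  have hl2pos : 0 < l2 := Real.sqrt_pos.2 hlog2
  set τ := l2 * c / (6 * m * A) with hτ
  have hτ0 : 0 < τ := by positivity
  set D := (4 * (m ^ 2 + m) + 2 * m) / (c * Real.log 2) + C * (6 * A) with hD
  have hD0 : 0 ≤ D := by positivity
  refine ⟨8 * C + D + 1 / τ, by positivity, fun S g B M h0 hS hg hB hspec hM hsub t => ?_⟩
  have hn2 := hS.two_le_n hc₁ hc₂
  have hn2' : (2 : ℝ) ≤ S.n := by exact_mod_cast hn2
  have hn : (0 : ℝ) < S.n := by linarith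
  have hsn : 0 < √(S.n : ℝ) := Real.sqrt_pos.2 hn
  have hlogn2 : Real.log 2 ≤ Real.log S.n := Real.log_le_log (by norm_num) hn2'
  have hlogn : 0 < Real.log S.n := hlog2.trans_le hlogn2
  set Q := M ^ 2 * Real.log S.n / √S.n with hQ
  have hQ0 : 0 ≤ Q := by positivity
  have hG0 : 0 ≤ (∑ j, ∫ x, |g j x| ^ 3 ∂S.μ) / √S.n := by
    refine div_nonneg (Finset.sum_nonneg fun j _ => integral_nonneg fun x => ?_) hsn.le
    simp only
    positivity
  -- If `Q` is not small, the distance is at most `1 ≤ Q / τ`. Otherwise `Q < τ` forces `M² r ≤ c /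
  -- (6m)`, which makes the perturbation bounds applicable.
  rcases le_or_gt τ Q with hQτ | hQτ
  · have h1 : 1 ≤ 1 / τ * Q := by
      rw [one_div, ← div_eq_inv_mul, one_le_div hτ0]; exact hQτ
    have h2 : 0 ≤ (8 * C + D) * Q := by positivity
    have h3 : 0 ≤ (8 * C + D + 1 / τ) * ((∑ j, ∫ x, |g j x| ^ 3 ∂S.μ) / √S.n) :=
      mul_nonneg (by positivity) hG0
    refine (abs_real_sub_real_le_one _ _ _ _).trans ?_
    linarith
  obtain ⟨ha, hb⟩ := hS.le_nTest hc₁ hc₂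
  have hq : 0 < κ * S.n := by positivity
  have ha0 : 0 < S.nxTest := by exact_mod_cast hq.trans_le ha
  have hb0 : 0 < S.nyTest := by exact_mod_cast hq.trans_le hb
  -- `M²` bounds a second moment and hence a variance, which is at least `c`. This lower bound
  -- yields `r ≤ 1` and lets `Q` absorb the `1 / n` terms.
  have hMc : c ≤ M ^ 2 := by
    have h1 := le_popCov_diag hspec ⟨0, hm⟩
    have h2 := popCov_diag_add_popMean_sq (S := S) hg hB ⟨0, hm⟩
    have h3 := integral_sq_le_of_subGaussian hM hg hB (hsub ⟨0, hm⟩)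
    nlinarith [sq_nonneg (popMean S g ⟨0, hm⟩)]
  set ln := √(Real.log S.n) with hln
  have hlnpos : 0 < ln := Real.sqrt_pos.2 hlogn
  have hln2 : ln ^ 2 = Real.log S.n := Real.sq_sqrt hlogn.le
  have hl2ln : l2 ≤ ln := Real.sqrt_le_sqrt hlogn2
  set r := A * (ln / √S.n) with hr
  have hr0 : 0 ≤ r := by positivity
  have hMr : M ^ 2 * r ≤ c / (6 * m) := by
    have h1 : M ^ 2 * r * l2 ≤ A * Q := by
      have : M ^ 2 * r * l2 = A * (M ^ 2 * (ln * l2) / √S.n) := by rw [hr]; ring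
      rw [this, hQ, ← hln2]
      gcongr
      nlinarith
    have h2 : A * Q ≤ A * τ := by gcongr
    have h3 : A * τ = c / (6 * m) * l2 := by rw [hτ]; field_simp
    rw [h3] at h2
    exact le_of_mul_le_mul_right (h1.trans h2) hl2pos
  have hm1 : (1 : ℝ) ≤ m := by exact_mod_cast hm
  have hr1 : r ≤ 1 := by
    have h1 : c * r ≤ c / (6 * m) := (mul_le_mul_of_nonneg_right hMc hr0).trans hMr
    have h2 : c / (6 * m) ≤ c := div_le_self hc.le (by linarith)
    have h3 : c * r ≤ c * 1 := by linarith
    exact le_of_mul_le_mul_left h3 hc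
  -- The products deviate by at most `2 M² r` and the means by at most `M r` outside the bad event;
  -- `r ≤ 1` gives `2 M² r + (M r)² ≤ 3 M² r`.
  set δ := 3 * (M ^ 2 * r) with hδ
  have hδ0 : 0 ≤ δ := by positivity
  have hmδ : m * δ ≤ c / 2 := by
    calc m * δ ≤ m * (3 * (c / (6 * m))) := by rw [hδ]; gcongr
      _ = c / 2 := by field_simp; ring
  -- Makes `exp (-R² / 2) = 1 / n`, while `δ R` remains a constant multiple of `Q`.
  set R := √2 * ln with hR
  have hR0 : 0 ≤ R := by positivity
  have hR2 : R ^ 2 / 2 = Real.log S.n := by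
    rw [hR, mul_pow, hln2, Real.sq_sqrt (by norm_num)]; ring
  have hexpn : Real.exp (-Real.log S.n) = 1 / S.n := by
    rw [Real.exp_neg, Real.exp_log hn, one_div]
  have hmain := hC S g B δ R h0 hS hg hB hspec hδ0 hmδ hR0 t
  have htail := one_sub_stdNormal_box_le m hR0
  rw [hR2, hexpn] at htail
  have hcard : ∀ s ∈ ({testX S, testY S} : Set (Finset (Fin S.nx ⊕ Fin S.ny))),
      κ * S.n ≤ (s.card : ℝ) := by
    intro s hs
    rcases hs with rfl | rfl
    · rw [card_testX]; exact ha
    · rw [card_testY]; exact hb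
  have hexp : ∀ s ∈ ({testX S, testY S} : Set (Finset (Fin S.nx ⊕ Fin S.ny))),
      2 * Real.exp (-(s.card * r ^ 2 / (32 * C₀))) ≤ 2 * (1 / S.n) := by
    intro s hs
    rw [← hexpn]
    gcongr
    have h1 : Real.log S.n = κ * S.n * r ^ 2 / (32 * C₀) := by
      rw [hr, mul_pow, hA2, div_pow, hln2, Real.sq_sqrt hn.le]
      field_simp
    rw [h1]
    gcongr
    exact hcard s hs
  have hrC : r ≤ 8 * C₀ := by linarith
  have hbad : S.P.real {ω | ∃ j k, δ < |testCov S g ω j k - popCov S g j k|} ≤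
      2 * (m ^ 2 + m) * (2 * (1 / S.n)) := by
    refine real_testCov_sub_popCov_le ha0 hb0 (δ' := 2 * M ^ 2 * r) (r := M * r) (by positivity)
      ?_ (fun s hs j k => ?_) (fun s hs j => ?_)
    · have h1 : r ^ 2 ≤ r := by nlinarith
      have h2 : M ^ 2 * r ^ 2 ≤ M ^ 2 * r := by gcongr
      rw [hδ, mul_pow]
      linarith
    · have hsc : (0 : ℝ) < s.card := hq.trans_le (hcard s hs)
      exact (obsAvg_bernstein h0 (measurable_centeredProd hg j k) (abs_centeredProd_le hB j k)
        (integral_centeredProd hg hB j k) (by positivity) hC₀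
        (integral_exp_centeredProd_le hM hg hB hsub j k) hr0 hrC
        (by exact_mod_cast hsc)).trans (hexp s hs)
    · have hsc : (0 : ℝ) < s.card := hq.trans_le (hcard s hs)
      exact (obsAvg_bernstein h0 ((hg j).sub_const _) (abs_sub_popMean_le hB j)
        (integral_centered hg hB j) hM hC₀ (integral_exp_centered_le hM hg hB hsub j) hr0 hrC
        (by exact_mod_cast hsc)).trans (hexp s hs)
  have hcube : C * (popCube S g / √S.n) ≤
      8 * C * ((∑ j, ∫ x, |g j x| ^ 3 ∂S.μ) / √S.n) := by
    calc _ ≤ C * ((8 * ∑ j, ∫ x, |g j x| ^ 3 ∂S.μ) / √S.n) := by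
          gcongr; exact popCube_le hg hB
      _ = _ := by ring
  have hδR : C * (δ * R) ≤ C * (6 * A) * Q := by
    have h2 : √2 ≤ 2 := by
      rw [Real.sqrt_le_left (by norm_num)]; norm_num
    have e : δ * R = 3 * √2 * A * Q := by
      rw [hδ, hR, hr, hQ, ← hln2]; ring
    calc C * (δ * R) = C * (3 * √2 * A * Q) := by rw [e]
      _ ≤ C * (3 * 2 * A * Q) := by gcongr
      _ = _ := by ring
  have hninv : 1 / (S.n : ℝ) ≤ 1 / (c * Real.log 2) * Q := by
    have h1 : 1 / (S.n : ℝ) ≤ 1 / √S.n := by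
      gcongr
      rw [Real.sqrt_le_left hn.le]
      nlinarith
    have h2 : c * Real.log 2 / √S.n ≤ Q := by
      rw [hQ]; gcongr
    calc 1 / (S.n : ℝ) ≤ 1 / √S.n := h1
      _ = 1 / (c * Real.log 2) * (c * Real.log 2 / √S.n) := by field_simp
      _ ≤ _ := by gcongr
  have hconst : (4 * (m ^ 2 + m) + 2 * m) * (1 / (S.n : ℝ)) ≤
      (4 * (m ^ 2 + m) + 2 * m) / (c * Real.log 2) * Q := by
    calc _ ≤ (4 * (m ^ 2 + m) + 2 * m) * (1 / (c * Real.log 2) * Q) := by gcongr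
      _ = _ := by ring
  have hDQ : D * Q = (4 * (m ^ 2 + m) + 2 * m) / (c * Real.log 2) * Q + C * (6 * A) * Q := by
    rw [hD]; ring
  have hfin1 : 0 ≤ (8 * C + 1 / τ) * Q := by positivity
  have hfin2 : 0 ≤ (D + 1 / τ) * ((∑ j, ∫ x, |g j x| ^ 3 ∂S.μ) / √S.n) :=
    mul_nonneg (by positivity) hG0
  linarith

/-! ### Independence of fitting and test data; conditioning by Fubini. -/

section SampleSplitting

variable (S : TwoSample.{u})

/-- The indices of the test observations. -/
def TwoSample.testIdx : Finset (Fin S.nx ⊕ Fin S.ny) := S.fitXᶜ.disjSum S.fitYᶜ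

/-- The sample space with the σ-algebra generated by the test observations. -/
def TwoSample.TestSpace : Type u := S.Ω

/-- The test data are modelled as the identity map into `Ω` with a smaller σ-algebra, so statistics
of the test data are still functions of `ω`, and independence of `S.toTest` is independence of this
σ-algebra. -/
instance : MeasurableSpace S.TestSpace :=
  ⨆ i ∈ (S.testIdx : Set (Fin S.nx ⊕ Fin S.ny)), MeasurableSpace.comap (S.obs i) inferInstance

/-- The identity of the sample space, as a map to `S.TestSpace`. -/
def TwoSample.toTest (ω : S.Ω) : S.TestSpace := ω

variable {S}

lemma measurable_obs_test {i : Fin S.nx ⊕ Fin S.ny} (hi : i ∈ S.testIdx) :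
    Measurable fun ω : S.TestSpace => S.obs i ω :=
  Measurable.of_comap_le (le_iSup₂_of_le i hi le_rfl)

lemma measurable_toTest : Measurable S.toTest := by
  intro A hA
  have hle : (inferInstance : MeasurableSpace S.TestSpace) ≤ S.mΩ :=
    iSup₂_le fun i _ => (measurable_obs i).comap_le
  exact hle A hA

lemma measurable_fitData : Measurable S.fitData :=
  Measurable.prodMk (f := fun ω (i : S.fitX) => S.X i ω) (g := fun ω (i : S.fitY) => S.Y i ω)
    (measurable_pi_lambda _ fun i => S.measurable_X i)
    (measurable_pi_lambda _ fun i => S.measurable_Y i)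

/-- The fitting data and the test observations are independent. -/
lemma indepFun_fitData_toTest : IndepFun S.fitData S.toTest S.P := by
  have h1 : iIndep (fun i => MeasurableSpace.comap (S.obs i) inferInstance) S.P := S.indep
  have h2 := indep_iSup_of_disjoint (fun i => (measurable_obs (S := S) i).comap_le) h1
    (S := ((S.testIdx : Set (Fin S.nx ⊕ Fin S.ny))ᶜ)) (T := S.testIdx) disjoint_compl_left
  refine indep_of_indep_of_le_left (indep_of_indep_of_le_right h2 ?_) ?_
  · rintro A ⟨A', hA', rfl⟩
    exact hA'
  · have hobs : ∀ i ∉ S.testIdx, MeasurableSpace.comap (S.obs i) inferInstance ≤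
        ⨆ i ∈ ((S.testIdx : Set (Fin S.nx ⊕ Fin S.ny))ᶜ),
          MeasurableSpace.comap (S.obs i) inferInstance := fun i hi =>
      le_iSup₂_of_le (f := fun i (_ : i ∈ ((S.testIdx : Set (Fin S.nx ⊕ Fin S.ny))ᶜ)) =>
        MeasurableSpace.comap (S.obs i) inferInstance) i (by simpa using hi) le_rfl
    have hX : ∀ i : S.fitX, Measurable[⨆ i ∈ ((S.testIdx : Set (Fin S.nx ⊕ Fin S.ny))ᶜ),
        MeasurableSpace.comap (S.obs i) inferInstance] (S.X i) := fun i =>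
      measurable_iff_comap_le.2 (hobs (Sum.inl i) (by simp [TwoSample.testIdx]))
    have hY : ∀ i : S.fitY, Measurable[⨆ i ∈ ((S.testIdx : Set (Fin S.nx ⊕ Fin S.ny))ᶜ),
        MeasurableSpace.comap (S.obs i) inferInstance] (S.Y i) := fun i =>
      measurable_iff_comap_le.2 (hobs (Sum.inr i) (by simp [TwoSample.testIdx]))
    exact ((@measurable_pi_lambda _ _ _ (_) _ _ hX).prodMk
      (@measurable_pi_lambda _ _ _ (_) _ _ hY)).comap_le

lemma map_fitData_toTest : S.P.map (fun ω => (S.fitData ω, S.toTest ω)) =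
    (S.P.map S.fitData).prod (S.P.map S.toTest) :=
  (indepFun_iff_map_prod_eq_prod_map_map measurable_fitData.aemeasurable
    measurable_toTest.aemeasurable).1 indepFun_fitData_toTest

instance : IsProbabilityMeasure (S.P.map S.fitData) :=
  Measure.isProbabilityMeasure_map measurable_fitData.aemeasurable

instance : IsProbabilityMeasure (S.P.map S.toTest) :=
  Measure.isProbabilityMeasure_map measurable_toTest.aemeasurable

variable {F : S.FitSpace → S.TestSpace → ℝ} {K : ℝ}

lemma integral_toTest (hF : Measurable (Function.uncurry F)) (z : S.FitSpace) :
    ∫ ω, F z (S.toTest ω) ∂S.P = ∫ ω, F z ω ∂(S.P.map S.toTest) :=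
  (integral_map measurable_toTest.aemeasurable
    (hF.comp measurable_prodMk_left).aestronglyMeasurable).symm

lemma measurable_integral_toTest (hF : Measurable (Function.uncurry F)) :
    Measurable fun z => ∫ ω, F z (S.toTest ω) ∂S.P := by
  simp_rw [integral_toTest hF]
  exact (hF.stronglyMeasurable.integral_prod_right).measurable

/-- Fubini's theorem for the fitting data and the test observations. -/
lemma integral_fitData_toTest (hF : Measurable (Function.uncurry F)) (hK : ∀ z ω, |F z ω| ≤ K) :
    ∫ ω, F (S.fitData ω) (S.toTest ω) ∂S.P =
      ∫ ω, ∫ ω', F (S.fitData ω) (S.toTest ω') ∂S.P ∂S.P := by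
  have h1 : ∫ ω, F (S.fitData ω) (S.toTest ω) ∂S.P =
      ∫ p, Function.uncurry F p ∂(S.P.map fun ω => (S.fitData ω, S.toTest ω)) :=
    (integral_map (measurable_fitData.prodMk measurable_toTest).aemeasurable
      hF.aestronglyMeasurable).symm
  have h2 : ∫ ω, ∫ ω', F (S.fitData ω) (S.toTest ω') ∂S.P ∂S.P =
      ∫ z, ∫ ω', F z (S.toTest ω') ∂S.P ∂(S.P.map S.fitData) :=
    (integral_map measurable_fitData.aemeasurable
      (measurable_integral_toTest hF).aestronglyMeasurable).symm
  rw [h1, h2, map_fitData_toTest,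
    integral_prod _ (integrable_of_abs_le hF fun p => hK p.1 p.2)]
  simp_rw [integral_toTest hF]
  rfl

/-- The conditional expectation given the fitting data of a function of the fitting data and the
test observations. -/
lemma condExp_fitData_toTest (hF : Measurable (Function.uncurry F)) (hK : ∀ z ω, |F z ω| ≤ K) :
    S.P[fun ω => F (S.fitData ω) (S.toTest ω) | S.fitAlgebra] =ᵐ[S.P]
      fun ω => ∫ ω', F (S.fitData ω) (S.toTest ω') ∂S.P := by
  have hle : S.fitAlgebra ≤ S.mΩ := measurable_fitData.comap_le
  have hm1 : Measurable fun ω => F (S.fitData ω) (S.toTest ω) :=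
    hF.comp (measurable_fitData.prodMk measurable_toTest)
  have hm2 := measurable_integral_toTest hF
  have hb2 : ∀ z, |∫ ω', F z (S.toTest ω') ∂S.P| ≤ K := fun z =>
    abs_integral_le_of_abs_le fun ω => hK z _
  have hi2 : Integrable (fun ω => ∫ ω', F (S.fitData ω) (S.toTest ω') ∂S.P) S.P :=
    integrable_of_abs_le (hm2.comp measurable_fitData) fun ω => hb2 _
  refine (ae_eq_condExp_of_forall_setIntegral_eq hle
    (integrable_of_abs_le hm1 fun ω => hK _ _) (fun s _ _ => hi2.integrableOn) ?_ ?_).symm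
  · rintro s ⟨A, hA, rfl⟩ -
    have hs : MeasurableSet (S.fitData ⁻¹' A) := measurable_fitData hA
    rw [← integral_indicator hs, ← integral_indicator hs]
    have hG : Measurable (Function.uncurry fun z ω => A.indicator (fun z => F z ω) z) := by
      have : (Function.uncurry fun z (ω : S.TestSpace) => A.indicator (fun z => F z ω) z) =
          (Prod.fst ⁻¹' A).indicator (Function.uncurry F) := by
        ext ⟨z, ω⟩
        by_cases hz : z ∈ A <;> simp [hz]
      rw [this]
      exact hF.indicator (measurable_fst hA)
    have hGK : ∀ z ω, |A.indicator (fun z => F z ω) z| ≤ K := by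
      intro z ω
      by_cases hz : z ∈ A
      · simpa [hz] using hK z ω
      · simpa [hz] using (abs_nonneg _).trans (hK z ω)
    have key := integral_fitData_toTest hG hGK
    have e1 : ∀ ω, (S.fitData ⁻¹' A).indicator
        (fun ω => ∫ ω', F (S.fitData ω) (S.toTest ω') ∂S.P) ω =
        ∫ ω', A.indicator (fun z => F z (S.toTest ω')) (S.fitData ω) ∂S.P := by
      intro ω
      by_cases hz : S.fitData ω ∈ A <;> simp [hz]
    have e2 : ∀ ω, (S.fitData ⁻¹' A).indicator (fun ω => F (S.fitData ω) (S.toTest ω)) ω =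
        A.indicator (fun z => F z (S.toTest ω)) (S.fitData ω) := by
      intro ω
      by_cases hz : S.fitData ω ∈ A <;> simp [hz]
    simp_rw [e1, e2]
    exact key.symm
  · exact (hm2.comp (comap_measurable S.fitData)).aestronglyMeasurable

end SampleSplitting

/-! ### Mean and covariance of the scaled statistic. -/

section StatMoments

variable {m : ℕ} {S : TwoSample.{u}} {g : Fin m → (Fin S.d → ℝ) → ℝ} {B : ℝ}

lemma scale_mul_testStat (ha : 0 < S.nxTest) (hb : 0 < S.nyTest) (ω : S.Ω) (θ : Fin m → ℝ)
    (j : Fin m) : Learner.scale S * testStat S g ω j =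
      ∑ i ∈ S.testIdx, testWeight S i * (g j (S.obs i ω) - θ j) := by
  have := congrFun (scale_smul_testStat (g := g) θ ha hb ω) j
  rw [Finset.sum_apply] at this
  exact this

lemma abs_scale_mul_testStat_le (hB : ∀ j x, |g j x| ≤ B) (ha : 0 < S.nxTest)
    (hb : 0 < S.nyTest) (ω : S.Ω) (j : Fin m) :
    |Learner.scale S * testStat S g ω j| ≤ ∑ i ∈ S.testIdx, |testWeight S i| * B := by
  rw [scale_mul_testStat ha hb ω 0]
  refine (Finset.abs_sum_le_sum_abs _ _).trans (Finset.sum_le_sum fun i _ => ?_)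
  rw [abs_mul, Pi.zero_apply, sub_zero]
  exact mul_le_mul_of_nonneg_left (hB j _) (abs_nonneg _)

lemma integrable_obs_centered (hg : ∀ j, Measurable (g j)) (hB : ∀ j x, |g j x| ≤ B)
    (i : Fin S.nx ⊕ Fin S.ny) (j : Fin m) :
    Integrable (fun ω => g j (S.obs i ω) - popMean S g j) S.P :=
  integrable_of_abs_le (((hg j).comp (measurable_obs i)).sub_const _)
    fun _ => abs_sub_popMean_le hB j _

lemma integral_obs_centered (h0 : S.Null) (hg : ∀ j, Measurable (g j))
    (hB : ∀ j x, |g j x| ≤ B) (i : Fin S.nx ⊕ Fin S.ny) (j : Fin m) :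
    ∫ ω, (g j (S.obs i ω) - popMean S g j) ∂S.P = 0 := by
  rw [integral_obs_comp h0 (F := fun x => g j x - popMean S g j) ((hg j).sub_const _) i,
    integral_centered hg hB]

lemma integral_scale_mul_testStat (h0 : S.Null) (ha : 0 < S.nxTest) (hb : 0 < S.nyTest)
    (hg : ∀ j, Measurable (g j)) (hB : ∀ j x, |g j x| ≤ B) (j : Fin m) :
    ∫ ω, Learner.scale S * testStat S g ω j ∂S.P = 0 := by
  simp_rw [scale_mul_testStat ha hb _ (popMean S g)]
  rw [integral_finsetSum _ fun i _ => (integrable_obs_centered hg hB i j).const_mul _]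
  simp [integral_const_mul, integral_obs_centered h0 hg hB]

/-- The covariance matrix of the scaled differences of test means. -/
lemma integral_scale_mul_testStat_mul (h0 : S.Null) (ha : 0 < S.nxTest) (hb : 0 < S.nyTest)
    (hg : ∀ j, Measurable (g j)) (hB : ∀ j x, |g j x| ≤ B) (j k : Fin m) :
    ∫ ω, (Learner.scale S * testStat S g ω j) * (Learner.scale S * testStat S g ω k) ∂S.P =
      popCov S g j k := by
  have hi : ∀ i l, Integrable (fun ω => testWeight S i * testWeight S l *
      ((g j (S.obs i ω) - popMean S g j) * (g k (S.obs l ω) - popMean S g k))) S.P := fun i l =>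
    (integrable_mul_of_abs_le (integrable_obs_centered hg hB i j)
      (((hg k).comp (measurable_obs l)).sub_const _) fun _ => abs_sub_popMean_le hB k _).const_mul _
  have e : ∀ ω, (Learner.scale S * testStat S g ω j) * (Learner.scale S * testStat S g ω k) =
      ∑ i ∈ S.testIdx, ∑ l ∈ S.testIdx, testWeight S i * testWeight S l *
        ((g j (S.obs i ω) - popMean S g j) * (g k (S.obs l ω) - popMean S g k)) := by
    intro ω
    rw [scale_mul_testStat ha hb _ (popMean S g), scale_mul_testStat ha hb _ (popMean S g),
      Finset.sum_mul_sum]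
    exact Finset.sum_congr rfl fun i _ => Finset.sum_congr rfl fun l _ => by ring
  -- Independence and centering kill the off-diagonal terms. Under the null all diagonal terms equal
  -- `popCov`, and the squared weights add up to `1`.
  have hval : ∀ i l, ∫ ω, (g j (S.obs i ω) - popMean S g j) * (g k (S.obs l ω) - popMean S g k) ∂S.P
      = if i = l then popCov S g j k else 0 := by
    intro i l
    split_ifs with hil
    · subst hil
      exact integral_obs_comp h0 (F := fun x => (g j x - popMean S g j) * (g k x - popMean S g k))
        (((hg j).sub_const _).mul ((hg k).sub_const _)) i
    · have hind : IndepFun (fun ω => g j (S.obs i ω) - popMean S g j)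
          (fun ω => g k (S.obs l ω) - popMean S g k) S.P :=
        (S.indep.indepFun hil).comp (φ := fun x => g j x - popMean S g j)
          (ψ := fun x => g k x - popMean S g k) ((hg j).sub_const _) ((hg k).sub_const _)
      rw [hind.integral_fun_mul_eq_mul_integral
        (integrable_obs_centered hg hB i j).aestronglyMeasurable
        (integrable_obs_centered hg hB l k).aestronglyMeasurable,
        integral_obs_centered h0 hg hB, zero_mul]
  simp_rw [e]
  rw [integral_finsetSum _ fun i _ => integrable_finsetSum _ fun l _ => hi i l]
  have e2 : ∀ i ∈ S.testIdx, ∫ ω, ∑ l ∈ S.testIdx, testWeight S i * testWeight S l *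
        ((g j (S.obs i ω) - popMean S g j) * (g k (S.obs l ω) - popMean S g k)) ∂S.P =
      testWeight S i ^ 2 * popCov S g j k := by
    intro i his
    rw [integral_finsetSum _ fun l _ => hi i l]
    simp_rw [integral_const_mul, hval]
    simp [his, sq]
  rw [Finset.sum_congr rfl e2, ← Finset.sum_mul]
  have := sum_testWeight_sq ha hb
  rw [show ∑ i ∈ S.testIdx, testWeight S i ^ 2 = 1 from this, one_mul]

end StatMoments

/-! ### Learned witnesses: measurability and conditioning on the fitting data. -/

section Witness

variable {m : ℕ} {S : TwoSample.{u}} (L : Learner S m)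

/-- The witnesses learned from the fitting data `z`. -/
def Learner.witness (z : S.FitSpace) (j : Fin m) (x : Fin S.d → ℝ) : ℝ :=
  L.f j z ((L.U j z)ᵀ *ᵥ x)

lemma Learner.maxStat_eq (ω : S.Ω) :
    L.maxStat ω = testMax S (L.witness (S.fitData ω)) (S.toTest ω) := rfl

lemma Learner.measurable_witness_apply (z : S.FitSpace) (j : Fin m) : Measurable (L.witness z j) :=
  (L.measurable_witness j).comp measurable_prodMk_left

lemma Learner.abs_witness_le (z : S.FitSpace) (j : Fin m) (x : Fin S.d → ℝ) :
    |L.witness z j x| ≤ L.B j := by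
  obtain ⟨-, θ, -, -, -, h⟩ := L.f_mem j z
  exact h _

lemma Learner.B_nonneg (j : Fin m) : 0 ≤ L.B j :=
  (abs_nonneg _).trans (L.abs_witness_le (0, 0) j 0)

lemma Learner.abs_witness_le_sum (z : S.FitSpace) (j : Fin m) (x : Fin S.d → ℝ) :
    |L.witness z j x| ≤ ∑ k, L.B k :=
  (L.abs_witness_le z j x).trans
    (Finset.single_le_sum (fun k _ => L.B_nonneg k) (Finset.mem_univ j))

lemma Learner.measurable_witness_obs (j : Fin m) {i : Fin S.nx ⊕ Fin S.ny} (hi : i ∈ S.testIdx) :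
    Measurable fun p : S.FitSpace × S.TestSpace => L.witness p.1 j (S.obs i p.2) :=
  (L.measurable_witness j).comp
    (measurable_fst.prodMk ((measurable_obs_test hi).comp measurable_snd))

lemma Learner.measurable_testMeanX (j : Fin m) :
    Measurable fun p : S.FitSpace × S.TestSpace => testMeanX S (L.witness p.1) j p.2 :=
  (Finset.measurable_sum _ fun i hi => L.measurable_witness_obs j (i := Sum.inl i)
    (Finset.inl_mem_disjSum.2 hi)).const_mul _

lemma Learner.measurable_testMeanY (j : Fin m) :
    Measurable fun p : S.FitSpace × S.TestSpace => testMeanY S (L.witness p.1) j p.2 :=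
  (Finset.measurable_sum _ fun i hi => L.measurable_witness_obs j (i := Sum.inr i)
    (Finset.inr_mem_disjSum.2 hi)).const_mul _

lemma Learner.measurable_testStat (j : Fin m) :
    Measurable fun p : S.FitSpace × S.TestSpace => testStat S (L.witness p.1) p.2 j :=
  (L.measurable_testMeanX j).sub (L.measurable_testMeanY j)

lemma Learner.measurable_testCov (j k : Fin m) :
    Measurable fun p : S.FitSpace × S.TestSpace => testCov S (L.witness p.1) p.2 j k := by
  simp only [testCov, Matrix.of_apply]
  refine Measurable.add (Measurable.const_mul (Measurable.const_mul
    (Finset.measurable_sum _ fun i hi => ?_) _) _) (Measurable.const_mul (Measurable.const_mul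
    (Finset.measurable_sum _ fun i hi => ?_) _) _)
  · have hi' : Sum.inl i ∈ S.testIdx := Finset.inl_mem_disjSum.2 hi
    exact ((L.measurable_witness_obs j hi').sub (L.measurable_testMeanX j)).mul
      ((L.measurable_witness_obs k hi').sub (L.measurable_testMeanX k))
  · have hi' : Sum.inr i ∈ S.testIdx := Finset.inr_mem_disjSum.2 hi
    exact ((L.measurable_witness_obs j hi').sub (L.measurable_testMeanY j)).mul
      ((L.measurable_witness_obs k hi').sub (L.measurable_testMeanY k))

lemma measurable_maxAbs (hm : 0 < m) : Measurable (maxAbs : (Fin m → ℝ) → ℝ) := by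
  refine measurable_of_Iic fun t => ?_
  have : (maxAbs : (Fin m → ℝ) → ℝ) ⁻¹' Set.Iic t = Set.Icc (fun _ => -t) fun _ => t := by
    ext z
    exact maxAbs_le_iff hm z t
  rw [this]
  exact measurableSet_Icc

lemma Learner.measurable_invSqrt_testCov (i j : Fin m) :
    Measurable fun p : S.FitSpace × S.TestSpace =>
      Learner.invSqrt (testCov S (L.witness p.1) p.2) i j :=
  measurable_invSqrt_apply (A := fun p : S.FitSpace × S.TestSpace =>
    testCov S (L.witness p.1) p.2) (fun p => isHermitian_testCov S (L.witness p.1) p.2)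
    L.measurable_testCov i j

lemma Learner.measurable_testMax (hm : 0 < m) :
    Measurable fun p : S.FitSpace × S.TestSpace => testMax S (L.witness p.1) p.2 := by
  have h : Measurable fun (p : S.FitSpace × S.TestSpace) (i : Fin m) =>
      ∑ j, Learner.invSqrt (testCov S (L.witness p.1) p.2) i j *
        (Learner.scale S * testStat S (L.witness p.1) p.2 j) :=
    measurable_pi_lambda _ fun i => Finset.measurable_sum _ fun j _ =>
      (L.measurable_invSqrt_testCov i j).mul ((L.measurable_testStat j).const_mul _)
  have e : ∀ p : S.FitSpace × S.TestSpace, testMax S (L.witness p.1) p.2 =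
      maxAbs fun i => ∑ j, Learner.invSqrt (testCov S (L.witness p.1) p.2) i j *
        (Learner.scale S * testStat S (L.witness p.1) p.2 j) := fun p =>
    testMax_eq_maxAbs (S := S) p.2
  simp_rw [e]
  exact (measurable_maxAbs hm).comp h

lemma Learner.measurable_maxStat (hm : 0 < m) : Measurable L.maxStat := by
  have h : Measurable fun ω => (S.fitData ω, S.toTest ω) :=
    measurable_fitData.prodMk measurable_toTest
  have h1 := (L.measurable_testMax hm).comp h
  have e : L.maxStat = fun ω => testMax S (L.witness (S.fitData ω)) (S.toTest ω) :=
    funext L.maxStat_eq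
  rw [e]
  exact h1

/-- Under the null hypothesis, the conditional covariance matrix of the scaled statistics is the
population covariance matrix of the learned witnesses. -/
lemma Learner.condCov_ae_eq (h0 : S.Null) (ha : 0 < S.nxTest) (hb : 0 < S.nyTest) :
    ∀ᵐ ω ∂S.P, L.condCov ω = popCov S (L.witness (S.fitData ω)) := by
  set K := ∑ i ∈ S.testIdx, |testWeight S i| * ∑ k, L.B k
  have hK : ∀ z (ω : S.TestSpace) j, |Learner.scale S * testStat S (L.witness z) ω j| ≤ K :=
    fun z ω j => abs_scale_mul_testStat_le (L.abs_witness_le_sum z) ha hb ω j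
  have hF : ∀ j, Measurable (Function.uncurry fun z (ω : S.TestSpace) =>
      Learner.scale S * testStat S (L.witness z) ω j) := fun j =>
    (L.measurable_testStat j).const_mul _
  -- Under the null the conditional means vanish, so the conditional covariance is a conditional
  -- second moment.
  have hmean : ∀ j, S.P[fun η => Learner.scale S * L.stat η j | S.fitAlgebra] =ᵐ[S.P] 0 := by
    intro j
    refine (condExp_fitData_toTest (hF j) fun z ω => hK z ω j).trans (ae_of_all _ fun ω => ?_)
    exact integral_scale_mul_testStat h0 ha hb (L.measurable_witness_apply _)
      (L.abs_witness_le_sum _) j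
  have hjk : ∀ j k, ∀ᵐ ω ∂S.P, L.condCov ω j k = popCov S (L.witness (S.fitData ω)) j k := by
    intro j k
    have h1 : (fun ω' =>
      (Learner.scale S * L.stat ω' j -
        (S.P[fun η => Learner.scale S * L.stat η j | S.fitAlgebra]) ω') *
      (Learner.scale S * L.stat ω' k -
        (S.P[fun η => Learner.scale S * L.stat η k | S.fitAlgebra]) ω')) =ᵐ[S.P]
        fun ω' => (Learner.scale S * L.stat ω' j) * (Learner.scale S * L.stat ω' k) := by
      filter_upwards [hmean j, hmean k] with ω h2 h3
      simp [h2, h3]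
    have h4 := condExp_fitData_toTest (S := S) (F := fun z ω =>
      (Learner.scale S * testStat S (L.witness z) ω j) *
        (Learner.scale S * testStat S (L.witness z) ω k)) ((hF j).mul (hF k)) (K := K * K)
        fun z ω => by
      rw [abs_mul]
      exact mul_le_mul (hK z ω j) (hK z ω k) (abs_nonneg _) ((abs_nonneg _).trans (hK z ω j))
    filter_upwards [(condExp_congr_ae h1).trans h4] with ω hω
    refine Eq.trans hω ?_
    exact integral_scale_mul_testStat_mul h0 ha hb (L.measurable_witness_apply _)
      (L.abs_witness_le_sum _) j k
  filter_upwards [ae_all_iff.2 fun j => ae_all_iff.2 fun k => hjk j k] with ω hω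
  ext j k
  exact hω j k

lemma Learner.measurableSet_testMax_le (hm : 0 < m) (t : ℝ) :
    MeasurableSet {p : S.FitSpace × S.TestSpace | testMax S (L.witness p.1) p.2 ≤ t} :=
  L.measurable_testMax hm measurableSet_Iic

/-- The indicator function of the event that the max statistic is at most `t`. -/
def Learner.maxIndicator (t : ℝ) (z : S.FitSpace) (ω : S.TestSpace) : ℝ :=
  {p : S.FitSpace × S.TestSpace | testMax S (L.witness p.1) p.2 ≤ t}.indicator 1 (z, ω)

lemma Learner.measurable_maxIndicator (hm : 0 < m) (t : ℝ) :
    Measurable (Function.uncurry (L.maxIndicator t)) :=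
  measurable_one.indicator (L.measurableSet_testMax_le hm t)

lemma Learner.integral_maxIndicator (hm : 0 < m) (t : ℝ) (z : S.FitSpace) :
    ∫ ω, L.maxIndicator t z (S.toTest ω) ∂S.P =
      S.P.real {ω | testMax S (L.witness z) ω ≤ t} := by
  have hs : MeasurableSet {ω : S.Ω | testMax S (L.witness z) ω ≤ t} :=
    measurable_toTest (measurable_prodMk_left (L.measurableSet_testMax_le hm t))
  exact integral_indicator_one hs

lemma Learner.measurable_real_testMax_le (hm : 0 < m) (t : ℝ) :
    Measurable fun ω => S.P.real {ω' | testMax S (L.witness (S.fitData ω)) ω' ≤ t} := by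
  simp_rw [← L.integral_maxIndicator hm t]
  exact (measurable_integral_toTest (L.measurable_maxIndicator hm t)).comp measurable_fitData

/-- The distribution function of the max statistic as a mixture. -/
lemma Learner.real_maxStat_le (hm : 0 < m) (t : ℝ) : S.P.real {ω | L.maxStat ω ≤ t} =
    ∫ ω, S.P.real {ω' | testMax S (L.witness (S.fitData ω)) ω' ≤ t} ∂S.P := by
  have hF1 : ∀ z ω, |L.maxIndicator t z ω| ≤ 1 := by
    intro z ω
    simp only [Learner.maxIndicator, Set.indicator_apply]
    split_ifs <;> simp
  have hs : MeasurableSet {ω : S.Ω | L.maxStat ω ≤ t} := L.measurable_maxStat hm measurableSet_Iic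
  have e1 : ∫ ω, L.maxIndicator t (S.fitData ω) (S.toTest ω) ∂S.P =
      S.P.real {ω | L.maxStat ω ≤ t} := integral_indicator_one hs
  rw [← e1, integral_fitData_toTest (L.measurable_maxIndicator hm t) hF1]
  simp_rw [L.integral_maxIndicator hm t]

/-- A bound for the distance of the distribution functions, given the fitting data, holds on
average. -/
lemma Learner.abs_real_maxStat_sub_le (hm : 0 < m) {t q : ℝ} {b : S.Ω → ℝ}
    (hb : Integrable b S.P)
    (h : ∀ᵐ ω ∂S.P, |S.P.real {ω' | testMax S (L.witness (S.fitData ω)) ω' ≤ t} - q| ≤ b ω) :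
    |S.P.real {ω | L.maxStat ω ≤ t} - q| ≤ ∫ ω, b ω ∂S.P := by
  have hi : Integrable (fun ω => S.P.real {ω' | testMax S (L.witness (S.fitData ω)) ω' ≤ t})
      S.P := by
    refine integrable_of_abs_le (B := 1) (L.measurable_real_testMax_le hm t) fun ω => ?_
    rw [abs_of_nonneg measureReal_nonneg]
    exact measureReal_le_one
  have e : S.P.real {ω | L.maxStat ω ≤ t} - q =
      ∫ ω, (S.P.real {ω' | testMax S (L.witness (S.fitData ω)) ω' ≤ t} - q) ∂S.P := by
    rw [integral_sub hi (integrable_const _), ← L.real_maxStat_le hm]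
    simp
  rw [e]
  exact abs_integral_le_integral_abs.trans
    (integral_mono_ae (hi.sub (integrable_const _)).abs hb h)

end Witness

/-! ### The two conclusions. -/

/-- Convergence in distribution of real random variables follows from the convergence of the
distribution functions at all points. -/
lemma tendstoInDistribution_of_tendsto_real {Ω : ℕ → Type*} {Ω' : Type*}
    [∀ r, MeasurableSpace (Ω r)] [MeasurableSpace Ω'] {P : ∀ r, Measure (Ω r)} {Q : Measure Ω'}
    [∀ r, IsProbabilityMeasure (P r)] [IsProbabilityMeasure Q] {T : ∀ r, Ω r → ℝ} {Z : Ω' → ℝ}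
    (hT : ∀ r, Measurable (T r)) (hZ : Measurable Z)
    (h : ∀ t, Tendsto (fun r => (P r).real {ω | T r ω ≤ t}) atTop (𝓝 (Q.real {ω | Z ω ≤ t}))) :
    TendstoInDistribution T atTop Z P Q where
  forall_aemeasurable r := (hT r).aemeasurable
  aemeasurable_limit := hZ.aemeasurable
  tendsto := by
    -- Half-open intervals form a π-system containing neighbourhoods inside every open set, so
    -- convergence of their probabilities suffices.
    refine (isPiSystem_Ioc (id : ℝ → ℝ) id).tendsto_probabilityMeasure_of_tendsto_of_mem ?_ ?_ ?_
    · rintro s ⟨a, b, -, rfl⟩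
      exact measurableSet_Ioc
    · intro u hu x hx
      obtain ⟨ε, hε, hsub⟩ := Metric.isOpen_iff.1 hu x hx
      refine ⟨Set.Ioc (x - ε / 2) (x + ε / 2), ⟨x - ε / 2, x + ε / 2, ?_, rfl⟩,
        Ioc_mem_nhds (by linarith) (by linarith), fun y hy => hsub ?_⟩
      · simp only [id]; linarith
      · rw [Metric.mem_ball, Real.dist_eq, abs_lt]
        constructor <;> linarith [hy.1, hy.2]
    · rintro s ⟨a, b, hab, rfl⟩
      have hval : ∀ (ρ : Measure ℝ) [IsProbabilityMeasure ρ], ρ.real (Set.Ioc a b) =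
          ρ.real (Set.Iic b) - ρ.real (Set.Iic a) := by
        intro ρ _
        have e : Set.Ioc a b = Set.Iic b \ Set.Iic a := by
          ext x
          simp [and_comm]
        rw [e, measureReal_sdiff (Set.Iic_subset_Iic.2 (show a ≤ b from le_of_lt hab)) measurableSet_Iic]
      have hlim := (h b).sub (h a)
      rw [← NNReal.tendsto_coe]
      have : ∀ r, IsProbabilityMeasure ((P r).map (T r)) := fun r =>
        Measure.isProbabilityMeasure_map (hT r).aemeasurable
      have : IsProbabilityMeasure (Q.map Z) := Measure.isProbabilityMeasure_map hZ.aemeasurable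
      have e1 : ∀ r, ((P r).map (T r)).real (Set.Ioc a b) =
          (P r).real {ω | T r ω ≤ b} - (P r).real {ω | T r ω ≤ a} := fun r => by
        rw [hval, map_measureReal_apply (hT r) measurableSet_Iic,
          map_measureReal_apply (hT r) measurableSet_Iic]
        rfl
      have e2 : (Q.map Z).real (Set.Ioc a b) =
          Q.real {ω | Z ω ≤ b} - Q.real {ω | Z ω ≤ a} := by
        rw [hval, map_measureReal_apply hZ measurableSet_Iic,
          map_measureReal_apply hZ measurableSet_Iic]
        rfl
      change Tendsto (fun r => ((P r).map (T r)).real (Set.Ioc a b)) atTop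
        (𝓝 ((Q.map Z).real (Set.Ioc a b)))
      simp_rw [e1, e2]
      exact hlim

lemma exists_one_sub_stdNormal_box_le (m : ℕ) {η : ℝ} (hη : 0 < η) :
    ∃ R : ℝ, 0 ≤ R ∧ 1 - (stdNormal m).real (Set.Icc (fun _ => -R) (fun _ => R)) ≤ η := by
  have h1 : Tendsto (fun R : ℝ => 2 * m * Real.exp (-(R ^ 2 / 2))) atTop (𝓝 (2 * m * 0)) := by
    refine (Real.tendsto_exp_neg_atTop_nhds_zero.comp ?_).const_mul _
    exact (tendsto_pow_atTop (by norm_num)).atTop_div_const (by norm_num)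
  rw [mul_zero] at h1
  obtain ⟨R, hR, hR0⟩ := ((h1.eventually (eventually_le_nhds hη)).and
    (eventually_ge_atTop 0)).exists
  exact ⟨R, hR0, (one_sub_stdNormal_box_le m hR0).trans hR⟩

lemma Learner.ae_spectrum_popCov_subset {m : ℕ} {S : TwoSample.{u}} {L : Learner S m}
    {c₁ c₂ c c' : ℝ} (hc₁ : 0 < c₁) (hc₂ : c₂ < 1) (h0 : S.Null) (hS : S.SizesBalanced c₁ c₂)
    (hL : L.WellConditioned c c') :
    ∀ᵐ ω ∂S.P, spectrum ℝ (popCov S (L.witness (S.fitData ω))) ⊆ Set.Icc c c' := by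
  have hn2 := hS.two_le_n hc₁ hc₂
  have hn : (0 : ℝ) < S.n := by exact_mod_cast (by omega : 0 < S.n)
  have hκ := testRatio_pos hc₁ hc₂
  obtain ⟨ha, hb⟩ := hS.le_nTest hc₁ hc₂
  have ha0 : 0 < S.nxTest := by exact_mod_cast (by positivity : (0 : ℝ) < _).trans_le ha
  have hb0 : 0 < S.nyTest := by exact_mod_cast (by positivity : (0 : ℝ) < _).trans_le hb
  filter_upwards [hL, L.condCov_ae_eq h0 ha0 hb0] with ω h1 h2
  rwa [← h2]

/-- Distance of the distribution function of the max statistic from its limit, for bounded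
networks. -/
lemma Learner.exists_maxStat_bound_of_bounded {m : ℕ} (hm : 0 < m) {c₁ c₂ c c' : ℝ}
    (hc₁ : 0 < c₁) (hc₂ : c₂ < 1) (hc : 0 < c) (hc' : 0 < c') : ∃ C : ℝ, 0 ≤ C ∧
    ∀ (S : TwoSample.{u}) (L : Learner S m) (δ R : ℝ), S.Null → S.SizesBalanced c₁ c₂ →
      L.WellConditioned c c' → 0 < δ → δ ≤ 1 → m * δ ≤ c / 2 → 0 ≤ R → ∀ t,
      |S.P.real {ω | L.maxStat ω ≤ t} - (stdNormal m).real {z | maxAbs z ≤ t}| ≤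
        C * ((∑ j, L.B j) / √S.n) + C * ((((∑ j, L.B j) / √S.n) ^ 2 + 1 / S.n) / δ ^ 2) +
          (1 - (stdNormal m).real (Set.Icc (fun _ => -R) (fun _ => R))) + C * (δ * R) := by
  obtain ⟨C, hC0, hC⟩ := exists_testMax_bound_of_bounded.{u} hm hc₁ hc₂ hc hc'
  refine ⟨C, hC0, fun S L δ R h0 hS hL hδ hδ1 hmδ hR t => ?_⟩
  refine (L.abs_real_maxStat_sub_le hm (integrable_const _) ?_).trans
    (le_of_eq (by rw [integral_const, probReal_univ, one_smul]))
  filter_upwards [L.ae_spectrum_popCov_subset hc₁ hc₂ h0 hS hL] with ω hω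
  exact hC S _ _ δ R h0 hS (L.measurable_witness_apply _) (L.abs_witness_le_sum _) hω hδ hδ1 hmδ
    hR t

/-- Convergence of the distribution functions of the max statistic. -/
lemma Learner.tendsto_real_maxStat_le {m : ℕ} (hm : 0 < m) {c₁ c₂ c c' : ℝ} (hc₁ : 0 < c₁)
    (hc₂ : c₂ < 1) (hc : 0 < c) (hc' : 0 < c') {S : ℕ → TwoSample.{u}}
    {L : ∀ r, Learner (S r) m} (h0 : ∀ r, (S r).Null) (hS : ∀ r, (S r).SizesBalanced c₁ c₂)
    (hL : ∀ r, (L r).WellConditioned c c') (hn : Tendsto (fun r => (S r).n) atTop atTop)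
    (hB : ∀ j, Tendsto (fun r => (L r).B j / √((S r).n : ℝ)) atTop (𝓝 0)) (t : ℝ) :
    Tendsto (fun r => (S r).P.real {ω | (L r).maxStat ω ≤ t}) atTop
      (𝓝 ((stdNormal m).real {z | maxAbs z ≤ t})) := by
  obtain ⟨C, hC0, hC⟩ := Learner.exists_maxStat_bound_of_bounded.{u} hm hc₁ hc₂ hc hc'
  have hm' : (0 : ℝ) < m := by exact_mod_cast hm
  rw [Metric.tendsto_atTop']
  intro ε hε
  -- First `R` makes the Gaussian tail small, then `δ` depending on `R` makes `C δ R` small; both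
  -- being fixed, the remaining terms vanish as `n → ∞`.
  obtain ⟨R, hR0, hR⟩ := exists_one_sub_stdNormal_box_le m (η := ε / 4) (by positivity)
  set δ := min 1 (min (c / (2 * m)) (ε / (4 * (C * R + 1)))) with hδ
  have hCR : 0 ≤ C * R := by positivity
  have hδ0 : 0 < δ := by positivity
  have hδ1 : δ ≤ 1 := min_le_left _ _
  have hδ2 : m * δ ≤ c / 2 := by
    calc m * δ ≤ m * (c / (2 * m)) := by
          gcongr
          exact (min_le_right _ _).trans (min_le_left _ _)
      _ = c / 2 := by field_simp
  have hδ3 : C * (δ * R) ≤ ε / 4 := by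
    calc C * (δ * R) = δ * (C * R) := by ring
      _ ≤ ε / (4 * (C * R + 1)) * (C * R + 1) := by
          gcongr
          · exact (min_le_right _ _).trans (min_le_right _ _)
          · linarith
      _ = ε / 4 := by field_simp
  have hx : Tendsto (fun r => (∑ j, (L r).B j) / √((S r).n : ℝ)) atTop (𝓝 0) := by
    simp_rw [Finset.sum_div]
    simpa using tendsto_finsetSum Finset.univ fun j _ => hB j
  have hinv : Tendsto (fun r => 1 / ((S r).n : ℝ)) atTop (𝓝 0) :=
    tendsto_one_div_atTop_nhds_zero_nat.comp hn
  have hlim : Tendsto (fun r => C * ((∑ j, (L r).B j) / √((S r).n : ℝ)) +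
      C * ((((∑ j, (L r).B j) / √((S r).n : ℝ)) ^ 2 + 1 / ((S r).n : ℝ)) / δ ^ 2)) atTop
      (𝓝 (C * 0 + C * ((0 ^ 2 + 0) / δ ^ 2))) :=
    (hx.const_mul C).add ((((hx.pow 2).add hinv).div_const _).const_mul C)
  have hev := hlim.eventually (eventually_lt_nhds (b := ε / 4) (by simpa using by positivity))
  obtain ⟨N, hN⟩ := eventually_atTop.1 hev
  refine ⟨N, fun r hr => ?_⟩
  rw [Real.dist_eq]
  have h1 := hC (S r) (L r) δ R (h0 r) (hS r) (hL r) hδ0 hδ1 hδ2 hR0 t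
  have h2 := hN r hr.le
  linarith

lemma Learner.measurable_integral_witness {m : ℕ} {S : TwoSample.{u}} (L : Learner S m) {h : ℝ → ℝ}
    (hh : Measurable h) (j : Fin m) :
    Measurable fun ω => ∫ x, h (L.witness (S.fitData ω) j x) ∂S.μ := by
  have h1 : Measurable fun p : S.FitSpace × (Fin S.d → ℝ) => h (L.witness p.1 j p.2) :=
    hh.comp (L.measurable_witness j)
  exact (h1.stronglyMeasurable.integral_prod_right' (ν := S.μ)).measurable.comp measurable_fitData

lemma Learner.integrable_cube_witness {m : ℕ} {S : TwoSample.{u}} (L : Learner S m) (j : Fin m) :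
    Integrable (fun ω => ∫ x, |L.witness (S.fitData ω) j x| ^ 3 ∂S.μ) S.P := by
  refine integrable_of_abs_le (B := L.B j ^ 3)
    (L.measurable_integral_witness (h := fun y => |y| ^ 3) (measurable_id.abs.pow_const 3) j)
    fun ω => abs_integral_le_of_abs_le fun x => ?_
  rw [abs_pow, abs_abs]
  exact pow_le_pow_left₀ (abs_nonneg _) (L.abs_witness_le _ j x) 3

lemma Learner.integral_cube_witness_le {m : ℕ} {S : TwoSample.{u}} (L : Learner S m)
    (h0 : S.Null) (j : Fin m) :
    ∫ ω, ∫ x, |L.witness (S.fitData ω) j x| ^ 3 ∂S.μ ∂S.P ≤ L.thirdMoment := by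
  have h1 : ∫ ω, ∫ x, |L.witness (S.fitData ω) j x| ^ 3 ∂S.μ ∂S.P ≤
      ∫ ω, (L.condExpWitness S.μ (fun y => |y| ^ 3) j ω +
        L.condExpWitness S.ν (fun y => |y| ^ 3) j ω) ∂S.P := by
    rw [← show S.μ = S.ν from h0]
    refine integral_mono (L.integrable_cube_witness j)
      ((L.integrable_cube_witness j).add (L.integrable_cube_witness j)) fun ω => ?_
    have : 0 ≤ L.condExpWitness S.μ (fun y => |y| ^ 3) j ω :=
      integral_nonneg fun x => by positivity
    exact le_add_of_nonneg_left this
  exact h1.trans (le_ciSup (f := fun j => ∫ ω, (L.condExpWitness S.μ (fun y => |y| ^ 3) j ω +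
        L.condExpWitness S.ν (fun y => |y| ^ 3) j ω) ∂S.P) (Set.finite_range _).bddAbove j)

/-- Distance of the distribution function of the max statistic from its limit, for sub-Gaussian
witnesses. -/
lemma Learner.exists_maxStat_bound_of_subGaussian {m : ℕ} (hm : 0 < m) {c₁ c₂ c c' : ℝ}
    (hc₁ : 0 < c₁) (hc₂ : c₂ < 1) (hc : 0 < c) : ∃ C : ℝ, 0 < C ∧
    ∀ (S : TwoSample.{u}) (L : Learner S m) (M : ℝ), S.Null → S.SizesBalanced c₁ c₂ →
      L.WellConditioned c c' → 0 < M → L.SubGaussian M → ∀ t,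
      |S.P.real {ω | L.maxStat ω ≤ t} - (stdNormal m).real {z | maxAbs z ≤ t}| ≤
        C * (L.thirdMoment / √S.n) + C * (M ^ 2 * Real.log S.n / √S.n) := by
  obtain ⟨C, hC0, hC⟩ := exists_testMax_bound_of_subGaussian.{u} hm hc₁ hc₂ hc
  refine ⟨C * m + C + 1, by positivity, fun S L M h0 hS hL hM hsub t => ?_⟩
  have hn1 : (1 : ℝ) ≤ S.n := by
    have := hS.two_le_n hc₁ hc₂
    exact_mod_cast (by omega : 1 ≤ S.n)
  have hlog : 0 ≤ Real.log S.n := Real.log_nonneg hn1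
  have hG0 : 0 ≤ L.thirdMoment :=
    (integral_nonneg fun ω => integral_nonneg fun x => by positivity).trans
      (L.integral_cube_witness_le h0 ⟨0, hm⟩)
  have hib : Integrable (fun ω => ∑ j, ∫ x, |L.witness (S.fitData ω) j x| ^ 3 ∂S.μ) S.P :=
    integrable_finsetSum _ fun j _ => L.integrable_cube_witness j
  have hb1 := (hib.div_const (√S.n)).const_mul C
  set Q := C * (M ^ 2 * Real.log S.n / √S.n)
  -- The conditional bound is random through the third moments of the learned witnesses; its average
  -- is controlled by `thirdMoment`.
  have key := L.abs_real_maxStat_sub_le hm (t := t) (q := (stdNormal m).real {z | maxAbs z ≤ t})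
    (hb1.add (integrable_const Q)) (by
      filter_upwards [L.ae_spectrum_popCov_subset hc₁ hc₂ h0 hS hL, ae_all_iff.2 hsub]
        with ω h1 h2
      exact hC S _ _ M h0 hS (L.measurable_witness_apply _) (L.abs_witness_le_sum _)
        (h1.trans Set.Icc_subset_Ici_self) hM (fun j => (h2 j).1) t)
  rw [integral_add' hb1 (integrable_const Q), integral_const_mul, integral_div,
    integral_finsetSum _ fun j _ => L.integrable_cube_witness j, integral_const, probReal_univ,
    one_smul] at key
  have hsum : ∑ j, ∫ ω, ∫ x, |L.witness (S.fitData ω) j x| ^ 3 ∂S.μ ∂S.P ≤ m * L.thirdMoment := by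
    simpa using Finset.sum_le_card_nsmul Finset.univ _ _ fun j _ => L.integral_cube_witness_le h0 j
  calc _ ≤ _ := key
    _ ≤ C * (m * L.thirdMoment / √S.n) + Q := by gcongr
    _ = C * m * (L.thirdMoment / √S.n) + C * (M ^ 2 * Real.log S.n / √S.n) := by
        simp only [Q]; ring
    _ ≤ _ := by
        gcongr
        · linarith
        · have : 0 ≤ C * m := by positivity
          linarith

end

end NeuralTwoSample

theorem theorem1 (m : ℕ) (hm : 0 < m) (c₁ c₂ c₁' c₂' : ℝ)
    (hc₁ : 0 < c₁) (hc : c₁ ≤ c₂) (hc₂ : c₂ < 1) (hc₁' : 0 < c₁') (hc₂' : 0 < c₂') :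
    (∀ (S : ℕ → NeuralTwoSample.TwoSample.{u})
        (L : ∀ r, NeuralTwoSample.Learner (S r) m),
      (∀ r, (S r).Null) →
      (∀ r, (S r).SizesBalanced c₁ c₂) →
      (∀ r, (L r).WellConditioned c₁' c₂') →
      Tendsto (fun r => (S r).n) atTop atTop →
      (∀ j, Tendsto (fun r => (L r).B j / √((S r).n : ℝ)) atTop (𝓝 0)) →
      TendstoInDistribution (fun r => (L r).maxStat) atTop
        (NeuralTwoSample.maxAbs : (Fin m → ℝ) → ℝ)
        (fun r => (S r).P) (NeuralTwoSample.stdNormal m)) ∧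
    ∃ c : ℝ, 0 < c ∧
      ∀ (S : NeuralTwoSample.TwoSample.{u}) (L : NeuralTwoSample.Learner S m) (M : ℝ),
        S.Null → S.SizesBalanced c₁ c₂ → L.WellConditioned c₁' c₂' →
        0 < M → L.SubGaussian M →
        ∀ t : ℝ,
          |S.P.real {ω | L.maxStat ω ≤ t} -
              (NeuralTwoSample.stdNormal m).real {z | NeuralTwoSample.maxAbs z ≤ t}| ≤
            c * (L.thirdMoment / √(S.n : ℝ)) +
              c * (M ^ 2 * Real.log (S.n : ℝ) / √(S.n : ℝ)) := by
  refine ⟨fun S L h0 hS hL hn hB => ?_,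
    NeuralTwoSample.Learner.exists_maxStat_bound_of_subGaussian hm hc₁ hc₂ hc₁'⟩
  exact NeuralTwoSample.tendstoInDistribution_of_tendsto_real
    (fun r => (L r).measurable_maxStat hm) (NeuralTwoSample.measurable_maxAbs hm)
    (NeuralTwoSample.Learner.tendsto_real_maxStat_le hm hc₁ hc₂ hc₁' hc₂' h0 hS hL hn hB)
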